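/- Theorem 3.2 (asynchronous $n$-step V-trace, constant stepsize). Consider a finite Markov decision process with state space $\mathcal S$, $|\mathcal S|\ge 2$, finite action space $\mathcal A$, transition matrices $P_a$, rewards $\mathcal R(s,a)\in[0,1]$ and discount factor $\gamma\in(0,1)$. Let $\pi$ (target) and $\pi_b$ (behavior) be policies such that $\pi(a|s)>0$ implies $\pi_b(a|s)>0$, and such that the Markov chain $\mathcal M_S$ of states under $\pi_b$, with transition matrix $P_{\pi_b}(s,s')=\sum_a\pi_b(a|s)P_a(s,s')$, is irreducible and aperiodic; let $\kappa_b$ be its stationary distribution and, for $\delta>0$, $t_\delta(\mathcal M_S)=\min\{k\ge0:\max_s\|P_{\pi_b}^k(s,\cdot)-\kappa_b\|_{\mathrm{TV}}\le\delta\}$. Let $n\ge1$ be an integer, $\bar\rho\ge\bar c\ge1$, $c(s,a)=\min(\bar c,\pi(a|s)/\pi_b(a|s))$ and $\rho(s,a)=\min(\bar\rho,\pi(a|s)/\pi_b(a|s))$. Let $\{(S_k,A_k)\}_{k\ge 0}$ be a trajectory collected under $\pi_b$ with an arbitrary initial state distribution, let $V_0\in\mathbb R^{\mathcal S}$ and $\alpha>0$,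 and for $k\ge0$ let $$V_{k+1}(S_k)=V_k(S_k)+\alpha\sum_{i=k}^{k+n-1}\gamma^{i-k}\Big(\prod_{j=k}^{i-1}c(S_j,A_j)\Big)\rho(S_i,A_i)\big(\mathcal R(S_i,A_i)+\gamma V_k(S_{i+1})-V_k(S_i)\big),$$ and $V_{k+1}(s)=V_k(s)$ for $s\ne S_k$. Put $C(s)=\sum_a\min(\bar c\,\pi_b(a|s),\pi(a|s))$, $D(s)=\sum_a\min(\bar\rho\,\pi_b(a|s),\pi(a|s))$, $\pi_{\bar\rho}(a|s)=\min(\bar\rho\,\pi_b(a|s),\pi(a|s))/D(s)$, and let $V_{\pi_{\bar\rho}}(s)=\mathbb E_{\pi_{\bar\rho}}[\sum_{k\ge0}\gamma^k\mathcal R(S_k,A_k)\mid S_0=s]$. Let $C_{\min},D_{\min},\mathcal K_{\min}$ be the minima over $s$ of $C(s)$, $D(s)$, $\kappa_b(s)$, let $\eta=\frac{1-(\gamma\bar c)^n}{1-\gamma\bar c}$ if $\gamma\bar c\ne1$ and $\eta=n$ if $\gamma\bar c=1$, and let $$\beta_2=1-\mathcal K_{\min}\frac{(1-\gamma)(1-(\gamma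 C_{\min})^n)D_{\min}}{1-\gamma C_{\min}}.$$ There is a numerical constant $c_{V,0}>0$, independent of all the data above, such that, whenever $$\alpha\,(t_\alpha(\mathcal M_S)+n)\le c_{V,0}\frac{(1-\beta_2)^2}{(\bar\rho+1)^2\eta^2\log|\mathcal S|},$$ one has for all $k\ge t_\alpha(\mathcal M_S)+n$ $$\mathbb E\big[\|V_k-V_{\pi_{\bar\rho}}\|_\infty^2\big]\le c_{V,1}\Big(1-\frac{1-\beta_2}{2}\alpha\Big)^{k-(t_\alpha(\mathcal M_S)+n)}+c_{V,2}\frac{\log|\mathcal S|\,(\bar\rho+1)^2\eta^2}{(1-\beta_2)^2}\,\alpha\,(t_\alpha(\mathcal M_S)+n),$$ where $c_{V,1}=3(\|V_0-V_{\pi_{\bar\rho}}\|_\infty+\|V_0\|_\infty+1)^2$ and $c_{V,2}=3648e(\|V_{\pi_{\bar\rho}}\|_\infty+1)^2$. -/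

import Mathlib

open MeasureTheory ProbabilityTheory

noncomputable section

/-- A finite Markov decision process: row-stochastic matrices `P a` of transition probabilities
`P a s s'`, a reward function with values in `[0, 1]` and a discount factor `γ ∈ (0, 1)`. -/
structure MDP (S A : Type*) [Fintype S] where
  P : A → Matrix S S ℝ
  P_nonneg : ∀ a s s', 0 ≤ P a s s'
  P_sum : ∀ a s, ∑ s', P a s s' = 1
  R : S → A → ℝ
  R_mem : ∀ s a, R s a ∈ Set.Icc (0 : ℝ) 1
  γ : ℝ
  γ_pos : 0 < γ
  γ_lt_one : γ < 1

/-- A (stationary, randomized) policy; `π.prob s a` is `π(a | s)`. -/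
structure Policy (S A : Type*) [Fintype A] where
  prob : S → A → ℝ
  nonneg : ∀ s a, 0 ≤ prob s a
  sum_one : ∀ s, ∑ a, prob s a = 1

/-- A nonnegative weight function on a finite type with total mass `1`, as a `PMF`. -/
def pmfOfReal {ι : Type*} [Fintype ι] (f : ι → ℝ) (h0 : ∀ i, 0 ≤ f i) (h1 : ∑ i, f i = 1) :
    PMF ι :=
  PMF.ofFintype (fun i => ENNReal.ofReal (f i)) (by
    rw [← ENNReal.ofReal_sum_of_nonneg (fun i _ => h0 i), h1, ENNReal.ofReal_one])

section Basic

variable {S A : Type*} [Fintype S] [Fintype A]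

namespace Policy

/-- The distribution `π(· | s)`. -/
def pmf (π : Policy S A) (s : S) : PMF A :=
  pmfOfReal (π.prob s) (π.nonneg s) (π.sum_one s)

/-- The joint law of `(S_0, A_0)` when `S_0 = s` and `A_0 ∼ π(· | s)`. -/
def startPMF (π : Policy S A) (s : S) : PMF (S × A) :=
  (π.pmf s).map (Prod.mk s)

end Policy

namespace MDP

/-- The distribution `P_a(s, ·)` of the next state. -/
def nextState (M : MDP S A) (s : S) (a : A) : PMF S :=
  pmfOfReal (M.P a s) (M.P_nonneg a s) (M.P_sum a s)

/-- The law of `(S_{k+1}, A_{k+1})` given `(S_k, A_k) = x` under the policy `π`. -/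
def nextPMF (M : MDP S A) (π : Policy S A) (x : S × A) : PMF (S × A) :=
  (M.nextState x.1 x.2).bind fun s' => π.startPMF s'

/-- The one-step kernel of the state-action chain, as a kernel on histories up to time `n`. -/
def stepKernel [MeasurableSpace S] [DiscreteMeasurableSpace S] [MeasurableSpace A]
    [DiscreteMeasurableSpace A] (M : MDP S A) (π : Policy S A) (n : ℕ) :
    Kernel ((i : Finset.Iic n) → (fun _ : ℕ => S × A) i) (S × A) :=
  (Kernel.ofFunOfCountable fun x : S × A => (M.nextPMF π x).toMeasure).comap
    (fun h => h ⟨n, Finset.mem_Iic.2 le_rfl⟩) (measurable_pi_apply _)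

instance [MeasurableSpace S] [DiscreteMeasurableSpace S] [MeasurableSpace A]
    [DiscreteMeasurableSpace A] (M : MDP S A) (π : Policy S A) (n : ℕ) :
    IsMarkovKernel (M.stepKernel π n) :=
  ⟨fun h => by
    change IsProbabilityMeasure
      ((M.nextPMF π (h ⟨n, Finset.mem_Iic.2 le_rfl⟩)).toMeasure)
    infer_instance⟩

/-- The law of the infinite trajectory `(S_0, A_0, S_1, A_1, …)` started at `S_0 = s`, with
actions selected by `π`. -/
def pathMeasure [MeasurableSpace S] [DiscreteMeasurableSpace S] [MeasurableSpace A]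
    [DiscreteMeasurableSpace A] (M : MDP S A) (π : Policy S A) (s : S) :
    Measure (ℕ → S × A) :=
  Kernel.trajMeasure (X := fun _ : ℕ => S × A) (π.startPMF s).toMeasure (M.stepKernel π)

/-- The value function `V_π(s) = E_π[∑ₖ γᵏ R(S_k, A_k) | S_0 = s]`. -/
def value [MeasurableSpace S] [DiscreteMeasurableSpace S] [MeasurableSpace A]
    [DiscreteMeasurableSpace A] (M : MDP S A) (π : Policy S A) (s : S) : ℝ :=
  ∫ ω, ∑' k : ℕ, M.γ ^ k * M.R (ω k).1 (ω k).2 ∂(M.pathMeasure π s)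

/-- The transition matrix `P_π(s, s') = ∑ₐ π(a | s) P_a(s, s')` of the state chain under `π`. -/
def stateMatrix (M : MDP S A) (π : Policy S A) : Matrix S S ℝ :=
  Matrix.of fun s s' => ∑ a, π.prob s a * M.P a s s'

/-- The state-action process `(X k, Z k)`, `k = 0, 1, …`, on the probability space `(Ω, μ)` is
collected by following `π` in `M`, with an arbitrary law of the initial state: given the past,
`Z k ∼ π(· | X k)` and `X (k + 1) ∼ P_{Z k}(X k, ·)`, expressed through the probabilities of all
finite trajectories. -/
structure IsTrajectory [MeasurableSpace S] [MeasurableSpace A] (M : MDP S A) (π : Policy S A)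
    {Ω : Type*} [MeasurableSpace Ω] (μ : Measure Ω) (X : ℕ → Ω → S) (Z : ℕ → Ω → A) : Prop where
  measurable_state : ∀ k, Measurable (X k)
  measurable_action : ∀ k, Measurable (Z k)
  prob_path : ∀ (m : ℕ) (s : ℕ → S) (a : ℕ → A),
    μ.real {ω | ∀ i ≤ m, X i ω = s i ∧ Z i ω = a i} =
      μ.real {ω | X 0 ω = s 0} * (∏ i ∈ Finset.range (m + 1), π.prob (s i) (a i)) *
        ∏ i ∈ Finset.range m, M.P (a i) (s i) (s (i + 1))

end MDP

end Basic

section MarkovChain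

variable {S : Type*} [Fintype S]

/-- `κ` is a stationary distribution of the chain with transition matrix `P`. -/
def IsStationaryDist (P : Matrix S S ℝ) (κ : S → ℝ) : Prop :=
  (∀ s, 0 ≤ κ s) ∧ ∑ s, κ s = 1 ∧ Matrix.vecMul κ P = κ

/-- The stationary distribution of the chain with transition matrix `P` (when there is exactly
one, as for irreducible chains, it is that one). -/
def stationaryDist (P : Matrix S S ℝ) : S → ℝ :=
  Classical.epsilon (IsStationaryDist P)

/-- The chain with transition matrix `P` is aperiodic: for each state `s` the greatest common
divisor of the return times `{k ≥ 1 | P^k(s, s) > 0}` is `1`. -/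
def IsAperiodicChain [DecidableEq S] (P : Matrix S S ℝ) : Prop :=
  ∀ s, ∀ d : ℕ, (∀ k : ℕ, 1 ≤ k → 0 < (P ^ k) s s → d ∣ k) → d = 1

/-- The total variation distance of two distributions on a finite set. -/
def tvDist (p q : S → ℝ) : ℝ := (1 / 2) * ∑ s, |p s - q s|

/-- The mixing time
`t_δ = min {k ≥ 0 | max_s ‖P^k(s, ·) - κ‖_TV ≤ δ}`, `κ` the stationary distribution. -/
def mixingTime [DecidableEq S] (P : Matrix S S ℝ) (δ : ℝ) : ℕ :=
  sInf {k : ℕ | ∀ s, tvDist ((P ^ k) s) (stationaryDist P) ≤ δ}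

end MarkovChain

section VTrace

variable {S A : Type*} [Fintype A]

/-- Coverage: every action that the target policy `π` may select, `πb` may select as well. -/
def Covers (πb π : Policy S A) : Prop :=
  ∀ s a, 0 < π.prob s a → 0 < πb.prob s a

/-- The truncated importance sampling ratio `min(τ, π(a | s) / πb(a | s))`. Pairs with
`πb(a | s) = 0` have probability zero along trajectories of `πb`. -/
def truncRatio (πb π : Policy S A) (τ : ℝ) (s : S) (a : A) : ℝ :=
  min τ (π.prob s a / πb.prob s a)

/-- `∑ₐ min(τ πb(a | s), π(a | s))`: this is `C(s)` for `τ = c̄` and `D(s)` for `τ = ρ̄`. -/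
def truncMass (πb π : Policy S A) (τ : ℝ) (s : S) : ℝ :=
  ∑ a, min (τ * πb.prob s a) (π.prob s a)

theorem truncMass_pos (πb π : Policy S A) {τ : ℝ} (hτ : 1 ≤ τ) (hcov : Covers πb π) (s : S) :
    0 < truncMass πb π τ s := by
  have hτ0 : 0 < τ := lt_of_lt_of_le one_pos hτ
  have hnn : ∀ a ∈ Finset.univ, 0 ≤ min (τ * πb.prob s a) (π.prob s a) := fun a _ =>
    le_min (mul_nonneg hτ0.le (πb.nonneg s a)) (π.nonneg s a)
  obtain ⟨a, ha, hpos⟩ : ∃ a ∈ Finset.univ, 0 < π.prob s a := by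
    apply Finset.exists_lt_of_sum_lt (f := fun _ => (0 : ℝ))
    simp [π.sum_one s]
  exact Finset.sum_pos' hnn ⟨a, ha, lt_min (mul_pos hτ0 (hcov s a hpos)) hpos⟩

/-- The policy `π_τ(a | s) = min(τ πb(a | s), π(a | s)) / ∑_b min(τ πb(b | s), π(b | s))`. -/
def truncPolicy (πb π : Policy S A) (τ : ℝ) (hτ : 1 ≤ τ) (hcov : Covers πb π) : Policy S A where
  prob s a := min (τ * πb.prob s a) (π.prob s a) / truncMass πb π τ s
  nonneg s a := div_nonneg
    (le_min (mul_nonneg (zero_le_one.trans hτ) (πb.nonneg s a)) (π.nonneg s a))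
    (truncMass_pos πb π hτ hcov s).le
  sum_one s := by
    rw [← Finset.sum_div]
    exact div_self (truncMass_pos πb π hτ hcov s).ne'

/-- `η(γ, c̄) = (1 - (γ c̄)^n) / (1 - γ c̄)`, and `n` when `γ c̄ = 1`. -/
def eta (n : ℕ) (γ c : ℝ) : ℝ :=
  if γ * c = 1 then n else (1 - (γ * c) ^ n) / (1 - γ * c)

end VTrace

namespace MDP

variable {S A : Type*} [Fintype S] [Fintype A]

/-- The contraction factor
`β₂ = 1 - K_min (1 - γ) (1 - (γ C_min)^n) D_min / (1 - γ C_min)`, with `K_min`, `C_min`, `D_min`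
the minima over the states of the stationary distribution of the chain under `πb`, of `C` and
of `D`. -/
def beta (M : MDP S A) (πb π : Policy S A) (n : ℕ) (cbar rhobar : ℝ) : ℝ :=
  let Kmin := ⨅ s, stationaryDist (M.stateMatrix πb) s
  let Cmin := ⨅ s, truncMass πb π cbar s
  let Dmin := ⨅ s, truncMass πb π rhobar s
  1 - Kmin * ((1 - M.γ) * (1 - (M.γ * Cmin) ^ n) * Dmin / (1 - M.γ * Cmin))

/-- The temporal difference `Γ(V, s, a, s') = R(s, a) + γ V(s') - V(s)`. -/
def tempDiff (M : MDP S A) (V : S → ℝ) (s : S) (a : A) (s' : S) : ℝ :=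
  M.R s a + M.γ * V s' - V s

/-- The asynchronous `n`-step V-trace iterates `V_k` along the state-action sequence
`(x 0, z 0), (x 1, z 1), …`, with stepsizes `α k` and initialization `V₀`. Only the entry of the
current state `x k` is updated, by
`α_k ∑_{i=k}^{k+n-1} γ^{i-k} (∏_{j=k}^{i-1} c(x_j, z_j)) ρ(x_i, z_i) Γ(V_k, x_i, z_i, x_{i+1})`. -/
def vtrace [DecidableEq S] (M : MDP S A) (πb π : Policy S A) (n : ℕ) (cbar rhobar : ℝ)
    (α : ℕ → ℝ) (V₀ : S → ℝ) (x : ℕ → S) (z : ℕ → A) : ℕ → S → ℝ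
  | 0 => V₀
  | k + 1 => fun s =>
    let V := vtrace M πb π n cbar rhobar α V₀ x z k
    if s = x k then
      V s + α k * ∑ i ∈ Finset.range n,
        M.γ ^ i * (∏ j ∈ Finset.range i, truncRatio πb π cbar (x (k + j)) (z (k + j))) *
          truncRatio πb π rhobar (x (k + i)) (z (k + i)) *
          M.tempDiff V (x (k + i)) (z (k + i)) (x (k + i + 1))
    else V s

end MDP

end

/-! Write `δ = 1 - β₂`, `d = |S|` and let `V*` be the value function of the truncated policy.
Averaged over the stationary law of the current state, one update moves `V` by `α m(V)`, where `V ↦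
V + m(V)` is affine, fixes `V*` and contracts the sup norm by `β₂`: its linear part has nonnegative
entries and row sums at most `β₂` (`norm_sub_value_add_meanIncr_le`).

The sup norm is not smooth, so the Lyapunov function is the squared `ℓ^p` norm of `V_k - V*`, with
`p` an even integer of order `log d / δ`. For this `p` there is a factor `u` with `d ≤ u^p` and `u
(1 - δ) ≤ 1 - δ/2`, hence the two norms differ by at most `u` and half of the contraction gap
survives. The squared norm is smooth with respect to the sup norm with constant `L = O(p) = O(log d
/ δ)`, which is the source of the logarithm in the bound (`sum_abs_powDual_sub_le`,
`powNorm_add_sq_le`, `exists_exponent`).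

The samples are Markovian, so the increment at time `k` is not centered given `V_k`. It is compared
with the increment evaluated at `V_j`, `j = k - (t + n)`. As an update looks `n` steps ahead, `V_j`
is a function of the history up to time `j + n`; from there the state chain has `t` steps to mix
before time `k`, so the conditional law of `S_k` is within `α` of stationarity in total variation
(`integral_bias_le`). Replacing `V_k` by `V_j` costs a relative error of order `ε = α a (t + n)`,
where `a = 2 ρ̄ η` bounds the growth and the Lipschitz constant of the increments.

Together these give `E_{k+1} ≤ (1 - δ α) E_k + O(L ε a) α (E_k + (‖V*‖ + 1)²)` for the expected
squared `ℓ^p` error. The stepsize condition lets half of the drift absorb the `E_k` part of the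
noise (`integral_powNorm_sq_succ_le`), and the recursion is summed from time `t + n`, before which
the iterates have hardly moved. -/

noncomputable section

/-! ### Smoothness of the squared `ℓ^p` norm with respect to the sup norm. -/

section PowerNorm

/-- Pair the indices `i` and `j = k - 1 - i`: since powers are monotone, `(a^i - b^i)(a^j - b^j) ≥
0`, so each pair is at most `a^(k-1) + b^(k-1)`. -/
theorem sum_range_pow_mul_pow_le {a b : ℝ} (ha : 0 ≤ a) (hb : 0 ≤ b) (k : ℕ) :
    2 * ∑ i ∈ Finset.range k, a ^ i * b ^ (k - 1 - i) ≤ k * (a ^ (k - 1) + b ^ (k - 1)) := by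
  have h : ∑ i ∈ Finset.range k, a ^ i * b ^ (k - 1 - i) =
      ∑ i ∈ Finset.range k, a ^ (k - 1 - i) * b ^ i := by
    rw [← Finset.sum_range_reflect]
    refine Finset.sum_congr rfl fun i hi => ?_
    have := Finset.mem_range.1 hi
    congr 2
    omega
  have hterm : ∀ i ∈ Finset.range k,
      a ^ i * b ^ (k - 1 - i) + a ^ (k - 1 - i) * b ^ i ≤ a ^ (k - 1) + b ^ (k - 1) := by
    intro i hi
    have hi' := Finset.mem_range.1 hi
    have e : k - 1 = i + (k - 1 - i) := by omega
    generalize k - 1 - i = j at *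
    rw [e, pow_add, pow_add]
    have : 0 ≤ (a ^ i - b ^ i) * (a ^ j - b ^ j) := by
      rcases le_total a b with hab | hab
      · exact mul_nonneg_of_nonpos_of_nonpos
          (sub_nonpos.2 (pow_le_pow_left₀ ha hab _)) (sub_nonpos.2 (pow_le_pow_left₀ ha hab _))
      · exact mul_nonneg
          (sub_nonneg.2 (pow_le_pow_left₀ hb hab _)) (sub_nonneg.2 (pow_le_pow_left₀ hb hab _))
    nlinarith
  calc 2 * ∑ i ∈ Finset.range k, a ^ i * b ^ (k - 1 - i)
      = ∑ i ∈ Finset.range k, (a ^ i * b ^ (k - 1 - i) + a ^ (k - 1 - i) * b ^ i) := by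
        rw [Finset.sum_add_distrib, ← h]; ring
    _ ≤ ∑ i ∈ Finset.range k, (a ^ (k - 1) + b ^ (k - 1)) := Finset.sum_le_sum hterm
    _ = _ := by simp [mul_add]

/-- Trapezoidal bound for the increments of a power. -/
theorem abs_pow_sub_pow_le_trapezoid (a b : ℝ) (k : ℕ) :
    |a ^ k - b ^ k| ≤ k / 2 * (|a| ^ (k - 1) + |b| ^ (k - 1)) * |a - b| := by
  rw [← Commute.geom_sum₂_mul (Commute.all a b), abs_mul]
  refine mul_le_mul_of_nonneg_right ?_ (abs_nonneg _)
  have h1 : |∑ i ∈ Finset.range k, a ^ i * b ^ (k - 1 - i)| ≤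
      ∑ i ∈ Finset.range k, |a| ^ i * |b| ^ (k - 1 - i) := by
    refine (Finset.abs_sum_le_sum_abs _ _).trans_eq ?_
    simp [abs_mul, abs_pow]
  have h2 := sum_range_pow_mul_pow_le (abs_nonneg a) (abs_nonneg b) k
  linarith

/-- Young's inequality with integer exponents, from weighted AM-GM with weights `i/(i+j)` and
`j/(i+j)`; summed over normalized vectors it gives Hölder. -/
theorem mul_pow_mul_pow_le {a b : ℝ} (ha : 0 ≤ a) (hb : 0 ≤ b) (i j : ℕ) :
    ((i + j : ℕ) : ℝ) * (a ^ i * b ^ j) ≤ i * a ^ (i + j) + j * b ^ (i + j) := by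
  rcases Nat.eq_zero_or_pos (i + j) with h0 | hp
  · have : i = 0 ∧ j = 0 := by omega
    simp [this.1, this.2]
  have hpR : (0 : ℝ) < ((i + j : ℕ) : ℝ) := by exact_mod_cast hp
  have h := Real.geom_mean_le_arith_mean2_weighted (w₁ := i / ((i + j : ℕ) : ℝ))
    (w₂ := j / ((i + j : ℕ) : ℝ)) (p₁ := a ^ (i + j)) (p₂ := b ^ (i + j)) (by positivity)
    (by positivity) (by positivity) (by positivity) (by rw [← add_div, ← Nat.cast_add, div_self hpR.ne'])
  have e : ∀ (c : ℝ) (l : ℕ), 0 ≤ c →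
      (c ^ (i + j)) ^ ((l : ℝ) / ((i + j : ℕ) : ℝ)) = c ^ l := by
    intro c l hc
    rw [← Real.rpow_natCast c (i + j), ← Real.rpow_mul hc, mul_div_cancel₀ _ hpR.ne',
      Real.rpow_natCast]
  rw [e a i ha, e b j hb] at h
  calc ((i + j : ℕ) : ℝ) * (a ^ i * b ^ j)
      ≤ ((i + j : ℕ) : ℝ) * (i / ((i + j : ℕ) : ℝ) * a ^ (i + j) +
          j / ((i + j : ℕ) : ℝ) * b ^ (i + j)) := mul_le_mul_of_nonneg_left h hpR.le
    _ = _ := by field_simp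

variable {S : Type*} [Fintype S]

/-- The `ℓ^p` norm of a function on a finite type. -/
def powNorm (p : ℕ) (x : S → ℝ) : ℝ := (∑ s, |x s| ^ p) ^ ((p : ℝ)⁻¹)

/-- The gradient of half the squared `ℓ^p` norm, for even `p ≥ 2`. -/
def powDual (p : ℕ) (x : S → ℝ) (s : S) : ℝ := x s ^ (p - 1) / powNorm p x ^ (p - 2)

theorem powNorm_nonneg (p : ℕ) (x : S → ℝ) : 0 ≤ powNorm p x :=
  Real.rpow_nonneg (Finset.sum_nonneg fun _ _ => by positivity) _

theorem powNorm_pow {p : ℕ} (hp : p ≠ 0) (x : S → ℝ) : powNorm p x ^ p = ∑ s, |x s| ^ p :=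
  Real.rpow_inv_natCast_pow (Finset.sum_nonneg fun _ _ => by positivity) hp

theorem powNorm_add_le {p : ℕ} (hp : 1 ≤ p) (x y : S → ℝ) :
    powNorm p (x + y) ≤ powNorm p x + powNorm p y := by
  have h := Real.Lp_add_le Finset.univ x y (p := (p : ℝ)) (by exact_mod_cast hp)
  simpa [powNorm] using h

theorem powNorm_neg (p : ℕ) (x : S → ℝ) : powNorm p (-x) = powNorm p x := by
  simp [powNorm]

theorem abs_powNorm_sub_le {p : ℕ} (hp : 1 ≤ p) (x y : S → ℝ) :
    |powNorm p x - powNorm p y| ≤ powNorm p (x - y) := by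
  have h1 := powNorm_add_le hp (x - y) y
  have h2 := powNorm_add_le hp (y - x) x
  rw [sub_add_cancel] at h1 h2
  rw [← neg_sub x y, powNorm_neg] at h2
  rw [abs_le]
  constructor <;> linarith

theorem abs_le_powNorm {p : ℕ} (hp : p ≠ 0) (x : S → ℝ) (s : S) : |x s| ≤ powNorm p x := by
  refine le_of_pow_le_pow_left₀ hp (powNorm_nonneg p x) ?_
  rw [powNorm_pow hp]
  exact Finset.single_le_sum (f := fun s => |x s| ^ p) (fun _ _ => by positivity)
    (Finset.mem_univ s)

theorem norm_le_powNorm {p : ℕ} (hp : p ≠ 0) (x : S → ℝ) : ‖x‖ ≤ powNorm p x :=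
  (pi_norm_le_iff_of_nonneg (powNorm_nonneg p x)).2 fun s => abs_le_powNorm hp x s

theorem powNorm_le_mul_norm {p : ℕ} (hp : p ≠ 0) {u : ℝ} (hu : 0 ≤ u)
    (hd : (Fintype.card S : ℝ) ≤ u ^ p) (x : S → ℝ) : powNorm p x ≤ u * ‖x‖ := by
  refine le_of_pow_le_pow_left₀ hp (by positivity) ?_
  rw [powNorm_pow hp, mul_pow]
  calc ∑ s, |x s| ^ p ≤ ∑ _s : S, ‖x‖ ^ p :=
        Finset.sum_le_sum fun s _ => pow_le_pow_left₀ (abs_nonneg _) (norm_le_pi_norm x s) _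
    _ = Fintype.card S * ‖x‖ ^ p := by simp
    _ ≤ _ := by gcongr

theorem eq_zero_of_powNorm_eq_zero {p : ℕ} (hp : p ≠ 0) {x : S → ℝ} (h : powNorm p x = 0) :
    x = 0 := by
  ext s
  have := abs_le_powNorm hp x s
  rw [h] at this
  exact abs_nonpos_iff.1 this

/-- Hölder's inequality for integer exponents. -/
theorem sum_pow_mul_pow_le {i j : ℕ} (hij : i + j ≠ 0) (x y : S → ℝ) :
    ∑ s, |x s| ^ i * |y s| ^ j ≤ powNorm (i + j) x ^ i * powNorm (i + j) y ^ j := by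
  rcases Nat.eq_zero_or_pos i with rfl | hi
  · simp only [zero_add] at *
    simp [powNorm_pow hij]
  rcases Nat.eq_zero_or_pos j with rfl | hj
  · simp only [add_zero] at *
    simp [powNorm_pow hij]
  have ha := powNorm_nonneg (i + j) x
  have hb := powNorm_nonneg (i + j) y
  rcases ha.eq_or_lt with h0 | ha'
  · have := eq_zero_of_powNorm_eq_zero hij h0.symm
    rw [← h0, this]
    simp [hi.ne']
  rcases hb.eq_or_lt with h0 | hb'
  · have := eq_zero_of_powNorm_eq_zero hij h0.symm
    rw [← h0, this]
    simp [hj.ne']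
  set a := powNorm (i + j) x with ha_def
  set b := powNorm (i + j) y with hb_def
  have hpos : (0 : ℝ) < ((i + j : ℕ) : ℝ) := by exact_mod_cast Nat.pos_of_ne_zero hij
  have key : ∀ s, ((i + j : ℕ) : ℝ) * ((|x s| / a) ^ i * (|y s| / b) ^ j) ≤
      i * (|x s| / a) ^ (i + j) + j * (|y s| / b) ^ (i + j) := fun s =>
    mul_pow_mul_pow_le (by positivity) (by positivity) i j
  have hsum := Finset.sum_le_sum fun s (_ : s ∈ Finset.univ) => key s
  simp only [div_pow] at hsum
  rw [Finset.sum_add_distrib, ← Finset.mul_sum, ← Finset.mul_sum, ← Finset.mul_sum,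
    ← Finset.sum_div, ← Finset.sum_div, ← powNorm_pow hij, ← powNorm_pow hij, ← ha_def, ← hb_def,
    div_self (by positivity), div_self (by positivity)] at hsum
  have h1 : ∑ s, |x s| ^ i / a ^ i * (|y s| ^ j / b ^ j) =
      (∑ s, |x s| ^ i * |y s| ^ j) / (a ^ i * b ^ j) := by
    rw [Finset.sum_div]
    refine Finset.sum_congr rfl fun s _ => ?_
    field_simp
  rw [h1] at hsum
  have h2 : (∑ s, |x s| ^ i * |y s| ^ j) / (a ^ i * b ^ j) ≤ 1 := by
    have : ((i + j : ℕ) : ℝ) * ((∑ s, |x s| ^ i * |y s| ^ j) / (a ^ i * b ^ j)) ≤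
        ((i + j : ℕ) : ℝ) * 1 := by
      refine hsum.trans_eq ?_
      push_cast
      ring
    exact le_of_mul_le_mul_left this hpos
  rwa [div_le_one (by positivity)] at h2

/-- Hölder against the constant function 1, whose norm `|S|^(1/(i+j))` is at most `u`. Lower power
sums thus lose only powers of `u`, not of `|S|`. -/
theorem sum_pow_le {i j : ℕ} (hij : i + j ≠ 0) {u : ℝ} (hu : 0 ≤ u)
    (hd : (Fintype.card S : ℝ) ≤ u ^ (i + j)) (x : S → ℝ) :
    ∑ s, |x s| ^ i ≤ u ^ j * powNorm (i + j) x ^ i := by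
  have h := sum_pow_mul_pow_le hij x (fun _ => 1)
  simp only [abs_one, one_pow, mul_one] at h
  have h1 : powNorm (i + j) (fun _ : S => (1 : ℝ)) ≤ u := by
    refine le_of_pow_le_pow_left₀ hij hu ?_
    rw [powNorm_pow hij]
    simpa using hd
  refine h.trans ?_
  rw [mul_comm]
  gcongr
  · exact pow_nonneg (powNorm_nonneg _ _) _
  · exact powNorm_nonneg _ _

variable {p : ℕ}

theorem abs_powDual (x : S → ℝ) (s : S) :
    |powDual p x s| = |x s| ^ (p - 1) / powNorm p x ^ (p - 2) := by
  rw [powDual, abs_div, abs_pow, abs_of_nonneg (pow_nonneg (powNorm_nonneg _ _) _)]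

theorem powDual_zero (hp : 2 ≤ p) : powDual p (0 : S → ℝ) = 0 := by
  ext s
  have : p - 1 ≠ 0 := by omega
  simp [powDual, this]

theorem powDual_mul_self (hp : Even p) (h2 : 2 ≤ p) (x : S → ℝ) :
    ∑ s, powDual p x s * x s = powNorm p x ^ 2 := by
  have hp0 : p ≠ 0 := by omega
  rcases (powNorm_nonneg p x).eq_or_lt with h0 | hpos
  · rw [← h0, eq_zero_of_powNorm_eq_zero hp0 h0.symm]
    simp
  have e : ∀ s, powDual p x s * x s = |x s| ^ p / powNorm p x ^ (p - 2) := by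
    intro s
    rw [powDual, hp.pow_abs, div_mul_eq_mul_div, ← pow_succ]
    congr 2
    omega
  simp_rw [e]
  rw [← Finset.sum_div, ← powNorm_pow hp0, div_eq_iff (by positivity), ← pow_add]
  congr 1
  omega

/-- Hölder with exponents `p - 1` and `1`: the dual norm of the gradient at `x` is at most the norm
of `x`. -/
theorem sum_abs_powDual_mul_le (h2 : 2 ≤ p) (x y : S → ℝ) :
    ∑ s, |powDual p x s| * |y s| ≤ powNorm p x * powNorm p y := by
  have hp0 : p ≠ 0 := by omega
  rcases (powNorm_nonneg p x).eq_or_lt with h0 | hpos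
  · rw [← h0, eq_zero_of_powNorm_eq_zero hp0 h0.symm, powDual_zero h2]
    simp
  simp_rw [abs_powDual, div_mul_eq_mul_div]
  rw [← Finset.sum_div, div_le_iff₀ (by positivity)]
  have h := sum_pow_mul_pow_le (i := p - 1) (j := 1) (by omega) x y
  rw [show p - 1 + 1 = p by omega] at h
  simp only [pow_one] at h
  refine h.trans_eq ?_
  rw [show p - 1 = (p - 2) + 1 by omega, pow_succ]
  ring

theorem sum_powDual_mul_le (h2 : 2 ≤ p) (x y : S → ℝ) :
    ∑ s, powDual p x s * y s ≤ powNorm p x * powNorm p y := by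
  refine (Finset.sum_le_sum fun s _ => ?_).trans (sum_abs_powDual_mul_le h2 x y)
  rw [← abs_mul]
  exact le_abs_self _

theorem abs_powDual_le (h2 : 2 ≤ p) (x : S → ℝ) (s : S) : |powDual p x s| ≤ powNorm p x := by
  have hp0 : p ≠ 0 := by omega
  rcases (powNorm_nonneg p x).eq_or_lt with h0 | hpos
  · rw [← h0, eq_zero_of_powNorm_eq_zero hp0 h0.symm, powDual_zero h2]
    simp
  rw [abs_powDual, div_le_iff₀ (by positivity), ← pow_succ', show p - 2 + 1 = p - 1 by omega]
  exact pow_le_pow_left₀ (abs_nonneg _) (abs_le_powNorm hp0 x s) _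

theorem sum_abs_powDual_le (h2 : 2 ≤ p) {u : ℝ} (hu : 0 ≤ u)
    (hd : (Fintype.card S : ℝ) ≤ u ^ p) (x : S → ℝ) :
    ∑ s, |powDual p x s| ≤ u * powNorm p x := by
  have h := sum_abs_powDual_mul_le h2 x (fun _ => 1)
  have h1 : powNorm p (fun _ : S => (1 : ℝ)) ≤ u := by
    refine le_of_pow_le_pow_left₀ (n := p) (by omega) hu ?_
    rw [powNorm_pow (by omega)]
    simpa using hd
  simp only [abs_one, mul_one] at h
  refine h.trans ?_
  rw [mul_comm]
  exact mul_le_mul_of_nonneg_right h1 (powNorm_nonneg _ _)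

/-- The gradient of half the squared `ℓ^p` norm is Lipschitz with respect to the sup norm. -/
theorem sum_abs_powDual_sub_le (h2 : 2 ≤ p) {u : ℝ} (hu : 1 ≤ u)
    (hd : (Fintype.card S : ℝ) ≤ u ^ p) (x y : S → ℝ) :
    ∑ s, |powDual p x s - powDual p y s| ≤
      (u ^ 2 + (p - 1) * u ^ 2 * (1 + u)) * ‖x - y‖ := by
  have hu0 : 0 ≤ u := zero_le_one.trans hu
  have hp0 : p ≠ 0 := by omega
  have hpR : (2 : ℝ) ≤ p := by exact_mod_cast h2
  have hL : u ^ 2 ≤ u ^ 2 + (p - 1) * u ^ 2 * (1 + u) := by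
    have : 0 ≤ ((p : ℝ) - 1) * u ^ 2 * (1 + u) :=
      mul_nonneg (mul_nonneg (by linarith) (sq_nonneg u)) (by linarith)
    linarith
  have hzero : ∀ z : S → ℝ, ∑ s, |powDual p z s| ≤
      (u ^ 2 + (p - 1) * u ^ 2 * (1 + u)) * ‖z‖ := by
    intro z
    calc ∑ s, |powDual p z s| ≤ u * powNorm p z := sum_abs_powDual_le h2 hu0 hd z
      _ ≤ u * (u * ‖z‖) := mul_le_mul_of_nonneg_left (powNorm_le_mul_norm hp0 hu0 hd z) hu0
      _ = u ^ 2 * ‖z‖ := by ring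
      _ ≤ _ := mul_le_mul_of_nonneg_right hL (norm_nonneg _)
  -- The main argument divides by both norms; at a zero vector the gradient vanishes and the bound
  -- with constant `u ^ 2` suffices.
  rcases (powNorm_nonneg p x).eq_or_lt with h0 | ha
  · rw [eq_zero_of_powNorm_eq_zero hp0 h0.symm, powDual_zero h2]
    simpa using hzero y
  rcases (powNorm_nonneg p y).eq_or_lt with h0 | hb
  · rw [eq_zero_of_powNorm_eq_zero hp0 h0.symm, powDual_zero h2]
    simpa using hzero x
  have hab : |powNorm p x - powNorm p y| ≤ u * ‖x - y‖ :=
    (abs_powNorm_sub_le (by omega) x y).trans (powNorm_le_mul_norm hp0 hu0 hd _)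
  have hsx : ∑ s, |x s / powNorm p x| ^ (p - 1) ≤ u := by
    have h := sum_pow_le (i := p - 1) (j := 1) (by omega) hu0
      (by rwa [show p - 1 + 1 = p by omega]) x
    rw [show p - 1 + 1 = p by omega, pow_one] at h
    simp_rw [abs_div, abs_of_pos ha, div_pow]
    rw [← Finset.sum_div, div_le_iff₀ (by positivity)]
    exact h
  have hs2 : ∀ z : S → ℝ, 0 < powNorm p z → ∑ s, |z s / powNorm p z| ^ (p - 1 - 1) ≤ u ^ 2 := by
    intro z hz
    have h := sum_pow_le (i := p - 2) (j := 2) (by omega) hu0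
      (by rwa [show p - 2 + 2 = p by omega]) z
    rw [show p - 2 + 2 = p by omega] at h
    simp_rw [abs_div, abs_of_pos hz, div_pow]
    rw [← Finset.sum_div, div_le_iff₀ (by positivity)]
    exact h
  have hsx2 := hs2 x ha
  have hsy2 := hs2 y hb
  generalize hA : powNorm p x = a at *
  generalize hB : powNorm p y = b at *
  have hdual : ∀ z : S → ℝ, 0 < powNorm p z → ∀ s,
      powDual p z s = powNorm p z * (z s / powNorm p z) ^ (p - 1) := by
    intro z hz s
    rw [powDual, div_pow, show p - 1 = (p - 2) + 1 by omega, pow_succ (powNorm p z)]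
    field_simp
  -- The gradient is norm times direction to the power `p - 1`. The change of norm costs `u ‖x -
  -- y‖`. The change of direction is handled by the trapezoidal bound, which involves the powers of
  -- `x/a` and `y/b` separately, so that each sum over `S` is at most `u ^ 2`.
  have hpt : ∀ s, |powDual p x s - powDual p y s| ≤
      u * ‖x - y‖ * |x s / a| ^ (p - 1) +
        ((p : ℝ) - 1) / 2 * (|x s / a| ^ (p - 1 - 1) + |y s / b| ^ (p - 1 - 1)) *
          ((1 + u) * ‖x - y‖) := by
    intro s
    rw [hdual x (hA ▸ ha), hdual y (hB ▸ hb), hA, hB]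
    have e : a * (x s / a) ^ (p - 1) - b * (y s / b) ^ (p - 1) =
        (a - b) * (x s / a) ^ (p - 1) + b * ((x s / a) ^ (p - 1) - (y s / b) ^ (p - 1)) := by
      ring
    have hz : b * |x s / a - y s / b| ≤ (1 + u) * ‖x - y‖ := by
      have e2 : b * (x s / a - y s / b) = (x s - y s) + (x s / a) * (b - a) := by
        field_simp
        ring
      have hxa : |x s / a| ≤ 1 := by
        rw [abs_div, abs_of_pos ha, div_le_one ha, ← hA]
        exact abs_le_powNorm hp0 x s
      calc b * |x s / a - y s / b| = |b * (x s / a - y s / b)| := by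
            rw [abs_mul, abs_of_pos hb]
        _ ≤ |x s - y s| + |x s / a| * |b - a| := by
            rw [e2, ← abs_mul]; exact abs_add_le _ _
        _ ≤ ‖x - y‖ + 1 * (u * ‖x - y‖) := by
            refine add_le_add (norm_le_pi_norm (x - y) s) ?_
            rw [abs_sub_comm]
            exact mul_le_mul hxa hab (abs_nonneg _) zero_le_one
        _ = _ := by ring
    have ht := abs_pow_sub_pow_le_trapezoid (x s / a) (y s / b) (p - 1)
    rw [Nat.cast_sub (by omega), Nat.cast_one] at ht
    rw [e]
    refine (abs_add_le _ _).trans (add_le_add ?_ ?_)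
    · rw [abs_mul, abs_pow]
      exact mul_le_mul_of_nonneg_right hab (by positivity)
    · rw [abs_mul, abs_of_pos hb]
      calc b * |(x s / a) ^ (p - 1) - (y s / b) ^ (p - 1)|
          ≤ b * (((p : ℝ) - 1) / 2 * (|x s / a| ^ (p - 1 - 1) + |y s / b| ^ (p - 1 - 1)) *
              |x s / a - y s / b|) := mul_le_mul_of_nonneg_left ht hb.le
        _ = ((p : ℝ) - 1) / 2 * (|x s / a| ^ (p - 1 - 1) + |y s / b| ^ (p - 1 - 1)) *
              (b * |x s / a - y s / b|) := by ring
        _ ≤ _ := mul_le_mul_of_nonneg_left hz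
              (mul_nonneg (by linarith) (by positivity))
  refine (Finset.sum_le_sum fun s _ => hpt s).trans ?_
  rw [Finset.sum_add_distrib, ← Finset.mul_sum, ← Finset.sum_mul, ← Finset.mul_sum,
    Finset.sum_add_distrib]
  calc _ ≤ u * ‖x - y‖ * u + ((p : ℝ) - 1) / 2 * (u ^ 2 + u ^ 2) * ((1 + u) * ‖x - y‖) := by
        have : 0 ≤ ((p : ℝ) - 1) / 2 := by linarith
        gcongr
    _ = _ := by ring

/-- The squared `ℓ^p` norm is smooth with respect to the sup norm. -/
theorem powNorm_add_sq_le (hp : Even p) (h2 : 2 ≤ p) {u : ℝ} (hu : 1 ≤ u)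
    (hd : (Fintype.card S : ℝ) ≤ u ^ p) (x h : S → ℝ) :
    powNorm p (x + h) ^ 2 ≤ powNorm p x ^ 2 + 2 * ∑ s, powDual p x s * h s +
      2 * (u ^ 2 + (p - 1) * u ^ 2 * (1 + u)) * ‖h‖ ^ 2 := by
  -- Pairing the gradient at `x + h` with `x`, and using `2ab ≤ a² + b²` at the end, bounds the
  -- increment by twice the pairing of that gradient with `h`. Moving the gradient back to `x` costs
  -- its Lipschitz constant times `‖h‖²`; no integration along the segment is needed.
  have h1 := sum_powDual_mul_le h2 (x + h) x
  have h3 : ∑ s, powDual p (x + h) s * x s =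
      powNorm p (x + h) ^ 2 - ∑ s, powDual p (x + h) s * h s := by
    rw [← powDual_mul_self hp h2, ← Finset.sum_sub_distrib]
    refine Finset.sum_congr rfl fun s _ => ?_
    simp only [Pi.add_apply]
    ring
  have h4 : ∑ s, powDual p (x + h) s * h s - ∑ s, powDual p x s * h s ≤
      (u ^ 2 + (p - 1) * u ^ 2 * (1 + u)) * ‖h‖ * ‖h‖ := by
    rw [← Finset.sum_sub_distrib]
    calc _ ≤ ∑ s, |powDual p (x + h) s - powDual p x s| * ‖h‖ := by
          refine Finset.sum_le_sum fun s _ => ?_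
          rw [← sub_mul]
          refine (le_abs_self _).trans ?_
          rw [abs_mul]
          exact mul_le_mul_of_nonneg_left (norm_le_pi_norm h s) (abs_nonneg _)
      _ ≤ _ := by
          rw [← Finset.sum_mul]
          refine mul_le_mul_of_nonneg_right ?_ (norm_nonneg _)
          simpa using sum_abs_powDual_sub_le h2 hu hd (x + h) x
  nlinarith [sq_nonneg (powNorm p (x + h) - powNorm p x)]

/-- A contraction of the sup norm yields a negative drift of the squared `ℓ^p` norm. -/
theorem sum_powDual_mul_le_of_contraction (hp : Even p) (h2 : 2 ≤ p) {u β : ℝ} (hu : 0 ≤ u)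
    (hd : (Fintype.card S : ℝ) ≤ u ^ p) (x h : S → ℝ) (hβ : 0 ≤ β)
    (hc : ‖x + h‖ ≤ β * ‖x‖) :
    ∑ s, powDual p x s * h s ≤ -(1 - u * β) * powNorm p x ^ 2 := by
  have hp0 : p ≠ 0 := by omega
  have h1 : ∑ s, powDual p x s * (x + h) s ≤ u * powNorm p x * (β * powNorm p x) := by
    calc ∑ s, powDual p x s * (x + h) s ≤ ∑ s, |powDual p x s| * (β * powNorm p x) := by
          refine Finset.sum_le_sum fun s _ => (le_abs_self _).trans ?_
          rw [abs_mul]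
          refine mul_le_mul_of_nonneg_left ((norm_le_pi_norm (x + h) s).trans (hc.trans ?_))
            (abs_nonneg _)
          exact mul_le_mul_of_nonneg_left (norm_le_powNorm hp0 x) hβ
      _ ≤ _ := by
          rw [← Finset.sum_mul]
          exact mul_le_mul_of_nonneg_right (sum_abs_powDual_le h2 hu hd x)
            (mul_nonneg hβ (powNorm_nonneg _ _))
  have h3 := powDual_mul_self hp h2 x
  simp only [Pi.add_apply, mul_add, Finset.sum_add_distrib] at h1
  nlinarith

end PowerNorm

/-! ### Mixing of irreducible aperiodic finite chains. -/

section ChainConvergence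

open Matrix Filter Topology

variable {S : Type*} [Fintype S] [DecidableEq S]

/-- An irreducible aperiodic nonnegative matrix has a power with positive entries. -/
theorem exists_pow_pos_of_irreducible_of_aperiodic {P : Matrix S S ℝ} (hirr : P.IsIrreducible)
    (hap : IsAperiodicChain P) : ∃ N, ∀ i j, 0 < (P ^ N) i j := by
  have hnn := hirr.nonneg
  have hmul : ∀ k l i j r, 0 < (P ^ k) i j → 0 < (P ^ l) j r → 0 < (P ^ (k + l)) i r := by
    intro k l i j r h1 h2
    rw [pow_add, mul_apply]
    exact Finset.sum_pos' (fun m _ => mul_nonneg (pow_apply_nonneg hnn k i m)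
      (pow_apply_nonneg hnn l m r)) ⟨j, Finset.mem_univ j, mul_pos h1 h2⟩
  have hreturn : ∀ s, ∃ N, ∀ m ≥ N, 0 < (P ^ m) s s := by
    intro s
    set T : Set ℕ := {k | 1 ≤ k ∧ 0 < (P ^ k) s s} with hT
    have hg : Nat.setGcd T = 1 :=
      hap s _ fun k hk hpos => Nat.setGcd_dvd_of_mem ⟨hk, hpos⟩
    -- The return times to `s` are closed under addition and have gcd 1, hence contain all large
    -- integers.
    obtain ⟨N, hN⟩ := Nat.exists_mem_closure_of_ge T
    refine ⟨N, fun m hm => ?_⟩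
    have := hN m hm (hg ▸ one_dvd m)
    clear hm
    induction this using AddSubmonoid.closure_induction with
    | mem x hx => exact hx.2
    | zero => simp
    | add x y _ _ h1 h2 => exact hmul _ _ _ _ _ h1 h2
  choose N hN using hreturn
  choose k hk hkpos using (isIrreducible_iff_exists_pow_pos hnn).1 hirr
  -- A common exponent: go from `i` to `j` in `k i j` steps, then spend the remaining time, at least
  -- `N j`, on a loop at `j`.
  refine ⟨∑ s, N s + ∑ i, ∑ j, k i j, fun i j => ?_⟩
  have h1 : N j ≤ ∑ s, N s := Finset.single_le_sum (fun _ _ => Nat.zero_le _) (Finset.mem_univ j)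
  have h2 : k i j ≤ ∑ i, ∑ j, k i j :=
    (Finset.single_le_sum (f := fun j => k i j) (fun _ _ => Nat.zero_le _)
      (Finset.mem_univ j)).trans (Finset.single_le_sum (f := fun i => ∑ j, k i j)
      (fun _ _ => Nat.zero_le _) (Finset.mem_univ i))
  have h3 := hmul _ (∑ s, N s + ∑ i, ∑ j, k i j - k i j) i j j (hkpos i j)
    (hN j _ (by omega))
  rwa [Nat.add_sub_cancel' (by omega)] at h3

/-- Doeblin's argument: all rows share the mass `δ` at every state, which cancels in the difference,
and only the remaining mass `1 - |S| δ` sees the oscillation of `f`. -/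
theorem mulVec_sub_le_of_le {P : Matrix S S ℝ} (hP : P ∈ rowStochastic ℝ S) {δ r : ℝ}
    (hδ : ∀ i j, δ ≤ P i j) {f : S → ℝ} (hf : ∀ i j, f i - f j ≤ r) (i j : S) :
    (P *ᵥ f) i - (P *ᵥ f) j ≤ (1 - Fintype.card S * δ) * r := by
  have : Nonempty S := ⟨i⟩
  obtain ⟨a, ha⟩ := Finite.exists_max f
  obtain ⟨b, hb⟩ := Finite.exists_min f
  have hup : (P *ᵥ f) i ≤ δ * ∑ s, f s + (1 - Fintype.card S * δ) * f a := by
    have : ∑ s, (P i s - δ) * f s ≤ ∑ s, (P i s - δ) * f a :=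
      Finset.sum_le_sum fun s _ => mul_le_mul_of_nonneg_left (ha s) (sub_nonneg.2 (hδ i s))
    rw [← Finset.sum_mul, Finset.sum_sub_distrib, sum_row_of_mem_rowStochastic hP] at this
    simp only [sub_mul, Finset.sum_sub_distrib, ← Finset.mul_sum, Finset.sum_const,
      Finset.card_univ, nsmul_eq_mul] at this
    simp only [mulVec, dotProduct]
    linarith
  have hlo : δ * ∑ s, f s + (1 - Fintype.card S * δ) * f b ≤ (P *ᵥ f) j := by
    have : ∑ s, (P j s - δ) * f b ≤ ∑ s, (P j s - δ) * f s :=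
      Finset.sum_le_sum fun s _ => mul_le_mul_of_nonneg_left (hb s) (sub_nonneg.2 (hδ j s))
    rw [← Finset.sum_mul, Finset.sum_sub_distrib, sum_row_of_mem_rowStochastic hP] at this
    simp only [sub_mul, Finset.sum_sub_distrib, ← Finset.mul_sum, Finset.sum_const,
      Finset.card_univ, nsmul_eq_mul] at this
    simp only [mulVec, dotProduct]
    linarith
  have hcard : 0 ≤ 1 - Fintype.card S * δ := by
    have : ∑ _s : S, δ ≤ ∑ s, P i s := Finset.sum_le_sum fun s _ => hδ i s
    rw [sum_row_of_mem_rowStochastic hP] at this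
    simpa using this
  nlinarith [hf a b]

/-- The rows of the powers of a stochastic matrix with a positive power merge. -/
theorem exists_pow_sub_le {P : Matrix S S ℝ} (hP : P ∈ rowStochastic ℝ S) {N : ℕ}
    (hN : ∀ i j, 0 < (P ^ N) i j) {ε : ℝ} (hε : 0 < ε) :
    ∃ K, ∀ k ≥ K, ∀ i j s, (P ^ k) i s - (P ^ k) j s ≤ ε := by
  rcases isEmpty_or_nonempty S with hS | hS
  · exact ⟨0, fun k _ i => isEmptyElim i⟩
  obtain ⟨a, ha⟩ := Finite.exists_min fun x : S × S => (P ^ N) x.1 x.2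
  set δ := (P ^ N) a.1 a.2 with hδ
  have hδ0 : 0 < δ := hN _ _
  have hPN : P ^ N ∈ rowStochastic ℝ S := pow_mem hP N
  have hcard : 0 < (Fintype.card S : ℝ) := by exact_mod_cast Fintype.card_pos
  have hθ0 : 0 ≤ 1 - Fintype.card S * δ := by
    have : ∑ _s : S, δ ≤ ∑ s, (P ^ N) a.1 s := Finset.sum_le_sum fun s _ => ha (a.1, s)
    rw [sum_row_of_mem_rowStochastic hPN] at this
    simpa using this
  have hθ1 : 1 - Fintype.card S * δ < 1 := by nlinarith [mul_pos hcard hδ0]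
  obtain ⟨q, hq⟩ := exists_pow_lt_of_lt_one hε hθ1
  have hcol : ∀ (m : ℕ) s, (fun i => (P ^ m) i s) = P ^ m *ᵥ Pi.single s 1 := by
    intro m s
    ext i
    simp
  have hstep : ∀ q : ℕ, ∀ i j s, (P ^ (N * q)) i s - (P ^ (N * q)) j s ≤
      (1 - Fintype.card S * δ) ^ q := by
    intro q
    induction q with
    | zero =>
      intro i j s
      simp only [mul_zero, pow_zero, one_apply]
      split_ifs <;> norm_num
    | succ q ih =>
      intro i j s
      have h := mulVec_sub_le_of_le hPN (fun i j => ha (i, j))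
        (f := fun i => (P ^ (N * q)) i s) (fun i j => ih i j s) i j
      rw [hcol, mulVec_mulVec, ← pow_add, ← hcol] at h
      rw [pow_succ']
      rwa [show N + N * q = N * (q + 1) by ring] at h
  refine ⟨N * q, fun k hk i j s => ?_⟩
  -- With `δ = 0` the lemma says that averaging does not increase oscillation, which carries the
  -- bound from the multiple `N * q` to all later times.
  have h := mulVec_sub_le_of_le (pow_mem hP (k - N * q)) (δ := 0)
    (fun i j => nonneg_of_mem_rowStochastic (pow_mem hP (k - N * q)))
    (f := fun i => (P ^ (N * q)) i s) (fun i j => hstep q i j s) i j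
  rw [hcol, mulVec_mulVec, ← pow_add, ← hcol, Nat.sub_add_cancel hk] at h
  simp only [mul_zero, sub_zero, one_mul] at h
  exact h.trans hq.le

/-- By stationarity `κ = κ P^k` is an average of the rows of `P^k`, so it is as close to each row as
the rows are to each other. -/
theorem abs_pow_sub_le_of_isStationaryDist {P : Matrix S S ℝ} {κ : S → ℝ}
    (hκ : IsStationaryDist P κ) {k : ℕ} {ε : ℝ} (h : ∀ i j s, (P ^ k) i s - (P ^ k) j s ≤ ε)
    (i s : S) : |(P ^ k) i s - κ s| ≤ ε := by
  have hk : κ ᵥ* P ^ k = κ := by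
    clear h
    induction k with
    | zero => simp
    | succ k ih => rw [pow_succ, ← vecMul_vecMul, ih, hκ.2.2]
  have h1 : κ s = ∑ j, κ j * (P ^ k) j s := by
    conv_lhs => rw [← hk]
    rfl
  have h2 : (P ^ k) i s - κ s = ∑ j, κ j * ((P ^ k) i s - (P ^ k) j s) := by
    simp_rw [mul_sub]
    rw [Finset.sum_sub_distrib, ← h1, ← Finset.sum_mul, hκ.2.1, one_mul]
  rw [h2]
  calc _ ≤ ∑ j, κ j * ε := by
        refine (Finset.abs_sum_le_sum_abs _ _).trans (Finset.sum_le_sum fun j _ => ?_)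
        rw [abs_mul, abs_of_nonneg (hκ.1 j)]
        refine mul_le_mul_of_nonneg_left (abs_le.2 ⟨?_, h i j s⟩) (hκ.1 j)
        linarith [h j i s]
    _ = ε := by rw [← Finset.sum_mul, hκ.2.1, one_mul]

/-- The limit of a fixed row of `P^k`. That row is Cauchy, as row `i₀` of `P^k` is an average of the
rows of `P^K` for `k ≥ K`. -/
theorem exists_isStationaryDist [Nonempty S] {P : Matrix S S ℝ} (hP : P ∈ rowStochastic ℝ S)
    {N : ℕ} (hN : ∀ i j, 0 < (P ^ N) i j) : ∃ κ, IsStationaryDist P κ := by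
  obtain ⟨i₀⟩ := ‹Nonempty S›
  have hcauchy : ∀ s, CauchySeq fun k => (P ^ k) i₀ s := by
    intro s
    rw [Metric.cauchySeq_iff']
    intro ε hε
    obtain ⟨K, hK⟩ := exists_pow_sub_le hP hN (half_pos hε)
    refine ⟨K, fun k hk => ?_⟩
    have hrow := sum_row_of_mem_rowStochastic (pow_mem hP (k - K)) i₀
    have h2 : (P ^ k) i₀ s - (P ^ K) i₀ s =
        ∑ j, (P ^ (k - K)) i₀ j * ((P ^ K) j s - (P ^ K) i₀ s) := by
      simp_rw [mul_sub]
      rw [Finset.sum_sub_distrib, ← Finset.sum_mul, hrow, one_mul, ← mul_apply, ← pow_add,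
        Nat.sub_add_cancel hk]
    rw [Real.dist_eq, h2]
    calc _ ≤ ∑ j, (P ^ (k - K)) i₀ j * (ε / 2) := by
          refine (Finset.abs_sum_le_sum_abs _ _).trans (Finset.sum_le_sum fun j _ => ?_)
          have hnn : 0 ≤ (P ^ (k - K)) i₀ j := nonneg_of_mem_rowStochastic (pow_mem hP _)
          rw [abs_mul, abs_of_nonneg hnn]
          refine mul_le_mul_of_nonneg_left (abs_le.2 ⟨?_, hK K le_rfl j i₀ s⟩) hnn
          linarith [hK K le_rfl i₀ j s]
      _ = ε / 2 := by rw [← Finset.sum_mul, hrow, one_mul]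
      _ < ε := half_lt_self hε
  choose κ hκ using fun s => cauchySeq_tendsto_of_complete (hcauchy s)
  refine ⟨κ, fun s => ?_, ?_, ?_⟩
  · exact ge_of_tendsto' (hκ s) fun k => nonneg_of_mem_rowStochastic (pow_mem hP k)
  · refine tendsto_nhds_unique (tendsto_finsetSum _ fun s _ => hκ s) ?_
    simp_rw [sum_row_of_mem_rowStochastic (pow_mem hP _)]
    exact tendsto_const_nhds
  · ext s
    have h1 : Tendsto (fun k => ∑ j, (P ^ k) i₀ j * P j s) atTop (𝓝 (∑ j, κ j * P j s)) :=
      tendsto_finsetSum _ fun j _ => (hκ j).mul_const _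
    refine tendsto_nhds_unique h1 (((tendsto_add_atTop_iff_nat 1).2 (hκ s)).congr fun k => ?_)
    rw [pow_succ, mul_apply]

/-- Existence makes the choice in `stationaryDist` meaningful; the later arguments only use that it
is stationary. -/
theorem isStationaryDist_stationaryDist [Nonempty S] {P : Matrix S S ℝ}
    (hP : P ∈ rowStochastic ℝ S) {N : ℕ} (hN : ∀ i j, 0 < (P ^ N) i j) :
    IsStationaryDist P (stationaryDist P) :=
  Classical.epsilon_spec (exists_isStationaryDist hP hN)

theorem stationaryDist_pos [Nonempty S] {P : Matrix S S ℝ}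
    (hP : P ∈ rowStochastic ℝ S) {N : ℕ} (hN : ∀ i j, 0 < (P ^ N) i j) (s : S) :
    0 < stationaryDist P s := by
  have hκ := isStationaryDist_stationaryDist hP hN
  have hk : stationaryDist P ᵥ* P ^ N = stationaryDist P := by
    clear hN
    induction N with
    | zero => simp
    | succ k ih => rw [pow_succ, ← vecMul_vecMul, ih, hκ.2.2]
  rw [← hk]
  obtain ⟨j, -, hj⟩ : ∃ j ∈ Finset.univ, 0 < stationaryDist P j := by
    apply Finset.exists_lt_of_sum_lt (f := fun _ => (0 : ℝ))
    simp [hκ.2.1]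
  exact Finset.sum_pos' (fun j _ => mul_nonneg (hκ.1 j) (hN j s).le)
    ⟨j, Finset.mem_univ j, mul_pos hj (hN j s)⟩

/-- Convergence makes the set defining `mixingTime` nonempty, so the infimum is attained and is not
the default value 0 of an empty infimum. -/
theorem tvDist_pow_mixingTime_le [Nonempty S] {P : Matrix S S ℝ}
    (hP : P ∈ rowStochastic ℝ S) {N : ℕ} (hN : ∀ i j, 0 < (P ^ N) i j) {δ : ℝ} (hδ : 0 < δ)
    (s : S) : tvDist ((P ^ mixingTime P δ) s) (stationaryDist P) ≤ δ := by
  have hne : {k : ℕ | ∀ s, tvDist ((P ^ k) s) (stationaryDist P) ≤ δ}.Nonempty := by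
    have hcard : 0 < (Fintype.card S : ℝ) := by exact_mod_cast Fintype.card_pos
    obtain ⟨K, hK⟩ := exists_pow_sub_le hP hN (div_pos hδ hcard)
    refine ⟨K, fun s => ?_⟩
    have h := abs_pow_sub_le_of_isStationaryDist (isStationaryDist_stationaryDist hP hN)
      (hK K le_rfl)
    have hs : ∑ s', |(P ^ K) s s' - stationaryDist P s'| ≤ δ :=
      (Finset.sum_le_sum fun s' _ => h s s').trans_eq (by
        simp only [Finset.sum_const, Finset.card_univ, nsmul_eq_mul]; field_simp)
    rw [tvDist]
    linarith
  exact Nat.sInf_mem hne s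

end ChainConvergence

/-! ### Sup-norm contraction of the mean multi-step update. -/

section NonnegContraction

open Matrix

variable {S : Type*} [Fintype S] [DecidableEq S]

/-- The linear part `∑_{i < n} (γ C)^i (γ D - diag(D 1))` of the mean multi-step update. -/
def multistepMatrix (γ : ℝ) (C D : Matrix S S ℝ) (n : ℕ) : Matrix S S ℝ :=
  ∑ i ∈ Finset.range n, (γ • C) ^ i * (γ • D - diagonal (D *ᵥ 1))

variable {γ : ℝ} {C D : Matrix S S ℝ}

/-- Shift the negative diagonal terms by one index: the sum telescopes into the terms `(γC)^i γ (D -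
C diag(D 1))`, which are nonnegative because `C ≤ D` and `D 1 ≤ 1`, plus the boundary term `(γC)^n
diag(D 1)`. -/
theorem multistepMatrix_add_diagonal_nonneg (hγ : 0 ≤ γ) (hC : ∀ s s', 0 ≤ C s s')
    (hCD : ∀ s s', C s s' ≤ D s s') (hD : ∀ s, (D *ᵥ 1) s ≤ 1) (n : ℕ) (s s' : S) :
    0 ≤ (multistepMatrix γ C D n + diagonal (D *ᵥ 1)) s s' := by
  have hγC : ∀ s s', 0 ≤ (γ • C) s s' := fun s s' => mul_nonneg hγ (hC s s')
  have hD0 : ∀ s, 0 ≤ (D *ᵥ 1) s := fun s =>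
    Finset.sum_nonneg fun s' _ => mul_nonneg ((hC s s').trans (hCD s s')) zero_le_one
  have key : ∀ n s s', 0 ≤ (multistepMatrix γ C D n + diagonal (D *ᵥ 1) -
      (γ • C) ^ n * diagonal (D *ᵥ 1)) s s' := by
    intro n
    induction n with
    | zero => intro s s'; simp [multistepMatrix]
    | succ n ih =>
      intro s s'
      have e : multistepMatrix γ C D (n + 1) + diagonal (D *ᵥ 1) -
          (γ • C) ^ (n + 1) * diagonal (D *ᵥ 1) =
          (multistepMatrix γ C D n + diagonal (D *ᵥ 1) - (γ • C) ^ n * diagonal (D *ᵥ 1)) +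
          (γ • C) ^ n * (γ • (D - C * diagonal (D *ᵥ 1))) := by
        rw [multistepMatrix, Finset.sum_range_succ, ← multistepMatrix, pow_succ, smul_sub,
          mul_sub, mul_sub, Matrix.mul_assoc ((γ • C) ^ n) (γ • C), Matrix.smul_mul γ C]
        abel
      rw [e, Matrix.add_apply]
      refine add_nonneg (ih s s') ?_
      rw [mul_apply]
      refine Finset.sum_nonneg fun j _ => mul_nonneg (pow_apply_nonneg hγC n s j) ?_
      rw [Matrix.smul_apply, Matrix.sub_apply, mul_diagonal]
      refine mul_nonneg hγ (sub_nonneg.2 ((mul_le_of_le_one_right (hC j s') (hD s')).trans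
        (hCD j s')))
  have h1 := key n s s'
  have h2 : 0 ≤ ((γ • C) ^ n * diagonal (D *ᵥ 1)) s s' := by
    rw [mul_diagonal]
    exact mul_nonneg (pow_apply_nonneg hγC n s s') (hD0 s')
  rw [Matrix.sub_apply] at h1
  linarith

/-- Applied to the constant 1, the factor `γD - diag(D 1)` gives `-(1 - γ) D 1`, and each power of
`γC` multiplies a lower bound of a nonnegative vector by at least `γ c`. -/
theorem multistepMatrix_mulVec_one_le (hγ : 0 ≤ γ) (hγ1 : γ ≤ 1) (hC : ∀ s s', 0 ≤ C s s')
    {c d : ℝ} (hc : 0 ≤ c) (hd : 0 ≤ d) (hcC : ∀ s, c ≤ (C *ᵥ 1) s)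
    (hdD : ∀ s, d ≤ (D *ᵥ 1) s) (n : ℕ) (s : S) :
    (multistepMatrix γ C D n *ᵥ 1) s ≤
      -((1 - γ) * d * ∑ i ∈ Finset.range n, (γ * c) ^ i) := by
  have hpow : ∀ i s, d * (γ * c) ^ i ≤ ((γ • C) ^ i *ᵥ (D *ᵥ 1)) s := by
    intro i
    induction i with
    | zero => intro s; simpa using hdD s
    | succ i ih =>
      intro s
      rw [pow_succ' (γ • C), ← mulVec_mulVec, smul_mulVec, Pi.smul_apply, smul_eq_mul]
      have h1 : ∑ j, C s j * (d * (γ * c) ^ i) ≤ (C *ᵥ ((γ • C) ^ i *ᵥ (D *ᵥ 1))) s :=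
        Finset.sum_le_sum fun j _ => mul_le_mul_of_nonneg_left (ih j) (hC s j)
      have h2 : c ≤ ∑ j, C s j := by simpa [mulVec, dotProduct] using hcC s
      rw [← Finset.sum_mul] at h1
      have h3 : c * (d * (γ * c) ^ i) ≤ (∑ j, C s j) * (d * (γ * c) ^ i) :=
        mul_le_mul_of_nonneg_right h2 (by positivity)
      calc d * (γ * c) ^ (i + 1) = γ * (c * (d * (γ * c) ^ i)) := by ring
        _ ≤ _ := mul_le_mul_of_nonneg_left (h3.trans h1) hγ
  have hone : (γ • D - diagonal (D *ᵥ 1)) *ᵥ 1 = -((1 - γ) • (D *ᵥ 1)) := by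
    rw [sub_mulVec, smul_mulVec, sub_smul, one_smul]
    have : diagonal (D *ᵥ 1) *ᵥ (1 : S → ℝ) = D *ᵥ 1 := by
      ext s; simp [mulVec_diagonal]
    rw [this]
    abel
  have e : multistepMatrix γ C D n *ᵥ 1 =
      -((1 - γ) • ∑ i ∈ Finset.range n, (γ • C) ^ i *ᵥ (D *ᵥ 1)) := by
    rw [multistepMatrix, sum_mulVec]
    simp_rw [← mulVec_mulVec, hone, mulVec_neg, mulVec_smul]
    rw [Finset.sum_neg_distrib, Finset.smul_sum]
  rw [e, Pi.neg_apply, Pi.smul_apply, Finset.sum_apply, smul_eq_mul, mul_assoc,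
    Finset.mul_sum _ _ d]
  refine neg_le_neg (mul_le_mul_of_nonneg_left ?_ (by linarith))
  exact Finset.sum_le_sum fun i _ => hpow i s

/-- The asynchronous mean multi-step update contracts the sup norm. -/
theorem norm_add_mul_multistepMatrix_le (hγ : 0 ≤ γ) (hγ1 : γ ≤ 1) (hC : ∀ s s', 0 ≤ C s s')
    (hCD : ∀ s s', C s s' ≤ D s s') (hD : ∀ s, (D *ᵥ 1) s ≤ 1)
    {c d K : ℝ} (hc : 0 ≤ c) (hd : 0 ≤ d) (hK : 0 ≤ K) (hcC : ∀ s, c ≤ (C *ᵥ 1) s)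
    (hdD : ∀ s, d ≤ (D *ᵥ 1) s) {κ : S → ℝ} (hκK : ∀ s, K ≤ κ s) (hκ1 : ∀ s, κ s ≤ 1)
    {n : ℕ} (hβ : 0 ≤ 1 - K * ((1 - γ) * d * ∑ i ∈ Finset.range n, (γ * c) ^ i)) (x : S → ℝ) :
    ‖x + fun s => κ s * (multistepMatrix γ C D n *ᵥ x) s‖ ≤
      (1 - K * ((1 - γ) * d * ∑ i ∈ Finset.range n, (γ * c) ^ i)) * ‖x‖ := by
  set W := multistepMatrix γ C D n with hW
  refine (pi_norm_le_iff_of_nonneg (mul_nonneg hβ (norm_nonneg _))).2 fun s => ?_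
  have hκ0 : ∀ s, 0 ≤ κ s := fun s => hK.trans (hκK s)
  -- The only negative contribution is at most `κ s * (D 1) s ≤ 1` on the diagonal, which the
  -- identity compensates. For a nonnegative matrix the sup-norm bound is then the largest row sum.
  have hcoef : ∀ s', 0 ≤ (1 : Matrix S S ℝ) s s' + κ s * W s s' := by
    intro s'
    have h := multistepMatrix_add_diagonal_nonneg hγ hC hCD hD n s s'
    rw [← hW, Matrix.add_apply] at h
    rcases eq_or_ne s s' with rfl | hne
    · rw [diagonal_apply_eq] at h
      rw [one_apply_eq]
      nlinarith [hκ0 s, hκ1 s, hD s]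
    · rw [diagonal_apply_ne _ hne, add_zero] at h
      rw [one_apply_ne hne, zero_add]
      exact mul_nonneg (hκ0 s) h
  have e : (x + fun s => κ s * (W *ᵥ x) s) s =
      ∑ s', ((1 : Matrix S S ℝ) s s' + κ s * W s s') * x s' := by
    simp only [add_mul, Finset.sum_add_distrib, Pi.add_apply, mul_assoc, ← Finset.mul_sum]
    simp [one_apply, mulVec, dotProduct]
  have hsum : ∑ s', ((1 : Matrix S S ℝ) s s' + κ s * W s s') = 1 + κ s * (W *ᵥ 1) s := by
    rw [Finset.sum_add_distrib, ← Finset.mul_sum]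
    simp [one_apply, mulVec, dotProduct]
  have hone := multistepMatrix_mulVec_one_le (D := D) hγ hγ1 hC hc hd hcC hdD n s
  rw [e, Real.norm_eq_abs]
  calc _ ≤ ∑ s', ((1 : Matrix S S ℝ) s s' + κ s * W s s') * ‖x‖ := by
        refine (Finset.abs_sum_le_sum_abs _ _).trans (Finset.sum_le_sum fun s' _ => ?_)
        rw [abs_mul, abs_of_nonneg (hcoef s')]
        exact mul_le_mul_of_nonneg_left (norm_le_pi_norm x s') (hcoef s')
    _ ≤ _ := by
        rw [← Finset.sum_mul, hsum]
        refine mul_le_mul_of_nonneg_right ?_ (norm_nonneg _)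
        have hω : 0 ≤ (1 - γ) * d * ∑ i ∈ Finset.range n, (γ * c) ^ i :=
          mul_nonneg (mul_nonneg (by linarith) hd)
            (Finset.sum_nonneg fun i _ => pow_nonneg (mul_nonneg hγ hc) i)
        have h1 := mul_le_mul_of_nonneg_left hone (hκ0 s)
        have h2 := mul_le_mul_of_nonneg_right (hκK s) hω
        rw [← hW] at h1
        linarith

end NonnegContraction

/-! ### The Bellman equation for the value function defined by the path measure. -/

section ValueFunction

variable {S A : Type*} [Fintype S] [Fintype A]

/-- The expectation of `g` at the next state-action pair. -/
def MDP.nextExp (M : MDP S A) (π : Policy S A) (g : S × A → ℝ) (x : S × A) : ℝ :=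
  ∑ s', M.P x.2 x.1 s' * ∑ a', π.prob s' a' * g (s', a')

theorem MDP.abs_nextExp_le (M : MDP S A) (π : Policy S A) {g : S × A → ℝ} {b : ℝ}
    (hg : ∀ x, |g x| ≤ b) (x : S × A) : |M.nextExp π g x| ≤ b := by
  have h1 : ∀ s', |∑ a', π.prob s' a' * g (s', a')| ≤ b := fun s' => by
    calc _ ≤ ∑ a', π.prob s' a' * b := by
          refine (Finset.abs_sum_le_sum_abs _ _).trans (Finset.sum_le_sum fun a' _ => ?_)
          rw [abs_mul, abs_of_nonneg (π.nonneg s' a')]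
          exact mul_le_mul_of_nonneg_left (hg _) (π.nonneg s' a')
      _ = b := by rw [← Finset.sum_mul, π.sum_one, one_mul]
  calc _ ≤ ∑ s', M.P x.2 x.1 s' * b := by
        refine (Finset.abs_sum_le_sum_abs _ _).trans (Finset.sum_le_sum fun s' _ => ?_)
        rw [abs_mul, abs_of_nonneg (M.P_nonneg _ _ _)]
        exact mul_le_mul_of_nonneg_left (h1 s') (M.P_nonneg _ _ _)
    _ = b := by rw [← Finset.sum_mul, M.P_sum, one_mul]

variable [MeasurableSpace S] [DiscreteMeasurableSpace S] [MeasurableSpace A]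
    [DiscreteMeasurableSpace A]

theorem integral_pmfOfReal {ι : Type*} [Fintype ι] [MeasurableSpace ι]
    [MeasurableSingletonClass ι] (f : ι → ℝ) (h0 : ∀ i, 0 ≤ f i) (h1 : ∑ i, f i = 1)
    (g : ι → ℝ) : ∫ i, g i ∂(pmfOfReal f h0 h1).toMeasure = ∑ i, f i * g i := by
  rw [PMF.integral_eq_sum]
  refine Finset.sum_congr rfl fun i _ => ?_
  simp [pmfOfReal, ENNReal.toReal_ofReal (h0 i)]

theorem Policy.integral_startPMF (π : Policy S A) (s : S) (g : S × A → ℝ) :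
    ∫ x, g x ∂(π.startPMF s).toMeasure = ∑ a, π.prob s a * g (s, a) := by
  rw [Policy.startPMF, ← PMF.toMeasure_map _ (π.pmf s) (measurable_of_countable (Prod.mk s)),
    integral_map
    (measurable_of_countable _).aemeasurable (measurable_of_countable g).aestronglyMeasurable,
    Policy.pmf, integral_pmfOfReal]

theorem MDP.integral_nextPMF (M : MDP S A) (π : Policy S A) (x : S × A) (g : S × A → ℝ) :
    ∫ y, g y ∂(M.nextPMF π x).toMeasure = M.nextExp π g x := by
  classical
  rw [PMF.integral_eq_sum]
  have h : ∀ y, ((M.nextPMF π x) y).toReal =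
      ∑ s', M.P x.2 x.1 s' * ((π.startPMF s') y).toReal := by
    intro y
    rw [MDP.nextPMF, PMF.bind_apply, tsum_fintype, ENNReal.toReal_sum
      (fun s' _ => ENNReal.mul_ne_top (PMF.apply_ne_top _ _) (PMF.apply_ne_top _ _))]
    refine Finset.sum_congr rfl fun s' _ => ?_
    simp [MDP.nextState, pmfOfReal, ENNReal.toReal_ofReal (M.P_nonneg _ _ _)]
  simp_rw [h, smul_eq_mul, Finset.sum_mul]
  rw [Finset.sum_comm, MDP.nextExp]
  refine Finset.sum_congr rfl fun s' _ => ?_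
  simp_rw [mul_assoc]
  rw [← Finset.mul_sum, ← Policy.integral_startPMF, PMF.integral_eq_sum]
  simp

instance (M : MDP S A) (π : Policy S A) (s : S) : IsProbabilityMeasure (M.pathMeasure π s) := by
  unfold MDP.pathMeasure
  infer_instance

theorem integrable_of_finite_comp {Ω ι : Type*} [MeasurableSpace Ω] {μ : Measure Ω}
    [IsFiniteMeasure μ] [Finite ι] [MeasurableSpace ι] [MeasurableSingletonClass ι] {Y : Ω → ι}
    (hY : Measurable Y) (g : ι → ℝ) : Integrable (fun ω => g (Y ω)) μ := by
  have : Integrable g (μ.map Y) := Integrable.of_finite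
  exact this.comp_measurable hY

theorem MDP.integral_pathMeasure_zero (M : MDP S A) (π : Policy S A) (s : S) (g : S × A → ℝ) :
    ∫ ω, g (ω 0) ∂M.pathMeasure π s = ∑ a, π.prob s a * g (s, a) := by
  have hmap : (M.pathMeasure π s).map (fun ω => ω 0) = (π.startPMF s).toMeasure := by
    have h1 : (M.pathMeasure π s).map (Preorder.frestrictLe 0) =
        (π.startPMF s).toMeasure.map (MeasurableEquiv.piUnique
          (fun i : Finset.Iic 0 => (fun _ : ℕ => S × A) i)).symm := by
      rw [MDP.pathMeasure, Kernel.trajMeasure, Measure.map_comp _ _ (by fun_prop),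
        Kernel.traj_map_frestrictLe, Kernel.partialTraj_self, Measure.id_comp]
    have h2 : (fun ω : ℕ → S × A => ω 0) =
        (fun h : (i : Finset.Iic 0) → (fun _ : ℕ => S × A) i =>
          h ⟨0, Finset.mem_Iic.2 le_rfl⟩) ∘ Preorder.frestrictLe 0 := rfl
    rw [h2, ← Measure.map_map (by fun_prop) (by fun_prop), h1,
      Measure.map_map (by fun_prop) (by fun_prop)]
    exact Measure.map_id
  rw [← Policy.integral_startPMF, ← hmap, integral_map (measurable_pi_apply 0).aemeasurable
    (measurable_of_countable g).aestronglyMeasurable]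

/-- Disintegrate the path law at time `k`; iterating turns expectations at any time into iterates of
`nextExp`. -/
theorem MDP.integral_pathMeasure_succ (M : MDP S A) (π : Policy S A) (s : S) (k : ℕ)
    (g : S × A → ℝ) :
    ∫ ω, g (ω (k + 1)) ∂M.pathMeasure π s = ∫ ω, M.nextExp π g (ω k) ∂M.pathMeasure π s := by
  have h := Kernel.map_frestrictLe_trajMeasure_compProd_eq_map_trajMeasure
    (X := fun _ : ℕ => S × A) (μ₀ := (π.startPMF s).toMeasure) (κ := M.stepKernel π) (a := k)
  change (M.pathMeasure π s).map (Preorder.frestrictLe k) ⊗ₘ M.stepKernel π k =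
    (M.pathMeasure π s).map (fun x => (Preorder.frestrictLe k x, x (k + 1))) at h
  have hg : Measurable g := measurable_of_countable g
  have hmeas : Measurable (fun x : ℕ → S × A => (Preorder.frestrictLe (π := fun _ => S × A) k x,
    x (k + 1))) := by fun_prop
  have : IsProbabilityMeasure
      ((M.pathMeasure π s).map (Preorder.frestrictLe (π := fun _ => S × A) k)) :=
    Measure.isProbabilityMeasure_map (by fun_prop)
  have hint : Integrable (fun p : ((i : Finset.Iic k) → (fun _ : ℕ => S × A) i) × (S × A) =>
      g p.2) ((M.pathMeasure π s).map (Preorder.frestrictLe k) ⊗ₘ M.stepKernel π k) :=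
    integrable_of_finite_comp measurable_snd g
  have h1 := Measure.integral_compProd hint
  rw [h, integral_map hmeas.aemeasurable
    (Measurable.aestronglyMeasurable (by exact hg.comp measurable_snd))] at h1
  rw [h1, integral_map (by fun_prop)]
  · refine integral_congr_ae (Filter.Eventually.of_forall fun ω => ?_)
    exact M.integral_nextPMF π (ω k) g
  · exact (Measurable.of_discrete).aestronglyMeasurable

theorem MDP.integral_pathMeasure (M : MDP S A) (π : Policy S A) (s : S) (k : ℕ)
    (g : S × A → ℝ) :
    ∫ ω, g (ω k) ∂M.pathMeasure π s = ∑ a, π.prob s a * ((M.nextExp π)^[k] g) (s, a) := by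
  induction k generalizing g with
  | zero => exact M.integral_pathMeasure_zero π s g
  | succ k ih => rw [M.integral_pathMeasure_succ, ih, Function.iterate_succ_apply]

/-- The Bellman equation for the value function. -/
theorem MDP.value_eq (M : MDP S A) (π : Policy S A) (s : S) :
    M.value π s = ∑ a, π.prob s a * (M.R s a + M.γ * ∑ s', M.P a s s' * M.value π s') := by
  set r : S × A → ℝ := fun x => M.R x.1 x.2 with hr
  have hr1 : ∀ x, |r x| ≤ 1 := fun x => by
    rw [abs_of_nonneg (M.R_mem _ _).1]; exact (M.R_mem _ _).2
  have hit : ∀ k x, |((M.nextExp π)^[k] r) x| ≤ 1 := by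
    intro k
    induction k with
    | zero => exact hr1
    | succ k ih => rw [Function.iterate_succ_apply']; exact M.abs_nextExp_le π ih
  have hgeom : Summable fun k : ℕ => M.γ ^ k :=
    summable_geometric_of_lt_one M.γ_pos.le M.γ_lt_one
  have hsum : ∀ x, Summable fun k : ℕ => M.γ ^ k * ((M.nextExp π)^[k] r) x := fun x => by
    refine Summable.of_norm_bounded hgeom fun k => ?_
    rw [norm_mul, Real.norm_of_nonneg (pow_nonneg M.γ_pos.le k)]
    exact mul_le_of_le_one_right (pow_nonneg M.γ_pos.le k) (hit k x)
  -- The action-value function. The value is its average over actions, and splitting off its term `k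
  -- = 0` gives the Bellman equation.
  set q : S × A → ℝ := fun x => ∑' k : ℕ, M.γ ^ k * ((M.nextExp π)^[k] r) x with hq
  have hqsum : ∀ x, HasSum (fun k : ℕ => M.γ ^ k * ((M.nextExp π)^[k] r) x) (q x) :=
    fun x => (hsum x).hasSum
  have hvalue : ∀ s, M.value π s = ∑ a, π.prob s a * q (s, a) := by
    intro s
    have hint : ∀ k : ℕ, Integrable (fun ω : ℕ → S × A => M.γ ^ k * M.R (ω k).1 (ω k).2)
        (M.pathMeasure π s) := fun k =>
      integrable_of_finite_comp (Y := fun ω : ℕ → S × A => ω k) (measurable_pi_apply k) (fun x : S × A => M.γ ^ k * M.R x.1 x.2)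
    have hnorm : Summable fun k : ℕ =>
        ∫ ω, ‖M.γ ^ k * M.R (ω k).1 (ω k).2‖ ∂M.pathMeasure π s := by
      refine Summable.of_nonneg_of_le (fun k => integral_nonneg fun _ => norm_nonneg _)
        (fun k => ?_) hgeom
      calc _ ≤ ∫ _ω, M.γ ^ k ∂M.pathMeasure π s := by
            refine integral_mono (hint k).norm (integrable_const _) fun ω => ?_
            simp only [norm_mul, Real.norm_of_nonneg (pow_nonneg M.γ_pos.le k)]
            exact mul_le_of_le_one_right (pow_nonneg M.γ_pos.le k) (hr1 (ω k))
        _ = _ := by simp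
    have h1 := hasSum_integral_of_summable_integral_norm hint hnorm
    have h2 : HasSum (fun k : ℕ => ∑ a, π.prob s a * (M.γ ^ k * ((M.nextExp π)^[k] r) (s, a)))
        (∑ a, π.prob s a * q (s, a)) := hasSum_sum fun a _ => (hqsum (s, a)).mul_left _
    have h3 := h1.tsum_eq
    rw [← h2.tsum_eq, MDP.value, ← h3]
    refine tsum_congr fun k => ?_
    rw [integral_const_mul, M.integral_pathMeasure π s k r, Finset.mul_sum]
    exact Finset.sum_congr rfl fun a _ => by ring
  have hqeq : ∀ x, q x = r x + M.γ * ∑ s', M.P x.2 x.1 s' * M.value π s' := by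
    intro x
    have h1 : HasSum (fun k : ℕ => M.γ * ∑ s', M.P x.2 x.1 s' * ∑ a', π.prob s' a' *
        (M.γ ^ k * ((M.nextExp π)^[k] r) (s', a')))
        (M.γ * ∑ s', M.P x.2 x.1 s' * ∑ a', π.prob s' a' * q (s', a')) :=
      (hasSum_sum fun s' _ =>
        (hasSum_sum fun a' _ => (hqsum (s', a')).mul_left _).mul_left _).mul_left _
    simp_rw [← hvalue] at h1
    change ∑' k : ℕ, M.γ ^ k * ((M.nextExp π)^[k] r) x = _
    rw [(hsum x).tsum_eq_zero_add, ← h1.tsum_eq]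
    simp only [pow_zero, one_mul, Function.iterate_zero, id]
    congr 1
    refine tsum_congr fun k => ?_
    rw [Function.iterate_succ_apply', MDP.nextExp, Finset.mul_sum, Finset.mul_sum]
    refine Finset.sum_congr rfl fun s' _ => ?_
    rw [pow_succ']
    simp_rw [mul_left_comm _ (M.γ ^ k)]
    rw [← Finset.mul_sum]
    ring
  rw [hvalue]
  exact Finset.sum_congr rfl fun a _ => by rw [hqeq]

end ValueFunction

/-! ### The Markov property of trajectories, through sums over finite histories. -/

section Trajectory

open Matrix

/-- `φ` only depends on the states up to time `j` and on the actions before time `j`. -/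
def HistDep {S A β : Type*} (j : ℕ) (φ : (ℕ → S) → (ℕ → A) → β) : Prop :=
  ∀ x x' z z', (∀ i ≤ j, x i = x' i) → (∀ i < j, z i = z' i) → φ x z = φ x' z'

theorem HistDep.mono {S A β : Type*} {j k : ℕ} {φ : (ℕ → S) → (ℕ → A) → β} (h : HistDep j φ)
    (hjk : j ≤ k) : HistDep k φ := fun x x' z z' hx hz =>
  h x x' z z' (fun i hi => hx i (hi.trans hjk)) (fun i hi => hz i (hi.trans_le hjk))

theorem integral_finite_comp {Ω ι : Type*} [MeasurableSpace Ω] {μ : Measure Ω}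
    [IsFiniteMeasure μ] [Fintype ι] [MeasurableSpace ι] [MeasurableSingletonClass ι] {Y : Ω → ι}
    (hY : Measurable Y) (g : ι → ℝ) :
    ∫ ω, g (Y ω) ∂μ = ∑ y, μ.real (Y ⁻¹' {y}) * g y := by
  rw [← integral_map hY.aemeasurable (measurable_of_countable g).aestronglyMeasurable,
    integral_fintype Integrable.of_finite]
  refine Finset.sum_congr rfl fun y _ => ?_
  rw [smul_eq_mul, measureReal_def, measureReal_def, Measure.map_apply hY (measurableSet_singleton y)]

/-- A section of the restriction to finite histories: a history-dependent functional becomes a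
function on a finite type, so it is integrable and its integral is a finite sum. -/
theorem exists_history_extension {S A : Type*} [Nonempty S] [Nonempty A] (j : ℕ) :
    ∃ e : (Fin (j + 1) → S) × (Fin j → A) → (ℕ → S) × (ℕ → A),
      (∀ h (i : Fin (j + 1)), (e h).1 i = h.1 i) ∧ ∀ h (i : Fin j), (e h).2 i = h.2 i := by
  refine ⟨fun h => (fun i => if hi : i < j + 1 then h.1 ⟨i, hi⟩ else Classical.arbitrary S,
    fun i => if hi : i < j then h.2 ⟨i, hi⟩ else Classical.arbitrary A), ?_, ?_⟩
  · intro h i; exact dif_pos i.2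
  · intro h i; exact dif_pos i.2

variable {S A : Type*} [Fintype S] [Fintype A]
  [MeasurableSpace S] [DiscreteMeasurableSpace S] [MeasurableSpace A] [DiscreteMeasurableSpace A]
  {M : MDP S A} {π : Policy S A} {Ω : Type*} [MeasurableSpace Ω] {μ : Measure Ω}
  [IsProbabilityMeasure μ] {X : ℕ → Ω → S} {Z : ℕ → Ω → A}

namespace MDP.IsTrajectory

/-- Sum the defining path probabilities over the action at time `j`, which has total conditional
mass 1. -/
theorem measureReal_path (h : M.IsTrajectory π μ X Z) (j : ℕ) (s : ℕ → S) (a : ℕ → A) :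
    μ.real {ω | (∀ i ≤ j, X i ω = s i) ∧ ∀ i < j, Z i ω = a i} =
      μ.real {ω | X 0 ω = s 0} * (∏ i ∈ Finset.range j, π.prob (s i) (a i)) *
        ∏ i ∈ Finset.range j, M.P (a i) (s i) (s (i + 1)) := by
  classical
  have hunion : {ω | (∀ i ≤ j, X i ω = s i) ∧ ∀ i < j, Z i ω = a i} =
      ⋃ b ∈ (Finset.univ : Finset A), {ω | ∀ i ≤ j, X i ω = s i ∧
        Z i ω = Function.update a j b i} := by
    ext ω
    simp only [Set.mem_ofPred_eq, Finset.mem_univ, Set.iUnion_true, Set.mem_iUnion]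
    constructor
    · rintro ⟨h1, h2⟩
      refine ⟨Z j ω, fun i hi => ⟨h1 i hi, ?_⟩⟩
      rcases hi.eq_or_lt with rfl | hlt
      · simp
      · rw [Function.update_of_ne hlt.ne]; exact h2 i hlt
    · rintro ⟨b, hb⟩
      refine ⟨fun i hi => (hb i hi).1, fun i hi => ?_⟩
      have := (hb i hi.le).2
      rwa [Function.update_of_ne hi.ne] at this
  rw [hunion, measureReal_biUnion_finset]
  · simp_rw [h.prob_path]
    have e1 : ∀ b, ∏ i ∈ Finset.range j, M.P (Function.update a j b i) (s i) (s (i + 1)) =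
        ∏ i ∈ Finset.range j, M.P (a i) (s i) (s (i + 1)) := fun b =>
      Finset.prod_congr rfl fun i hi => by
        rw [Function.update_of_ne (Finset.mem_range.1 hi).ne]
    have e2 : ∀ b, ∏ i ∈ Finset.range (j + 1), π.prob (s i) (Function.update a j b i) =
        (∏ i ∈ Finset.range j, π.prob (s i) (a i)) * π.prob (s j) b := fun b => by
      rw [Finset.prod_range_succ, Function.update_self]
      congr 1
      exact Finset.prod_congr rfl fun i hi => by
        rw [Function.update_of_ne (Finset.mem_range.1 hi).ne]
    simp_rw [e1, e2]
    rw [← Finset.sum_mul, ← Finset.mul_sum, ← Finset.mul_sum, π.sum_one, mul_one]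
  · intro b _ b' _ hbb
    refine Set.disjoint_left.2 fun ω hω hω' => hbb ?_
    have h1 := (hω j le_rfl).2
    have h2 := (hω' j le_rfl).2
    rw [Function.update_self] at h1 h2
    exact h1.symm.trans h2
  · intro b _
    simp only [Set.ofPred_forall, Set.ofPred_and]
    exact MeasurableSet.iInter fun i => MeasurableSet.iInter fun _ =>
      (h.measurable_state i (measurableSet_singleton (s i))).inter
        (h.measurable_action i (measurableSet_singleton _))

theorem measureReal_path_succ (h : M.IsTrajectory π μ X Z) (j : ℕ) (s : ℕ → S) (a : ℕ → A) :
    μ.real {ω | (∀ i ≤ j + 1, X i ω = s i) ∧ ∀ i < j + 1, Z i ω = a i} =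
      μ.real {ω | (∀ i ≤ j, X i ω = s i) ∧ ∀ i < j, Z i ω = a i} *
        (π.prob (s j) (a j) * M.P (a j) (s j) (s (j + 1))) := by
  rw [h.measureReal_path, h.measureReal_path, Finset.prod_range_succ, Finset.prod_range_succ]
  ring

theorem integrable (h : M.IsTrajectory π μ X Z) {j : ℕ} {φ : (ℕ → S) → (ℕ → A) → ℝ}
    (hφ : HistDep j φ) : Integrable (fun ω => φ (fun i => X i ω) (fun i => Z i ω)) μ := by
  obtain ⟨ω₀⟩ := nonempty_of_isProbabilityMeasure μ
  have : Nonempty S := ⟨X 0 ω₀⟩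
  have : Nonempty A := ⟨Z 0 ω₀⟩
  obtain ⟨e, he1, he2⟩ := exists_history_extension (S := S) (A := A) j
  have hY : Measurable fun ω => ((fun i : Fin (j + 1) => X i ω), (fun i : Fin j => Z i ω)) :=
    (measurable_pi_lambda (fun ω (i : Fin (j + 1)) => X i ω) fun i => h.measurable_state i).prodMk
      (measurable_pi_lambda (fun ω (i : Fin j) => Z i ω) fun i => h.measurable_action i)
  refine (integrable_of_finite_comp (μ := μ) hY fun y => φ (e y).1 (e y).2).congr
    (Filter.Eventually.of_forall fun ω => hφ _ _ _ _ (fun i hi => ?_) fun i hi => ?_)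
  · exact he1 _ ⟨i, by omega⟩
  · exact he2 _ ⟨i, hi⟩

/-- The Markov property of a trajectory, in integrated form. -/
theorem integral_step (h : M.IsTrajectory π μ X Z) {j : ℕ}
    {φ : (ℕ → S) → (ℕ → A) → A → S → ℝ} (hφ : ∀ a s', HistDep j fun x z => φ x z a s') :
    ∫ ω, φ (fun i => X i ω) (fun i => Z i ω) (Z j ω) (X (j + 1) ω) ∂μ =
      ∫ ω, ∑ a, π.prob (X j ω) a * ∑ s', M.P a (X j ω) s' *
        φ (fun i => X i ω) (fun i => Z i ω) a s' ∂μ := by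
  classical
  obtain ⟨ω₀⟩ := nonempty_of_isProbabilityMeasure μ
  have : Nonempty S := ⟨X 0 ω₀⟩
  have : Nonempty A := ⟨Z 0 ω₀⟩
  obtain ⟨e, he1, he2⟩ := exists_history_extension (S := S) (A := A) j
  set H : Ω → (Fin (j + 1) → S) × (Fin j → A) :=
    fun ω => ((fun i : Fin (j + 1) => X i ω), (fun i : Fin j => Z i ω)) with hH
  have hHm : Measurable H :=
    (measurable_pi_lambda (fun ω (i : Fin (j + 1)) => X i ω) fun i => h.measurable_state i).prodMk
      (measurable_pi_lambda (fun ω (i : Fin j) => Z i ω) fun i => h.measurable_action i)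
  have hYm : Measurable fun ω => (H ω, Z j ω, X (j + 1) ω) :=
    hHm.prodMk ((h.measurable_action j).prodMk (h.measurable_state (j + 1)))
  have hrep : ∀ ω a s', φ (fun i => X i ω) (fun i => Z i ω) a s' =
      φ (e (H ω)).1 (e (H ω)).2 a s' := fun ω a s' =>
    hφ a s' _ _ _ _ (fun i hi => (he1 (H ω) ⟨i, by omega⟩).symm)
      (fun i hi => (he2 (H ω) ⟨i, hi⟩).symm)
  have hXj : ∀ ω, X j ω = (e (H ω)).1 j := fun ω => (he1 (H ω) ⟨j, by omega⟩).symm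
  have hL := integral_finite_comp (μ := μ) hYm
    fun y => φ (e y.1).1 (e y.1).2 y.2.1 y.2.2
  have hR := integral_finite_comp (μ := μ) hHm fun y => ∑ a, π.prob ((e y).1 j) a *
    ∑ s', M.P a ((e y).1 j) s' * φ (e y).1 (e y).2 a s'
  simp_rw [hrep, hXj]
  rw [hR]
  refine hL.trans ?_
  rw [Fintype.sum_prod_type]
  refine Finset.sum_congr rfl fun y _ => ?_
  rw [Fintype.sum_prod_type, Finset.mul_sum]
  refine Finset.sum_congr rfl fun a _ => ?_
  rw [Finset.mul_sum, Finset.mul_sum]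
  refine Finset.sum_congr rfl fun s' _ => ?_
  -- The extension of `y` is overwritten at action `j` and state `j + 1`; neither coordinate is part
  -- of `y`, so one pair of sequences describes both the history and its one-step continuation.
  have hset : (fun ω => (H ω, Z j ω, X (j + 1) ω)) ⁻¹' {(y, a, s')} =
      {ω | (∀ i ≤ j + 1, X i ω = Function.update (e y).1 (j + 1) s' i) ∧
        ∀ i < j + 1, Z i ω = Function.update (e y).2 j a i} := by
    ext ω
    simp only [Set.mem_preimage, Set.mem_singleton_iff, Prod.mk.injEq, Set.mem_ofPred_eq]
    constructor
    · rintro ⟨h1, h2, h3⟩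
      refine ⟨fun i hi => ?_, fun i hi => ?_⟩
      · rcases hi.eq_or_lt with rfl | hlt
        · rw [Function.update_self, h3]
        · rw [Function.update_of_ne hlt.ne, he1 y ⟨i, hlt⟩, ← h1]
      · rcases (Nat.lt_succ_iff.1 hi).eq_or_lt with rfl | hlt
        · rw [Function.update_self, h2]
        · rw [Function.update_of_ne hlt.ne, he2 y ⟨i, hlt⟩, ← h1]
    · rintro ⟨h1, h2⟩
      refine ⟨Prod.ext (funext fun i => ?_) (funext fun i => ?_), ?_, ?_⟩
      · have := h1 i (by omega)
        rwa [Function.update_of_ne (by omega), he1] at this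
      · have := h2 i (by omega)
        rwa [Function.update_of_ne (by omega), he2] at this
      · simpa using h2 j (by omega)
      · simpa using h1 (j + 1) le_rfl
  have hset2 : H ⁻¹' {y} = {ω | (∀ i ≤ j, X i ω = Function.update (e y).1 (j + 1) s' i) ∧
        ∀ i < j, Z i ω = Function.update (e y).2 j a i} := by
    ext ω
    simp only [Set.mem_preimage, Set.mem_singleton_iff, Set.mem_ofPred_eq]
    constructor
    · intro h1
      refine ⟨fun i hi => ?_, fun i hi => ?_⟩
      · rw [Function.update_of_ne (by omega), he1 y ⟨i, by omega⟩, ← h1]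
      · rw [Function.update_of_ne (by omega), he2 y ⟨i, hi⟩, ← h1]
    · rintro ⟨h1, h2⟩
      refine Prod.ext (funext fun i => ?_) (funext fun i => ?_)
      · have := h1 i (by omega)
        rwa [Function.update_of_ne (by omega), he1] at this
      · have := h2 i i.2
        rwa [Function.update_of_ne (by omega), he2] at this
  rw [hset, h.measureReal_path_succ, ← hset2, Function.update_self, Function.update_self,
    Function.update_of_ne (by omega)]
  ring

/-- The transition matrix weighted by a function of the state-action pair. -/
def _root_.MDP.weightedMatrix (M : MDP S A) (π : Policy S A) (c : S → A → ℝ) : Matrix S S ℝ :=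
  of fun s s' => ∑ a, π.prob s a * (c s a * M.P a s s')

variable [DecidableEq S]

/-- Each induction step integrates out the last transition, which absorbs its weight `c` into `F` as
a multiplication by the weighted matrix; `F` must therefore stay general and may depend on the
history up to `k`. -/
theorem integral_prod_mul_state (h : M.IsTrajectory π μ X Z) (c : S → A → ℝ) (k i : ℕ)
    {F : (ℕ → S) → (ℕ → A) → S → ℝ} (hF : ∀ s, HistDep k fun x z => F x z s) :
    ∫ ω, (∏ j ∈ Finset.range i, c (X (k + j) ω) (Z (k + j) ω)) *
        F (fun i => X i ω) (fun i => Z i ω) (X (k + i) ω) ∂μ =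
      ∫ ω, (M.weightedMatrix π c ^ i *ᵥ F (fun i => X i ω) (fun i => Z i ω)) (X k ω) ∂μ := by
  induction i generalizing F with
  | zero => simp
  | succ i ih =>
    have hstep := h.integral_step (j := k + i) (φ := fun x z a s' =>
      (∏ j ∈ Finset.range i, c (x (k + j)) (z (k + j))) * c (x (k + i)) a * F x z s') (by
        intro a s' x x' z z' hx hz
        have hF' : F x z s' = F x' z' s' := hF s' x x' z z' (fun l hl => hx l (by omega))
          (fun l hl => hz l (by omega))
        simp only
        rw [hx (k + i) le_rfl, hF']
        congr 2
        refine Finset.prod_congr rfl fun j hj => ?_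
        have := Finset.mem_range.1 hj
        rw [hx _ (by omega), hz _ (by omega)])
    have hFW : ∀ s, HistDep k fun x z => (M.weightedMatrix π c *ᵥ F x z) s := by
      intro s x x' z z' hx hz
      simp only [mulVec, dotProduct]
      exact Finset.sum_congr rfl fun s' _ => congrArg _ (hF s' x x' z z' hx hz)
    have hih := ih hFW
    simp_rw [Finset.prod_range_succ]
    refine hstep.trans ?_
    simp_rw [pow_succ, ← mulVec_mulVec]
    rw [← hih]
    refine integral_congr_ae (Filter.Eventually.of_forall fun ω => ?_)
    simp only [MDP.weightedMatrix, mulVec, dotProduct, of_apply, Finset.mul_sum, Finset.sum_mul]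
    rw [Finset.sum_comm]
    exact Finset.sum_congr rfl fun s' _ => Finset.sum_congr rfl fun a _ => by ring

theorem integral_prod_mul_transition (h : M.IsTrajectory π μ X Z) (c : S → A → ℝ) (k i : ℕ)
    {G : (ℕ → S) → (ℕ → A) → S → A → S → ℝ} (hG : ∀ s a s', HistDep k fun x z => G x z s a s') :
    ∫ ω, (∏ j ∈ Finset.range i, c (X (k + j) ω) (Z (k + j) ω)) *
        G (fun i => X i ω) (fun i => Z i ω) (X (k + i) ω) (Z (k + i) ω) (X (k + i + 1) ω) ∂μ =
      ∫ ω, (M.weightedMatrix π c ^ i *ᵥ fun s => ∑ a, π.prob s a * ∑ s', M.P a s s' *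
        G (fun i => X i ω) (fun i => Z i ω) s a s') (X k ω) ∂μ := by
  have hstep := h.integral_step (j := k + i) (φ := fun x z a s' =>
    (∏ j ∈ Finset.range i, c (x (k + j)) (z (k + j))) * G x z (x (k + i)) a s') (by
      intro a s' x x' z z' hx hz
      have hG' : ∀ s, G x z s a s' = G x' z' s a s' := fun s =>
        hG s a s' x x' z z' (fun l hl => hx l (by omega)) (fun l hl => hz l (by omega))
      simp only
      rw [hx (k + i) le_rfl, hG']
      congr 1
      refine Finset.prod_congr rfl fun j hj => ?_
      have := Finset.mem_range.1 hj
      rw [hx _ (by omega), hz _ (by omega)])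
  refine hstep.trans ?_
  rw [← h.integral_prod_mul_state c k i (F := fun x z s => ∑ a, π.prob s a * ∑ s', M.P a s s' *
        G x z s a s') (by
      intro s x x' z z' hx hz
      simp only
      exact Finset.sum_congr rfl fun a _ => by
        congr 1
        exact Finset.sum_congr rfl fun s' _ => congrArg _ (hG s a s' x x' z z' hx hz))]
  refine integral_congr_ae (Filter.Eventually.of_forall fun ω => ?_)
  simp only [Finset.mul_sum]
  exact Finset.sum_congr rfl fun a _ => Finset.sum_congr rfl fun s' _ => by ring

end MDP.IsTrajectory

end Trajectory

/-! ### Conditional means and Lipschitz bounds of the V-trace increments. -/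

section MeanUpdate

open Matrix

variable {S A : Type*} [Fintype A]

theorem eta_eq_sum (n : ℕ) (γ c : ℝ) : eta n γ c = ∑ i ∈ Finset.range n, (γ * c) ^ i := by
  rw [eta]
  split_ifs with h
  · simp [h]
  · rw [geom_sum_eq h, ← neg_div_neg_eq]
    congr 1 <;> ring

theorem truncRatio_nonneg (πb π : Policy S A) {τ : ℝ} (hτ : 0 ≤ τ) (s : S) (a : A) :
    0 ≤ truncRatio πb π τ s a :=
  le_min hτ (div_nonneg (π.nonneg s a) (πb.nonneg s a))

theorem truncRatio_le (πb π : Policy S A) (τ : ℝ) (s : S) (a : A) :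
    truncRatio πb π τ s a ≤ τ := min_le_left _ _

/-- Coverage is what makes this hold at `πb(a | s) = 0`, where it forces `π(a | s) = 0` and both
sides vanish. -/
theorem prob_mul_truncRatio {πb π : Policy S A} (hcov : Covers πb π) (τ : ℝ) (s : S) (a : A) :
    πb.prob s a * truncRatio πb π τ s a = min (τ * πb.prob s a) (π.prob s a) := by
  rcases (πb.nonneg s a).eq_or_lt with h | h
  · have : π.prob s a = 0 := by
      refine le_antisymm (not_lt.1 fun hpos => ?_) (π.nonneg s a)
      exact (hcov s a hpos).ne h
    simp [← h, this]
  · rw [truncRatio, mul_min_of_nonneg _ _ h.le, mul_div_cancel₀ _ h.ne', mul_comm]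

theorem truncMass_le_one (πb π : Policy S A) (τ : ℝ) (s : S) : truncMass πb π τ s ≤ 1 :=
  (Finset.sum_le_sum fun _ _ => min_le_right _ _).trans_eq (π.sum_one s)

namespace MDP

variable [Fintype S] (M : MDP S A) {πb π : Policy S A}

theorem weightedMatrix_truncRatio_apply (hcov : Covers πb π) (τ : ℝ) (s s' : S) :
    M.weightedMatrix πb (truncRatio πb π τ) s s' =
      ∑ a, min (τ * πb.prob s a) (π.prob s a) * M.P a s s' := by
  simp only [weightedMatrix, of_apply]
  exact Finset.sum_congr rfl fun a _ => by rw [← mul_assoc, prob_mul_truncRatio hcov]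

theorem weightedMatrix_truncRatio_mulVec_one (hcov : Covers πb π) (τ : ℝ) (s : S) :
    (M.weightedMatrix πb (truncRatio πb π τ) *ᵥ 1) s = truncMass πb π τ s := by
  simp only [mulVec, dotProduct, weightedMatrix_truncRatio_apply M hcov, Pi.one_apply, mul_one]
  rw [Finset.sum_comm, truncMass]
  exact Finset.sum_congr rfl fun a _ => by rw [← Finset.mul_sum, M.P_sum, mul_one]

theorem weightedMatrix_truncRatio_nonneg {τ : ℝ} (hτ : 0 ≤ τ) (s s' : S) :
    0 ≤ M.weightedMatrix πb (truncRatio πb π τ) s s' :=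
  Finset.sum_nonneg fun a _ => mul_nonneg (πb.nonneg s a)
    (mul_nonneg (truncRatio_nonneg πb π hτ s a) (M.P_nonneg a s s'))

theorem weightedMatrix_truncRatio_mono {τ τ' : ℝ} (h : τ ≤ τ') (s s' : S) :
    M.weightedMatrix πb (truncRatio πb π τ) s s' ≤
      M.weightedMatrix πb (truncRatio πb π τ') s s' :=
  Finset.sum_le_sum fun a _ => mul_le_mul_of_nonneg_left
    (mul_le_mul_of_nonneg_right (min_le_min_right _ h) (M.P_nonneg a s s')) (πb.nonneg s a)

variable (πb π)

/-- The conditional mean of the truncated temporal difference at the state `s`. -/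
def meanTempDiff (rhobar : ℝ) (V : S → ℝ) (s : S) : ℝ :=
  ∑ a, πb.prob s a * ∑ s', M.P a s s' * (truncRatio πb π rhobar s a * M.tempDiff V s a s')

/-- The multi-step increment of the V-trace iteration at time `k`, with stepsize one. -/
def vtraceIncr (n : ℕ) (cbar rhobar : ℝ) (V : S → ℝ) (x : ℕ → S) (z : ℕ → A) (k : ℕ) : ℝ :=
  ∑ i ∈ Finset.range n,
    M.γ ^ i * (∏ j ∈ Finset.range i, truncRatio πb π cbar (x (k + j)) (z (k + j))) *
      truncRatio πb π rhobar (x (k + i)) (z (k + i)) *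
      M.tempDiff V (x (k + i)) (z (k + i)) (x (k + i + 1))

variable {πb π}

theorem meanTempDiff_eq (hcov : Covers πb π) (rhobar : ℝ) (V : S → ℝ) (s : S) :
    M.meanTempDiff πb π rhobar V s = ∑ a, min (rhobar * πb.prob s a) (π.prob s a) *
      (M.R s a + M.γ * ∑ s', M.P a s s' * V s' - V s) := by
  refine Finset.sum_congr rfl fun a _ => ?_
  have : ∑ s', M.P a s s' * (truncRatio πb π rhobar s a * M.tempDiff V s a s') =
      truncRatio πb π rhobar s a * (M.R s a + M.γ * ∑ s', M.P a s s' * V s' - V s) := by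
    have e : ∀ s', M.P a s s' * (truncRatio πb π rhobar s a * M.tempDiff V s a s') =
        truncRatio πb π rhobar s a * (M.P a s s' * M.R s a + M.γ * (M.P a s s' * V s') -
          M.P a s s' * V s) := fun s' => by rw [tempDiff]; ring
    simp_rw [e]
    rw [← Finset.mul_sum, Finset.sum_sub_distrib, Finset.sum_add_distrib, ← Finset.sum_mul,
      ← Finset.sum_mul, ← Finset.mul_sum, M.P_sum, one_mul, one_mul]
  rw [this, ← mul_assoc, prob_mul_truncRatio hcov]

/-- The truncated weights are `D(s)` times the truncated policy, so the mean temporal difference is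
`D(s)` times the Bellman residual of that policy. -/
theorem meanTempDiff_value [MeasurableSpace S] [DiscreteMeasurableSpace S] [MeasurableSpace A]
    [DiscreteMeasurableSpace A] {rhobar : ℝ} (hr : 1 ≤ rhobar) (hcov : Covers πb π) :
    M.meanTempDiff πb π rhobar (M.value (truncPolicy πb π rhobar hr hcov)) = 0 := by
  ext s
  rw [meanTempDiff_eq M hcov]
  set V := M.value (truncPolicy πb π rhobar hr hcov) with hV
  have hpos := truncMass_pos πb π hr hcov s
  have hb := M.value_eq (truncPolicy πb π rhobar hr hcov) s
  rw [← hV] at hb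
  have e : ∀ a, min (rhobar * πb.prob s a) (π.prob s a) =
      truncMass πb π rhobar s * (truncPolicy πb π rhobar hr hcov).prob s a := fun a => by
    simp only [truncPolicy]
    field_simp
  simp_rw [e, mul_assoc, mul_sub]
  rw [Finset.sum_sub_distrib, ← Finset.mul_sum, ← Finset.mul_sum, ← hb, ← Finset.sum_mul,
    Policy.sum_one]
  simp

theorem abs_vtraceIncr_sub_le {n : ℕ} {cbar rhobar : ℝ} (hc : 0 ≤ cbar) (hr : 0 ≤ rhobar)
    (V V' : S → ℝ) (x : ℕ → S) (z : ℕ → A) (k : ℕ) :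
    |M.vtraceIncr πb π n cbar rhobar V x z k - M.vtraceIncr πb π n cbar rhobar V' x z k| ≤
      2 * rhobar * eta n M.γ cbar * ‖V - V'‖ := by
  rw [vtraceIncr, vtraceIncr, ← Finset.sum_sub_distrib, eta_eq_sum, Finset.mul_sum, Finset.sum_mul]
  refine (Finset.abs_sum_le_sum_abs _ _).trans (Finset.sum_le_sum fun i _ => ?_)
  rw [← mul_sub, abs_mul, abs_mul, abs_mul, abs_of_nonneg (pow_nonneg M.γ_pos.le i),
    abs_of_nonneg (truncRatio_nonneg πb π hr _ _), abs_of_nonneg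
    (Finset.prod_nonneg fun j _ => truncRatio_nonneg πb π hc _ _)]
  have h1 : ∏ j ∈ Finset.range i, truncRatio πb π cbar (x (k + j)) (z (k + j)) ≤ cbar ^ i := by
    refine (Finset.prod_le_prod (fun j _ => truncRatio_nonneg πb π hc _ _)
      fun j _ => truncRatio_le πb π cbar _ _).trans_eq (by simp)
  have h2 : |M.tempDiff V (x (k + i)) (z (k + i)) (x (k + i + 1)) -
      M.tempDiff V' (x (k + i)) (z (k + i)) (x (k + i + 1))| ≤ 2 * ‖V - V'‖ := by
    have e : M.tempDiff V (x (k + i)) (z (k + i)) (x (k + i + 1)) -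
      M.tempDiff V' (x (k + i)) (z (k + i)) (x (k + i + 1)) =
      M.γ * (V - V') (x (k + i + 1)) - (V - V') (x (k + i)) := by
      simp only [tempDiff, Pi.sub_apply]; ring
    rw [e]
    refine (abs_sub _ _).trans ?_
    rw [abs_mul, abs_of_pos M.γ_pos]
    have h3 := norm_le_pi_norm (V - V') (x (k + i))
    have h4 := norm_le_pi_norm (V - V') (x (k + i + 1))
    rw [Real.norm_eq_abs] at h3 h4
    have h5 := mul_le_of_le_one_left (abs_nonneg ((V - V') (x (k + i + 1)))) M.γ_lt_one.le
    linarith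
  calc _ ≤ M.γ ^ i * cbar ^ i * rhobar * (2 * ‖V - V'‖) := by
        have h6 := truncRatio_le πb π rhobar (x (k + i)) (z (k + i))
        have h7 := truncRatio_nonneg πb π hr (x (k + i)) (z (k + i))
        have h8 : 0 ≤ M.γ ^ i := pow_nonneg M.γ_pos.le i
        have h9 : 0 ≤ ∏ j ∈ Finset.range i, truncRatio πb π cbar (x (k + j)) (z (k + j)) :=
          Finset.prod_nonneg fun j _ => truncRatio_nonneg πb π hc _ _
        gcongr
    _ = _ := by rw [mul_pow]; ring

/-- At `V = 0` only the rewards, which are at most 1, contribute; the rest is the Lipschitz bound.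
-/
theorem abs_vtraceIncr_le {n : ℕ} {cbar rhobar : ℝ} (hc : 0 ≤ cbar) (hr : 0 ≤ rhobar)
    (V : S → ℝ) (x : ℕ → S) (z : ℕ → A) (k : ℕ) :
    |M.vtraceIncr πb π n cbar rhobar V x z k| ≤
      2 * rhobar * eta n M.γ cbar * (‖V‖ + 1) := by
  have hη : 0 ≤ eta n M.γ cbar := by
    rw [eta_eq_sum]
    exact Finset.sum_nonneg fun i _ => pow_nonneg (mul_nonneg M.γ_pos.le hc) i
  have h0 : |M.vtraceIncr πb π n cbar rhobar 0 x z k| ≤ rhobar * eta n M.γ cbar := by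
    rw [vtraceIncr, eta_eq_sum, Finset.mul_sum]
    refine (Finset.abs_sum_le_sum_abs _ _).trans (Finset.sum_le_sum fun i _ => ?_)
    rw [abs_mul, abs_mul, abs_mul, abs_of_nonneg (pow_nonneg M.γ_pos.le i),
      abs_of_nonneg (truncRatio_nonneg πb π hr _ _), abs_of_nonneg
      (Finset.prod_nonneg fun j _ => truncRatio_nonneg πb π hc _ _)]
    have h1 : ∏ j ∈ Finset.range i, truncRatio πb π cbar (x (k + j)) (z (k + j)) ≤ cbar ^ i := by
      refine (Finset.prod_le_prod (fun j _ => truncRatio_nonneg πb π hc _ _)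
        fun j _ => truncRatio_le πb π cbar _ _).trans_eq (by simp)
    have h2 : |M.tempDiff 0 (x (k + i)) (z (k + i)) (x (k + i + 1))| ≤ 1 := by
      simp only [tempDiff, Pi.zero_apply, mul_zero, add_zero, sub_zero]
      rw [abs_of_nonneg (M.R_mem _ _).1]
      exact (M.R_mem _ _).2
    calc _ ≤ M.γ ^ i * cbar ^ i * rhobar * 1 := by
          have h6 := truncRatio_le πb π rhobar (x (k + i)) (z (k + i))
          have h7 := truncRatio_nonneg πb π hr (x (k + i)) (z (k + i))
          have h8 : 0 ≤ M.γ ^ i := pow_nonneg M.γ_pos.le i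
          have h9 : 0 ≤ ∏ j ∈ Finset.range i, truncRatio πb π cbar (x (k + j)) (z (k + j)) :=
            Finset.prod_nonneg fun j _ => truncRatio_nonneg πb π hc _ _
          gcongr
      _ = _ := by rw [mul_pow]; ring
  have h1 := M.abs_vtraceIncr_sub_le (πb := πb) (π := π) (n := n) hc hr V 0 x z k
  rw [sub_zero] at h1
  have h2 := abs_add_le (M.vtraceIncr πb π n cbar rhobar V x z k -
    M.vtraceIncr πb π n cbar rhobar 0 x z k) (M.vtraceIncr πb π n cbar rhobar 0 x z k)
  rw [sub_add_cancel] at h2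
  have h3 : 0 ≤ rhobar * eta n M.γ cbar := mul_nonneg hr hη
  linarith

variable [DecidableEq S]

theorem meanTempDiff_sub (hcov : Covers πb π) (rhobar : ℝ) (V V' : S → ℝ) :
    M.meanTempDiff πb π rhobar V - M.meanTempDiff πb π rhobar V' =
      (M.γ • M.weightedMatrix πb (truncRatio πb π rhobar) -
        diagonal (M.weightedMatrix πb (truncRatio πb π rhobar) *ᵥ 1)) *ᵥ (V - V') := by
  ext s
  rw [Pi.sub_apply, meanTempDiff_eq M hcov, meanTempDiff_eq M hcov, sub_mulVec, Pi.sub_apply,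
    smul_mulVec, Pi.smul_apply, mulVec_diagonal, weightedMatrix_truncRatio_mulVec_one M hcov,
    truncMass, ← Finset.sum_sub_distrib, Finset.sum_mul]
  simp only [mulVec, dotProduct, weightedMatrix_truncRatio_apply M hcov, smul_eq_mul,
    Finset.sum_mul, Finset.mul_sum]
  rw [Finset.sum_comm, ← Finset.sum_sub_distrib]
  refine Finset.sum_congr rfl fun a _ => ?_
  simp only [Pi.sub_apply, mul_sub, mul_add, Finset.sum_sub_distrib, Finset.mul_sum]
  have e : ∀ W : S → ℝ, ∑ s', M.γ * (min (rhobar * πb.prob s a) (π.prob s a) * M.P a s s' * W s') =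
      ∑ s', min (rhobar * πb.prob s a) (π.prob s a) * (M.γ * (M.P a s s' * W s')) := fun W =>
    Finset.sum_congr rfl fun s' _ => by ring
  rw [e, e]
  ring

variable (πb π) in
/-- The conditional mean of the multi-step increment given the current state. -/
def meanIncr (n : ℕ) (cbar rhobar : ℝ) (V : S → ℝ) (s : S) : ℝ :=
  ∑ i ∈ Finset.range n, M.γ ^ i *
    (M.weightedMatrix πb (truncRatio πb π cbar) ^ i *ᵥ M.meanTempDiff πb π rhobar V) s

theorem meanIncr_sub (hcov : Covers πb π) (n : ℕ) (cbar rhobar : ℝ) (V V' : S → ℝ) :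
    M.meanIncr πb π n cbar rhobar V - M.meanIncr πb π n cbar rhobar V' =
      multistepMatrix M.γ (M.weightedMatrix πb (truncRatio πb π cbar))
        (M.weightedMatrix πb (truncRatio πb π rhobar)) n *ᵥ (V - V') := by
  rw [multistepMatrix, sum_mulVec]
  ext s
  rw [Finset.sum_apply, Pi.sub_apply, meanIncr, meanIncr, ← Finset.sum_sub_distrib]
  refine Finset.sum_congr rfl fun i _ => ?_
  rw [← mulVec_mulVec, ← meanTempDiff_sub M hcov, smul_pow, smul_mulVec, Pi.smul_apply, mulVec_sub,
    Pi.sub_apply, smul_eq_mul]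
  ring

theorem norm_weightedMatrix_pow_mulVec_le (hcov : Covers πb π) {τ : ℝ} (hτ : 0 ≤ τ) (i : ℕ)
    (f : S → ℝ) : ‖M.weightedMatrix πb (truncRatio πb π τ) ^ i *ᵥ f‖ ≤ ‖f‖ := by
  induction i with
  | zero => simp
  | succ i ih =>
    rw [pow_succ', ← mulVec_mulVec]
    refine (pi_norm_le_iff_of_nonneg (norm_nonneg _)).2 fun s => ?_
    generalize M.weightedMatrix πb (truncRatio πb π τ) ^ i *ᵥ f = g at ih ⊢
    have h1 : ∑ s', M.weightedMatrix πb (truncRatio πb π τ) s s' ≤ 1 := by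
      have := weightedMatrix_truncRatio_mulVec_one M hcov τ s
      simp only [mulVec, dotProduct, Pi.one_apply, mul_one] at this
      rw [this]
      exact truncMass_le_one _ _ _ _
    calc _ ≤ ∑ s', M.weightedMatrix πb (truncRatio πb π τ) s s' * ‖f‖ := by
          refine (norm_sum_le _ _).trans (Finset.sum_le_sum fun s' _ => ?_)
          have h0 := M.weightedMatrix_truncRatio_nonneg (πb := πb) (π := π) hτ s s'
          rw [norm_mul, Real.norm_of_nonneg h0]
          exact mul_le_mul_of_nonneg_left ((norm_le_pi_norm g s').trans ih) h0
      _ ≤ _ := by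
          rw [← Finset.sum_mul]
          exact mul_le_of_le_one_left (norm_nonneg _) h1

theorem norm_meanTempDiff_sub_le (hcov : Covers πb π) {rhobar : ℝ} (hr : 0 ≤ rhobar)
    (V V' : S → ℝ) :
    ‖M.meanTempDiff πb π rhobar V - M.meanTempDiff πb π rhobar V'‖ ≤ 2 * ‖V - V'‖ := by
  rw [meanTempDiff_sub M hcov, sub_mulVec, smul_mulVec]
  refine (norm_sub_le _ _).trans ?_
  have h1 := norm_weightedMatrix_pow_mulVec_le M hcov hr 1 (V - V')
  rw [pow_one] at h1
  have h2 : ‖diagonal (M.weightedMatrix πb (truncRatio πb π rhobar) *ᵥ 1) *ᵥ (V - V')‖ ≤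
      ‖V - V'‖ := by
    refine (pi_norm_le_iff_of_nonneg (norm_nonneg _)).2 fun s => ?_
    have h0 : 0 ≤ truncMass πb π rhobar s := Finset.sum_nonneg fun a _ =>
      le_min (mul_nonneg hr (πb.nonneg s a)) (π.nonneg s a)
    rw [mulVec_diagonal, weightedMatrix_truncRatio_mulVec_one M hcov, norm_mul,
      Real.norm_of_nonneg h0]
    exact (mul_le_of_le_one_left (norm_nonneg _) (truncMass_le_one _ _ _ _)).trans
      (norm_le_pi_norm _ s)
  rw [norm_smul, Real.norm_of_nonneg M.γ_pos.le]
  have h3 : M.γ * ‖M.weightedMatrix πb (truncRatio πb π rhobar) *ᵥ (V - V')‖ ≤ ‖V - V'‖ :=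
    (mul_le_of_le_one_left (norm_nonneg _) M.γ_lt_one.le).trans h1
  linarith

/-- The weighted matrices are substochastic, so `2 ∑ γ^i` would do; the bound is weakened to share
one constant with the sampled increments. -/
theorem abs_meanIncr_sub_le (hcov : Covers πb π) {n : ℕ} {cbar rhobar : ℝ} (hc : 1 ≤ cbar)
    (hr : 1 ≤ rhobar) (V V' : S → ℝ) (s : S) :
    |M.meanIncr πb π n cbar rhobar V s - M.meanIncr πb π n cbar rhobar V' s| ≤
      2 * rhobar * eta n M.γ cbar * ‖V - V'‖ := by
  rw [meanIncr, meanIncr, ← Finset.sum_sub_distrib, eta_eq_sum, Finset.mul_sum, Finset.sum_mul]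
  refine (Finset.abs_sum_le_sum_abs _ _).trans (Finset.sum_le_sum fun i _ => ?_)
  rw [← mul_sub, ← Pi.sub_apply, ← mulVec_sub, abs_mul, abs_of_nonneg (pow_nonneg M.γ_pos.le i)]
  have h1 := (norm_le_pi_norm _ s).trans
    ((norm_weightedMatrix_pow_mulVec_le M hcov (zero_le_one.trans hc) i _).trans
    (norm_meanTempDiff_sub_le M hcov (zero_le_one.trans hr) V V'))
  rw [Real.norm_eq_abs] at h1
  have h2 : M.γ ^ i ≤ (M.γ * cbar) ^ i :=
    pow_le_pow_left₀ M.γ_pos.le (le_mul_of_one_le_right M.γ_pos.le hc) i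
  calc _ ≤ (M.γ * cbar) ^ i * (2 * ‖V - V'‖) :=
        mul_le_mul h2 h1 (abs_nonneg _) ((pow_nonneg M.γ_pos.le i).trans h2)
    _ ≤ rhobar * ((M.γ * cbar) ^ i * (2 * ‖V - V'‖)) :=
        le_mul_of_one_le_left (mul_nonneg ((pow_nonneg M.γ_pos.le i).trans h2) (by positivity)) hr
    _ = _ := by ring

theorem vtrace_succ (n : ℕ) (cbar rhobar : ℝ) (α : ℕ → ℝ) (V₀ : S → ℝ) (x : ℕ → S) (z : ℕ → A)
    (k : ℕ) : M.vtrace πb π n cbar rhobar α V₀ x z (k + 1) =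
      M.vtrace πb π n cbar rhobar α V₀ x z k + Pi.single (x k) (α k * M.vtraceIncr πb π n cbar
        rhobar (M.vtrace πb π n cbar rhobar α V₀ x z k) x z k) := by
  ext s
  rw [vtrace, Pi.add_apply]
  by_cases h : s = x k
  · subst h; simp [vtraceIncr]
  · simp [h]

end MDP

end MeanUpdate

/-! ### The contraction factor, and conditional expectations along the V-trace chain. -/

section VTraceChain

open Matrix

variable {S A : Type*} [Fintype S] [Fintype A]

namespace MDP

variable (M : MDP S A) {πb π : Policy S A}

theorem weightedMatrix_one (πb : Policy S A) :
    M.weightedMatrix πb (fun _ _ => 1) = M.stateMatrix πb := by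
  ext s s'
  simp [weightedMatrix, stateMatrix]

theorem stateMatrix_mem_rowStochastic [DecidableEq S] (πb : Policy S A) :
    M.stateMatrix πb ∈ rowStochastic ℝ S := by
  rw [mem_rowStochastic_iff_sum]
  refine ⟨fun s s' => Finset.sum_nonneg fun a _ =>
    mul_nonneg (πb.nonneg s a) (M.P_nonneg a s s'), fun s => ?_⟩
  simp only [stateMatrix, of_apply]
  rw [Finset.sum_comm, ← πb.sum_one s]
  exact Finset.sum_congr rfl fun a _ => by rw [← Finset.mul_sum, M.P_sum, mul_one]

theorem one_sub_beta (πb π : Policy S A) (n : ℕ) (cbar rhobar : ℝ)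
    (hC : M.γ * (⨅ s, truncMass πb π cbar s) < 1) :
    1 - M.beta πb π n cbar rhobar = (⨅ s, stationaryDist (M.stateMatrix πb) s) *
      ((1 - M.γ) * (⨅ s, truncMass πb π rhobar s) *
        ∑ i ∈ Finset.range n, (M.γ * ⨅ s, truncMass πb π cbar s) ^ i) := by
  rw [beta, geom_sum_eq hC.ne, ← neg_div_neg_eq, neg_sub]
  ring

theorem iInf_truncMass_mem [Nonempty S] {τ : ℝ} (hτ : 1 ≤ τ) (hcov : Covers πb π) :
    (⨅ s, truncMass πb π τ s) ∈ Set.Ioc (0 : ℝ) 1 := by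
  obtain ⟨s, hs⟩ := exists_eq_ciInf_of_finite (f := fun s => truncMass πb π τ s)
  rw [← hs]
  exact ⟨truncMass_pos πb π hτ hcov s, truncMass_le_one πb π τ s⟩

theorem mul_iInf_truncMass_lt_one [Nonempty S] {τ : ℝ} (hτ : 1 ≤ τ) (hcov : Covers πb π) :
    M.γ * (⨅ s, truncMass πb π τ s) < 1 :=
  (mul_le_of_le_one_right M.γ_pos.le (iInf_truncMass_mem hτ hcov).2).trans_lt M.γ_lt_one

/-- The bound `1/2` comes from the smallest stationary probability, at most `1/|S|`; the other
factor is at most 1 by comparison with `∑ γ^i`. -/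
theorem one_sub_beta_mem [DecidableEq S] (hS : 2 ≤ Fintype.card S) {n : ℕ} (hn : 1 ≤ n)
    {cbar rhobar : ℝ} (hc : 1 ≤ cbar) (hr : 1 ≤ rhobar) (hcov : Covers πb π) {N : ℕ}
    (hN : ∀ i j, 0 < (M.stateMatrix πb ^ N) i j) :
    1 - M.beta πb π n cbar rhobar ∈ Set.Ioc (0 : ℝ) (1 / 2) := by
  have : Nonempty S := Fintype.card_pos_iff.1 (by omega)
  have hP := M.stateMatrix_mem_rowStochastic πb
  have hκ := isStationaryDist_stationaryDist hP hN
  have hC := iInf_truncMass_mem (S := S) hc hcov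
  have hD := iInf_truncMass_mem (S := S) hr hcov
  have hC1 := M.mul_iInf_truncMass_lt_one hc hcov
  rw [one_sub_beta M πb π n cbar rhobar hC1]
  set c := ⨅ s, truncMass πb π cbar s
  set d := ⨅ s, truncMass πb π rhobar s
  have hγ0 := M.γ_pos
  have hγ1 := M.γ_lt_one
  have hc0 : 0 ≤ M.γ * c := mul_nonneg hγ0.le hC.1.le
  have hsum_pos : 0 < ∑ i ∈ Finset.range n, (M.γ * c) ^ i :=
    Finset.sum_pos' (fun i _ => pow_nonneg hc0 i) ⟨0, Finset.mem_range.2 (by omega), by simp⟩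
  have hsum_le : (1 - M.γ) * ∑ i ∈ Finset.range n, (M.γ * c) ^ i ≤ 1 := by
    have h1 : ∑ i ∈ Finset.range n, (M.γ * c) ^ i ≤ ∑ i ∈ Finset.range n, M.γ ^ i :=
      Finset.sum_le_sum fun i _ => pow_le_pow_left₀ hc0 (mul_le_of_le_one_right hγ0.le hC.2) i
    have h2 := mul_neg_geom_sum M.γ n
    have h3 : 0 < M.γ ^ n := pow_pos hγ0 n
    have h4 := mul_le_mul_of_nonneg_left h1 (by linarith : 0 ≤ 1 - M.γ)
    linarith
  obtain ⟨s₀, hs₀⟩ := exists_eq_ciInf_of_finite (f := fun s => stationaryDist (M.stateMatrix πb) s)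
  have hKpos : 0 < ⨅ s, stationaryDist (M.stateMatrix πb) s := by
    rw [← hs₀]; exact stationaryDist_pos hP hN s₀
  have hKle : (⨅ s, stationaryDist (M.stateMatrix πb) s) ≤ 1 / 2 := by
    have h1 : ∑ _s : S, (⨅ s, stationaryDist (M.stateMatrix πb) s) ≤
        ∑ s, stationaryDist (M.stateMatrix πb) s :=
      Finset.sum_le_sum fun s _ => ciInf_le (Set.finite_range _).bddBelow s
    rw [hκ.2.1] at h1
    simp only [Finset.sum_const, Finset.card_univ, nsmul_eq_mul] at h1
    have h2 : (2 : ℝ) ≤ Fintype.card S := by exact_mod_cast hS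
    nlinarith
  have hd_le : (1 - M.γ) * d * ∑ i ∈ Finset.range n, (M.γ * c) ^ i ≤ 1 := by
    calc _ = d * ((1 - M.γ) * ∑ i ∈ Finset.range n, (M.γ * c) ^ i) := by ring
      _ ≤ 1 * 1 := mul_le_mul hD.2 hsum_le (mul_nonneg (by linarith) hsum_pos.le) zero_le_one
      _ = 1 := one_mul 1
  have hd_pos : 0 < (1 - M.γ) * d * ∑ i ∈ Finset.range n, (M.γ * c) ^ i :=
    mul_pos (mul_pos (by linarith) hD.1) hsum_pos
  exact ⟨mul_pos hKpos hd_pos, by nlinarith⟩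

/-- The mean multi-step V-trace update contracts towards the value function of the truncated
policy. -/
theorem norm_sub_value_add_meanIncr_le [DecidableEq S] [MeasurableSpace S]
    [DiscreteMeasurableSpace S] [MeasurableSpace A] [DiscreteMeasurableSpace A]
    (hS : 2 ≤ Fintype.card S) {n : ℕ} (hn : 1 ≤ n) {cbar rhobar : ℝ} (hc : 1 ≤ cbar)
    (hcr : cbar ≤ rhobar) (hcov : Covers πb π) {N : ℕ}
    (hN : ∀ i j, 0 < (M.stateMatrix πb ^ N) i j) (V : S → ℝ) :
    ‖(V - M.value (truncPolicy πb π rhobar (hc.trans hcr) hcov)) + fun s =>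
        stationaryDist (M.stateMatrix πb) s * M.meanIncr πb π n cbar rhobar V s‖ ≤
      M.beta πb π n cbar rhobar *
        ‖V - M.value (truncPolicy πb π rhobar (hc.trans hcr) hcov)‖ := by
  have : Nonempty S := Fintype.card_pos_iff.1 (by omega)
  have hP := M.stateMatrix_mem_rowStochastic πb
  have hκ := isStationaryDist_stationaryDist hP hN
  have hr := hc.trans hcr
  have hC1 := M.mul_iInf_truncMass_lt_one (τ := cbar) hc hcov
  have hβ := M.one_sub_beta_mem hS hn hc hr hcov hN
  have hβeq := M.one_sub_beta πb π n cbar rhobar hC1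
  have hβ' : M.beta πb π n cbar rhobar = 1 - (⨅ s, stationaryDist (M.stateMatrix πb) s) *
      ((1 - M.γ) * (⨅ s, truncMass πb π rhobar s) *
        ∑ i ∈ Finset.range n, (M.γ * ⨅ s, truncMass πb π cbar s) ^ i) := by linarith
  set Vs := M.value (truncPolicy πb π rhobar hr hcov) with hVs
  have hzero : M.meanIncr πb π n cbar rhobar Vs = 0 := by
    ext s
    simp [meanIncr, hVs, M.meanTempDiff_value hr hcov]
  have hlin : M.meanIncr πb π n cbar rhobar V = multistepMatrix M.γ
      (M.weightedMatrix πb (truncRatio πb π cbar))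
        (M.weightedMatrix πb (truncRatio πb π rhobar)) n *ᵥ (V - Vs) := by
    rw [← M.meanIncr_sub hcov, hzero, sub_zero]
  rw [hlin, hβ']
  refine norm_add_mul_multistepMatrix_le M.γ_pos.le M.γ_lt_one.le
    (M.weightedMatrix_truncRatio_nonneg (zero_le_one.trans hc))
    (M.weightedMatrix_truncRatio_mono hcr) (fun s => ?_) (iInf_truncMass_mem hc hcov).1.le
    (iInf_truncMass_mem hr hcov).1.le (Real.iInf_nonneg hκ.1) (fun s => ?_) (fun s => ?_)
    (fun s => ciInf_le (Set.finite_range _).bddBelow s) (fun s => ?_) ?_ _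
  · rw [weightedMatrix_truncRatio_mulVec_one M hcov]
    exact truncMass_le_one _ _ _ _
  · rw [weightedMatrix_truncRatio_mulVec_one M hcov]
    exact ciInf_le (f := fun s => truncMass πb π cbar s) (Set.finite_range _).bddBelow s
  · rw [weightedMatrix_truncRatio_mulVec_one M hcov]
    exact ciInf_le (f := fun s => truncMass πb π rhobar s) (Set.finite_range _).bddBelow s
  · rw [← hκ.2.1]
    exact Finset.single_le_sum (fun s _ => hκ.1 s) (Finset.mem_univ s)
  · rw [← hβ']
    linarith [hβ.2]

theorem vtraceIncr_congr {n : ℕ} {cbar rhobar : ℝ} {V V' : S → ℝ} (hV : V = V') {x x' : ℕ → S}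
    {z z' : ℕ → A} {k : ℕ} (hx : ∀ i ≤ k + n, x i = x' i) (hz : ∀ i < k + n, z i = z' i) :
    M.vtraceIncr πb π n cbar rhobar V x z k = M.vtraceIncr πb π n cbar rhobar V' x' z' k := by
  subst hV
  refine Finset.sum_congr rfl fun i hi => ?_
  have hi' := Finset.mem_range.1 hi
  rw [hx (k + i) (by omega), hz (k + i) (by omega), hx (k + i + 1) (by omega)]
  congr 3
  refine Finset.prod_congr rfl fun j hj => ?_
  have hj' := Finset.mem_range.1 hj
  rw [hx (k + j) (by omega), hz (k + j) (by omega)]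

/-- The shift by `n` is the look-ahead of the update, and the reason why `n` is added to the mixing
time. -/
theorem histDep_vtrace [DecidableEq S] (n : ℕ) (cbar rhobar : ℝ) (α : ℕ → ℝ) (V₀ : S → ℝ)
    (k : ℕ) : HistDep (k + n) fun x z => M.vtrace πb π n cbar rhobar α V₀ x z k := by
  induction k with
  | zero => intro x x' z z' hx hz; rfl
  | succ k ih =>
    intro x x' z z' hx hz
    have h := ih x x' z z' (fun i hi => hx i (by omega)) (fun i hi => hz i (by omega))
    simp only at h
    simp only [M.vtrace_succ]
    rw [hx k (by omega), h, M.vtraceIncr_congr rfl (fun i hi => hx i (by omega))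
      (fun i hi => hz i (by omega))]

end MDP

namespace MDP.IsTrajectory

variable [DecidableEq S] [MeasurableSpace S] [DiscreteMeasurableSpace S] [MeasurableSpace A]
  [DiscreteMeasurableSpace A]
  {M : MDP S A} {πb π : Policy S A} {Ω : Type*} [MeasurableSpace Ω] {μ : Measure Ω}
  [IsProbabilityMeasure μ] {X : ℕ → Ω → S} {Z : ℕ → Ω → A}

theorem integral_mul_vtraceIncr (h : M.IsTrajectory πb μ X Z) (n : ℕ) (cbar rhobar : ℝ) {k : ℕ}
    {W : (ℕ → S) → (ℕ → A) → S → ℝ} (hW : HistDep k W) (D : (S → ℝ) → S → ℝ) :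
    ∫ ω, D (W (fun i => X i ω) (fun i => Z i ω)) (X k ω) *
        M.vtraceIncr πb π n cbar rhobar (W (fun i => X i ω) (fun i => Z i ω))
          (fun i => X i ω) (fun i => Z i ω) k ∂μ =
      ∫ ω, D (W (fun i => X i ω) (fun i => Z i ω)) (X k ω) *
        M.meanIncr πb π n cbar rhobar (W (fun i => X i ω) (fun i => Z i ω)) (X k ω) ∂μ := by
  simp only [vtraceIncr, meanIncr, Finset.mul_sum]
  rw [integral_finsetSum, integral_finsetSum]
  · refine Finset.sum_congr rfl fun i _ => ?_
    -- The factor `D (W) (X k)` is known at time `k`, so it is carried inside `G` and pulled out of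
    -- the matrix product again in `e2`.
    have key := h.integral_prod_mul_transition (truncRatio πb π cbar) k i
      (G := fun x z s a s' => D (W x z) (x k) *
        (truncRatio πb π rhobar s a * M.tempDiff (W x z) s a s')) (by
        intro s a s' x x' z z' hx hz
        simp only
        rw [hW x x' z z' hx hz, hx k le_rfl])
    have e1 : ∀ ω, D (W (fun i => X i ω) (fun i => Z i ω)) (X k ω) *
        (M.γ ^ i * (∏ j ∈ Finset.range i, truncRatio πb π cbar (X (k + j) ω) (Z (k + j) ω)) *
          truncRatio πb π rhobar (X (k + i) ω) (Z (k + i) ω) *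
          M.tempDiff (W (fun i => X i ω) (fun i => Z i ω)) (X (k + i) ω) (Z (k + i) ω)
            (X (k + i + 1) ω)) =
        M.γ ^ i * ((∏ j ∈ Finset.range i, truncRatio πb π cbar (X (k + j) ω) (Z (k + j) ω)) *
          (D (W (fun i => X i ω) (fun i => Z i ω)) (X k ω) *
          (truncRatio πb π rhobar (X (k + i) ω) (Z (k + i) ω) *
          M.tempDiff (W (fun i => X i ω) (fun i => Z i ω)) (X (k + i) ω) (Z (k + i) ω)
            (X (k + i + 1) ω)))) := fun ω => by ring
    have e2 : ∀ ω, D (W (fun i => X i ω) (fun i => Z i ω)) (X k ω) * (M.γ ^ i *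
        (M.weightedMatrix πb (truncRatio πb π cbar) ^ i *ᵥ
          M.meanTempDiff πb π rhobar (W (fun i => X i ω) (fun i => Z i ω))) (X k ω)) =
        M.γ ^ i * (M.weightedMatrix πb (truncRatio πb π cbar) ^ i *ᵥ
          fun s => ∑ a, πb.prob s a * ∑ s', M.P a s s' *
            (D (W (fun i => X i ω) (fun i => Z i ω)) (X k ω) *
            (truncRatio πb π rhobar s a *
              M.tempDiff (W (fun i => X i ω) (fun i => Z i ω)) s a s'))) (X k ω) := by
      intro ω
      have : (fun s => ∑ a, πb.prob s a * ∑ s', M.P a s s' *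
            (D (W (fun i => X i ω) (fun i => Z i ω)) (X k ω) *
            (truncRatio πb π rhobar s a *
              M.tempDiff (W (fun i => X i ω) (fun i => Z i ω)) s a s'))) =
          D (W (fun i => X i ω) (fun i => Z i ω)) (X k ω) •
            M.meanTempDiff πb π rhobar (W (fun i => X i ω) (fun i => Z i ω)) := by
        ext s
        rw [Pi.smul_apply, smul_eq_mul, meanTempDiff, Finset.mul_sum]
        refine Finset.sum_congr rfl fun a _ => ?_
        rw [Finset.mul_sum, Finset.mul_sum, Finset.mul_sum]
        exact Finset.sum_congr rfl fun s' _ => by ring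
      rw [this, mulVec_smul, Pi.smul_apply, smul_eq_mul]
      ring
    simp_rw [e1, e2]
    rw [integral_const_mul, integral_const_mul]
    exact congrArg _ key
  · intro i _
    refine h.integrable (j := k) (φ := fun x z => D (W x z) (x k) * (M.γ ^ i *
      (M.weightedMatrix πb (truncRatio πb π cbar) ^ i *ᵥ
        M.meanTempDiff πb π rhobar (W x z)) (x k))) fun x x' z z' hx hz => ?_
    simp only
    rw [hW x x' z z' hx hz, hx k le_rfl]
  · intro i _
    refine h.integrable (j := k + i + 1) (φ := fun x z => D (W x z) (x k) * (M.γ ^ i *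
      (∏ j ∈ Finset.range i, truncRatio πb π cbar (x (k + j)) (z (k + j))) *
          truncRatio πb π rhobar (x (k + i)) (z (k + i)) *
          M.tempDiff (W x z) (x (k + i)) (z (k + i)) (x (k + i + 1)))) fun x x' z z' hx hz => ?_
    simp only
    rw [hW x x' z z' (fun l hl => hx l (by omega)) (fun l hl => hz l (by omega)),
      hx k (by omega), hx (k + i) (by omega), hz (k + i) (by omega), hx (k + i + 1) le_rfl]
    congr 4
    refine Finset.prod_congr rfl fun j hj => ?_
    have hj' := Finset.mem_range.1 hj
    rw [hx (k + j) (by omega), hz (k + j) (by omega)]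

theorem integral_state_add (h : M.IsTrajectory πb μ X Z) {k : ℕ} (t : ℕ)
    {W : (ℕ → S) → (ℕ → A) → S → ℝ} (hW : HistDep k W) (F : (S → ℝ) → S → ℝ) :
    ∫ ω, F (W (fun i => X i ω) (fun i => Z i ω)) (X (k + t) ω) ∂μ =
      ∫ ω, (M.stateMatrix πb ^ t *ᵥ F (W (fun i => X i ω) (fun i => Z i ω))) (X k ω) ∂μ := by
  have key := h.integral_prod_mul_state (fun _ _ => 1) k t (F := fun x z => F (W x z))
    (fun s x x' z z' hx hz => by simp only; rw [hW x x' z z' hx hz])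
  simpa [MDP.weightedMatrix_one] using key

end MDP.IsTrajectory

end VTraceChain

/-! ### Deterministic one-step drift and the choice of the exponent. -/

section LyapunovDrift

variable {S : Type*} [Fintype S]

theorem one_add_pow_le {a : ℝ} (ha : 0 ≤ a) (l : ℕ) (hla : l * a ≤ 1 / 2) :
    (1 + a) ^ l ≤ 1 + 2 * (l * a) := by
  have hla0 : 0 ≤ l * a := by positivity
  calc (1 + a) ^ l ≤ Real.exp a ^ l := by
        gcongr
        linarith [Real.add_one_le_exp a]
    _ = Real.exp (l * a) := (Real.exp_nat_mul a l).symm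
    _ ≤ 1 / (1 - l * a) := Real.exp_bound_div_one_sub_of_interval hla0 (by linarith)
    _ ≤ 1 + 2 * (l * a) := by
        rw [div_le_iff₀ (by linarith)]
        nlinarith

/-- A discrete Gronwall estimate, stated from the earlier point `x j`. -/
theorem norm_sub_le_of_linear_growth {E : Type*} [SeminormedAddCommGroup E] {x : ℕ → E} {a b : ℝ}
    (ha : 0 ≤ a) (h : ∀ i, ‖x (i + 1) - x i‖ ≤ a * (‖x i‖ + b)) (j l : ℕ) :
    ‖x (j + l) - x j‖ ≤ ((1 + a) ^ l - 1) * (‖x j‖ + b) := by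
  induction l with
  | zero => simp
  | succ l ih =>
    have h1 := h (j + l)
    have h2 : ‖x (j + l)‖ ≤ ‖x (j + l) - x j‖ + ‖x j‖ := by
      simpa using norm_add_le (x (j + l) - x j) (x j)
    have h3 : ‖x (j + (l + 1)) - x j‖ ≤ ‖x (j + l + 1) - x (j + l)‖ + ‖x (j + l) - x j‖ :=
      norm_sub_le_norm_sub_add_norm_sub _ _ _
    have h4 : a * (‖x (j + l)‖ + b) ≤ a * ((1 + a) ^ l * (‖x j‖ + b)) :=
      mul_le_mul_of_nonneg_left (by linarith) ha
    rw [pow_succ]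
    linarith

variable [DecidableEq S]

/-- One step of the Lyapunov drift: `x` is the current error, `y` an earlier one, `g` and `g'` are
the sampled increments at the coordinate `s₀`, and `m` and `m'` the mean increments. -/
theorem powNorm_sq_drift {p : ℕ} (hp : Even p) (h2 : 2 ≤ p) {u β δ L A b α ε : ℝ} (hu : 1 ≤ u)
    (hu2 : u ^ 2 ≤ 2) (hd : (Fintype.card S : ℝ) ≤ u ^ p) (hβ : 0 ≤ β)
    (huβ : δ / 2 ≤ 1 - u * β) (hL : L = u ^ 2 + (p - 1) * u ^ 2 * (1 + u)) (hA : 0 ≤ A)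
    (hb : 0 ≤ b) (hα : 0 ≤ α) (hαε : α * A ≤ ε) {x y m m' : S → ℝ} {s₀ : S} {g g' : ℝ}
    (hc : ‖x + m‖ ≤ β * ‖x‖) (hg : |g| ≤ A * (‖x‖ + b)) (hm : ∀ s, |m s| ≤ A * (‖x‖ + b))
    (hgg : |g - g'| ≤ A * ‖x - y‖) (hmm : ∀ s, |m s - m' s| ≤ A * ‖x - y‖)
    (hxy : ‖x - y‖ ≤ 3 * ε * (‖x‖ + b)) (hy : ‖y‖ ≤ 2 * (‖x‖ + b)) :
    powNorm p (x + Pi.single s₀ (α * g)) ^ 2 ≤ (1 - δ * α) * powNorm p x ^ 2 +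
      α * (ε * A) * (14 * L + 48) * (‖x‖ + b) ^ 2 +
      2 * α * (powDual p y s₀ * g' - ∑ s, powDual p y s * m' s) := by
  set Y := ‖x‖ + b with hY
  have hY0 : 0 ≤ Y := by positivity
  have hu0 : 0 ≤ u := by linarith
  have hpR : (2 : ℝ) ≤ p := by exact_mod_cast h2
  have hL0 : 0 ≤ L := by
    rw [hL]
    have : 0 ≤ ((p : ℝ) - 1) * u ^ 2 * (1 + u) :=
      mul_nonneg (mul_nonneg (by linarith) (sq_nonneg u)) (by linarith)
    positivity
  have hε : 0 ≤ ε := (mul_nonneg hα hA).trans hαε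
  have hLip := sum_abs_powDual_sub_le h2 hu hd x y
  rw [← hL] at hLip
  have hLip' : ∑ s, |powDual p x s - powDual p y s| ≤ L * (3 * ε * Y) :=
    hLip.trans (mul_le_mul_of_nonneg_left hxy hL0)
  have hJy : ∑ s, |powDual p y s| ≤ 4 * Y := by
    calc _ ≤ u * powNorm p y := sum_abs_powDual_le h2 hu0 hd y
      _ ≤ u * (u * ‖y‖) :=
        mul_le_mul_of_nonneg_left (powNorm_le_mul_norm (by omega) hu0 hd y) hu0
      _ = u ^ 2 * ‖y‖ := by ring
      _ ≤ 2 * (2 * Y) := mul_le_mul hu2 hy (norm_nonneg _) zero_le_two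
      _ = 4 * Y := by ring
  have hpair : ∀ (w : S → ℝ) (r : ℝ) (v : S → ℝ) (B C : ℝ), ∑ s, |w s| ≤ B → |r| ≤ C →
      (∀ s, |v s| ≤ C) → 0 ≤ C → w s₀ * r - ∑ s, w s * v s ≤ 2 * (B * C) := by
    intro w r v B C hw hr hv hC
    have h1 : w s₀ * r ≤ B * C := by
      refine (le_abs_self _).trans ?_
      rw [abs_mul]
      exact mul_le_mul ((Finset.single_le_sum (f := fun s => |w s|) (fun _ _ => abs_nonneg _)
        (Finset.mem_univ s₀)).trans hw) hr (abs_nonneg _)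
        ((Finset.sum_nonneg fun _ _ => abs_nonneg _).trans hw)
    have h2 : -∑ s, w s * v s ≤ B * C := by
      refine (neg_le_abs _).trans ((Finset.abs_sum_le_sum_abs _ _).trans ?_)
      calc _ ≤ ∑ s, |w s| * C := Finset.sum_le_sum fun s _ => by
            rw [abs_mul]; exact mul_le_mul_of_nonneg_left (hv s) (abs_nonneg _)
        _ ≤ B * C := by
            rw [← Finset.sum_mul]; exact mul_le_mul_of_nonneg_right hw hC
    linarith
  have hmean := sum_powDual_mul_le_of_contraction hp h2 hu0 hd x m hβ hc
  -- The pairing of the gradient at `x` with the sampled increment splits into its pairing with `m`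
  -- (contraction), the change of gradient from `x` to `y` (`hT2`), the change of increments
  -- (`hT3`), and the noise term at `y`, which is left for the expectation.
  have hT2 := hpair (fun s => powDual p x s - powDual p y s) g m _ _ hLip' hg hm
    (mul_nonneg hA hY0)
  have hT3 := hpair (powDual p y) (g - g') (fun s => m s - m' s) _ _ hJy
    (hgg.trans (mul_le_mul_of_nonneg_left hxy hA))
    (fun s => (hmm s).trans (mul_le_mul_of_nonneg_left hxy hA)) (by positivity)
  have hsmooth := powNorm_add_sq_le hp h2 hu hd x (Pi.single s₀ (α * g))
  rw [← hL] at hsmooth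
  have hs1 : ∑ s, powDual p x s * (Pi.single s₀ (α * g) : S → ℝ) s = α * (powDual p x s₀ * g) := by
    rw [Finset.sum_eq_single s₀]
    · rw [Pi.single_eq_same]; ring
    · intro s _ hs; rw [Pi.single_eq_of_ne hs, mul_zero]
    · intro hs; exact absurd (Finset.mem_univ _) hs
  have hs2 : ‖(Pi.single s₀ (α * g) : S → ℝ)‖ ^ 2 ≤ α * (ε * A) * Y ^ 2 := by
    have h1 : ‖(Pi.single s₀ (α * g) : S → ℝ)‖ ≤ α * A * Y := by
      rw [Pi.norm_single, norm_mul, Real.norm_of_nonneg hα, mul_assoc]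
      exact mul_le_mul_of_nonneg_left hg hα
    calc _ ≤ (α * A * Y) ^ 2 := pow_le_pow_left₀ (norm_nonneg _) h1 2
      _ = (α * A) * (α * A * Y ^ 2) := by ring
      _ ≤ ε * (α * A * Y ^ 2) := mul_le_mul_of_nonneg_right hαε (by positivity)
      _ = _ := by ring
  rw [hs1] at hsmooth
  simp only [sub_mul, mul_sub, Finset.sum_sub_distrib] at hT2 hT3
  have hneg : -(1 - u * β) * powNorm p x ^ 2 ≤ -(δ / 2) * powNorm p x ^ 2 :=
    mul_le_mul_of_nonneg_right (by linarith) (sq_nonneg _)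
  -- Here `6 L = 2 · 3 L` and `24 = 2 · 4 · 3`; doubling and adding the smoothness term `2 L` gives
  -- `14 L + 48`.
  have hmain : powDual p x s₀ * g ≤ -(δ / 2) * powNorm p x ^ 2 + (6 * L + 24) * (ε * A) * Y ^ 2 +
      (powDual p y s₀ * g' - ∑ s, powDual p y s * m' s) := by
    linarith
  have h5 := mul_le_mul_of_nonneg_left hmain (by positivity : 0 ≤ 2 * α)
  have h6 := mul_le_mul_of_nonneg_left hs2 (by positivity : 0 ≤ 2 * L)
  linarith

/-- Admissible exponents for the Lyapunov function. -/
theorem exists_exponent {d δ : ℝ} (hd : 2 ≤ d) (hδ : 0 < δ) (hδ2 : δ ≤ 1 / 2) :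
    ∃ (p : ℕ) (u : ℝ), Even p ∧ 2 ≤ p ∧ 1 ≤ u ∧ u ^ 2 ≤ 2 ∧ d ≤ u ^ p ∧
      δ / 2 ≤ 1 - u * (1 - δ) ∧
      u ^ 2 + (p - 1) * u ^ 2 * (1 + u) ≤ 13 * (Real.log d / δ) := by
  have hd0 : 0 < d := by linarith
  have hlog : 0.69 ≤ Real.log d := by
    have h1 := Real.log_two_gt_d9
    have h2 := Real.log_le_log (by norm_num) hd
    linarith
  set q := Real.log d / δ with hq
  have hq1 : 1.38 ≤ q := by
    rw [hq, le_div_iff₀ hδ]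
    linarith
  have hpos : 0 < 1 - δ / 2 := by linarith
  have hu43 : 1 / (1 - δ / 2) ≤ 4 / 3 := by
    rw [div_le_iff₀ hpos]; linarith
  have hu1 : 1 ≤ 1 / (1 - δ / 2) := by
    rw [le_div_iff₀ hpos]; linarith
  set u := 1 / (1 - δ / 2) with hu
  have hmq : q ≤ (⌈q⌉₊ : ℝ) := Nat.le_ceil q
  have hmq' : (⌈q⌉₊ : ℝ) < q + 1 := Nat.ceil_lt_add_one (by linarith)
  have hm1 : 1 ≤ ⌈q⌉₊ := Nat.one_le_ceil_iff.2 (by linarith)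
  -- With `u = 1 / (1 - δ/2)` one has `log u ≥ δ/2`, so `p ≥ 2 log d / δ` gives `u^p ≥ d`, and `u (1
  -- - δ) = 1 - u δ/2 ≤ 1 - δ/2`. The constant 13 uses `u ≤ 4/3` and `q ≥ 1.38`.
  refine ⟨2 * ⌈q⌉₊, u, even_two_mul _, by omega, hu1, by nlinarith, ?_, ?_, ?_⟩
  · rw [← Real.log_le_log_iff hd0 (by positivity), Real.log_pow]
    have h1 : δ / 2 ≤ Real.log u := by
      rw [hu, one_div, Real.log_inv]
      linarith [Real.log_le_sub_one_of_pos hpos]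
    have h2 : Real.log d = 2 * q * (δ / 2) := by
      rw [hq]; field_simp
    rw [h2]
    push_cast
    exact mul_le_mul (by linarith) h1 (by linarith) (by positivity)
  · have h1 : u * (1 - δ / 2) = 1 := one_div_mul_cancel hpos.ne'
    nlinarith
  · push_cast
    have hp1 : 0 ≤ 2 * (⌈q⌉₊ : ℝ) - 1 := by
      have : (1 : ℝ) ≤ (⌈q⌉₊ : ℝ) := by exact_mod_cast hm1
      linarith
    have husq : u ^ 2 ≤ 16 / 9 := by nlinarith
    calc u ^ 2 + (2 * (⌈q⌉₊ : ℝ) - 1) * u ^ 2 * (1 + u)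
        ≤ 16 / 9 + (2 * (⌈q⌉₊ : ℝ) - 1) * (16 / 9) * (1 + 4 / 3) := by gcongr
      _ ≤ 13 * q := by linarith

/-- The constant `w / r` is the fixed point of `e ↦ (1 - r) e + w`. -/
theorem le_geom_of_step_le {e : ℕ → ℝ} {r w : ℝ} (hr : 0 < r) (hr1 : r ≤ 1) (hw : 0 ≤ w) {m : ℕ}
    (h : ∀ k, m ≤ k → e (k + 1) ≤ (1 - r) * e k + w) {k : ℕ} (hk : m ≤ k) :
    e k ≤ e m * (1 - r) ^ (k - m) + w / r := by
  induction k, hk using Nat.le_induction with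
  | base => simp; positivity
  | succ k hk ih =>
    have h1 := mul_le_mul_of_nonneg_left ih (by linarith : 0 ≤ 1 - r)
    have h2 := h k hk
    have h3 : (1 - r) * (w / r) + w = w / r := by field_simp; ring
    rw [show k + 1 - m = (k - m) + 1 by omega, pow_succ]
    linarith

end LyapunovDrift

/-! ### The bias of the Markovian noise after mixing. -/

section BiasBound

open Matrix

theorem sum_mul_sub_sum_mul_le_of_tvDist_le {S : Type*} [Fintype S] {q κ : S → ℝ} {α : ℝ} (h : tvDist q κ ≤ α)
    {F : S → ℝ} {B : ℝ} (hF : ∀ s, |F s| ≤ B) (hB : 0 ≤ B) :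
    ∑ s, q s * F s - ∑ s, κ s * F s ≤ 2 * α * B := by
  rw [← Finset.sum_sub_distrib]
  rw [tvDist] at h
  calc _ ≤ ∑ s, |q s - κ s| * B := Finset.sum_le_sum fun s _ => by
        rw [← sub_mul]
        refine (le_abs_self _).trans ?_
        rw [abs_mul]
        exact mul_le_mul_of_nonneg_left (hF s) (abs_nonneg _)
    _ ≤ _ := by
        rw [← Finset.sum_mul]
        exact mul_le_mul_of_nonneg_right (by linarith) hB

variable {S A : Type*} [Fintype S] [Fintype A] [DecidableEq S] [MeasurableSpace S]
  [DiscreteMeasurableSpace S] [MeasurableSpace A] [DiscreteMeasurableSpace A]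
  {M : MDP S A} {πb π : Policy S A} {Ω : Type*} [MeasurableSpace Ω] {μ : Measure Ω}
  [IsProbabilityMeasure μ] {X : ℕ → Ω → S} {Z : ℕ → Ω → A}

/-- The Markovian noise is nearly centered once the state chain has mixed. -/
theorem MDP.IsTrajectory.integral_bias_le (h : M.IsTrajectory πb μ X Z) (n : ℕ)
    (cbar rhobar : ℝ) {k t : ℕ} {κ : S → ℝ} {α : ℝ}
    (hmix : ∀ s, tvDist ((M.stateMatrix πb ^ t) s) κ ≤ α)
    {W : (ℕ → S) → (ℕ → A) → S → ℝ} (hW : HistDep k W) (D : (S → ℝ) → S → ℝ) (B : (S → ℝ) → ℝ)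
    (hB : ∀ V s, |D V s * M.meanIncr πb π n cbar rhobar V s| ≤ B V) :
    ∫ ω, (D (W (fun i => X i ω) (fun i => Z i ω)) (X (k + t) ω) *
        M.vtraceIncr πb π n cbar rhobar (W (fun i => X i ω) (fun i => Z i ω))
          (fun i => X i ω) (fun i => Z i ω) (k + t) -
      ∑ s, D (W (fun i => X i ω) (fun i => Z i ω)) s *
        (κ s * M.meanIncr πb π n cbar rhobar (W (fun i => X i ω) (fun i => Z i ω)) s)) ∂μ ≤
    ∫ ω, 2 * α * B (W (fun i => X i ω) (fun i => Z i ω)) ∂μ := by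
  have hWdep : ∀ (T : (S → ℝ) → ℝ), HistDep k fun x z => T (W x z) := fun T x x' z z' hx hz => by
    simp only; rw [hW x x' z z' hx hz]
  have hint1 := h.integrable (j := k + t + n) (φ := fun x z => D (W x z) (x (k + t)) *
    M.vtraceIncr πb π n cbar rhobar (W x z) x z (k + t)) (by
      intro x x' z z' hx hz
      have hWe : W x z = W x' z' :=
        hW x x' z z' (fun i hi => hx i (by omega)) (fun i hi => hz i (by omega))
      simp only
      rw [hWe, hx (k + t) (by omega), M.vtraceIncr_congr rfl hx hz])
  have hint2 := h.integrable (hWdep fun V => ∑ s, D V s *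
    (κ s * M.meanIncr πb π n cbar rhobar V s))
  have hint3 := h.integrable (j := k) (φ := fun x z => (M.stateMatrix πb ^ t *ᵥ
    fun s => D (W x z) s * M.meanIncr πb π n cbar rhobar (W x z) s) (x k)) (by
      intro x x' z z' hx hz
      simp only
      rw [hW x x' z z' hx hz, hx k le_rfl])
  -- Two averagings: the look-ahead after time `k + t` turns the sampled increment into its mean,
  -- then the `t` steps from `k` turn the state into row `X k` of `P^t`, which is close to `κ`.
  rw [integral_sub hint1 hint2, h.integral_mul_vtraceIncr n cbar rhobar
    (hW.mono (Nat.le_add_right k t)) D,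
    h.integral_state_add t hW fun V s => D V s * M.meanIncr πb π n cbar rhobar V s,
    ← integral_sub hint3 hint2]
  refine integral_mono (hint3.sub hint2) (h.integrable (hWdep fun V => 2 * α * B V)) fun ω => ?_
  generalize W (fun i => X i ω) (fun i => Z i ω) = V
  have hB0 : 0 ≤ B V := (abs_nonneg _).trans (hB V (X k ω))
  have := sum_mul_sub_sum_mul_le_of_tvDist_le (hmix (X k ω))
    (F := fun s => D V s * M.meanIncr πb π n cbar rhobar V s) (hB V) hB0
  refine le_trans (le_of_eq ?_) this
  simp only [mulVec, dotProduct]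
  congr 1
  exact Finset.sum_congr rfl fun s _ => by ring

end BiasBound

/-! ### Expected one-step drift of the V-trace error. -/

section VTraceDrift

open Matrix

variable {S A : Type*} [Fintype S] [DecidableEq S] [Fintype A]

theorem MDP.norm_vtrace_succ_sub_le (M : MDP S A) (πb π : Policy S A) {n : ℕ} {cbar rhobar : ℝ}
    (hc : 0 ≤ cbar) (hr : 0 ≤ rhobar) {α : ℝ} (hα : 0 ≤ α) (V₀ : S → ℝ) (x : ℕ → S) (z : ℕ → A)
    (k : ℕ) :
    ‖M.vtrace πb π n cbar rhobar (fun _ => α) V₀ x z (k + 1) -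
        M.vtrace πb π n cbar rhobar (fun _ => α) V₀ x z k‖ ≤
      α * (2 * rhobar * eta n M.γ cbar) *
        (‖M.vtrace πb π n cbar rhobar (fun _ => α) V₀ x z k‖ + 1) := by
  rw [M.vtrace_succ, add_sub_cancel_left, Pi.norm_single, norm_mul, Real.norm_of_nonneg hα,
    mul_assoc]
  exact mul_le_mul_of_nonneg_left (M.abs_vtraceIncr_le hc hr _ _ _ _) hα

theorem one_le_eta {n : ℕ} (hn : 1 ≤ n) {γ c : ℝ} (hγ : 0 ≤ γ) (hc : 0 ≤ c) :
    1 ≤ eta n γ c := by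
  rw [eta_eq_sum]
  calc (1 : ℝ) = (γ * c) ^ 0 := (pow_zero _).symm
    _ ≤ _ := Finset.single_le_sum (f := fun i => (γ * c) ^ i)
      (fun i _ => pow_nonneg (mul_nonneg hγ hc) i) (Finset.mem_range.2 hn)

variable [MeasurableSpace S] [DiscreteMeasurableSpace S] [MeasurableSpace A]
  [DiscreteMeasurableSpace A]
  {M : MDP S A} {πb π : Policy S A} {Ω : Type*} [MeasurableSpace Ω] {μ : Measure Ω}
  [IsProbabilityMeasure μ] {X : ℕ → Ω → S} {Z : ℕ → Ω → A}

set_option maxHeartbeats 1000000 in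
/-- Expected drift of the squared `ℓ^p` error of the V-trace iterates. -/
theorem MDP.IsTrajectory.integral_powNorm_sq_succ_le (h : M.IsTrajectory πb μ X Z)
    (hS : 2 ≤ Fintype.card S) {n : ℕ} (hn : 1 ≤ n) {cbar rhobar : ℝ} (hc : 1 ≤ cbar)
    (hcr : cbar ≤ rhobar) (hcov : Covers πb π) {N : ℕ}
    (hN : ∀ i j, 0 < (M.stateMatrix πb ^ N) i j) (V₀ : S → ℝ) {α : ℝ} (hα : 0 < α)
    {p : ℕ} (hp : Even p) (h2 : 2 ≤ p) {u δ L a ε : ℝ} (hu : 1 ≤ u) (hu2 : u ^ 2 ≤ 2)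
    (hd : (Fintype.card S : ℝ) ≤ u ^ p) (hδ : δ = 1 - M.beta πb π n cbar rhobar)
    (huβ : δ / 2 ≤ 1 - u * (1 - δ)) (hL : L = u ^ 2 + (p - 1) * u ^ 2 * (1 + u))
    (ha : a = 2 * rhobar * eta n M.γ cbar)
    (hε : ε = α * a * ((mixingTime (M.stateMatrix πb) α + n : ℕ) : ℝ)) (hε6 : ε ≤ 1 / 6)
    (hsmall : 68 * L * (ε * a) ≤ δ / 2) {k : ℕ}
    (hk : mixingTime (M.stateMatrix πb) α + n ≤ k) :
    ∫ ω, powNorm p (M.vtrace πb π n cbar rhobar (fun _ => α) V₀ (fun i => X i ω)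
        (fun i => Z i ω) (k + 1) - M.value (truncPolicy πb π rhobar (hc.trans hcr) hcov)) ^ 2 ∂μ ≤
      (1 - δ / 2 * α) * ∫ ω, powNorm p (M.vtrace πb π n cbar rhobar (fun _ => α) V₀
        (fun i => X i ω) (fun i => Z i ω) k -
          M.value (truncPolicy πb π rhobar (hc.trans hcr) hcov)) ^ 2 ∂μ +
      68 * L * (ε * a) * (‖M.value (truncPolicy πb π rhobar (hc.trans hcr) hcov)‖ + 1) ^ 2 * α := by
  have : Nonempty S := Fintype.card_pos_iff.1 (by omega)
  have hP := M.stateMatrix_mem_rowStochastic πb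
  have hκ := isStationaryDist_stationaryDist hP hN
  have hr := hc.trans hcr
  have hβ := M.one_sub_beta_mem hS hn hc hr hcov hN
  have hmix := tvDist_pow_mixingTime_le hP hN hα
  have hcontr := M.norm_sub_value_add_meanIncr_le hS hn hc hcr hcov hN
  rw [← hδ] at hβ
  have hβeq : M.beta πb π n cbar rhobar = 1 - δ := by rw [hδ]; ring
  rw [hβeq] at hcontr
  set t := mixingTime (M.stateMatrix πb) α with ht
  set κ := stationaryDist (M.stateMatrix πb) with hκdef
  have hzero : M.meanTempDiff πb π rhobar (M.value (truncPolicy πb π rhobar hr hcov)) = 0 :=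
    M.meanTempDiff_value hr hcov
  generalize M.value (truncPolicy πb π rhobar hr hcov) = Vs at *
  have hη := one_le_eta hn M.γ_pos.le (zero_le_one.trans hc)
  have ha2 : 2 ≤ a := by rw [ha]; nlinarith
  have ha0 : 0 ≤ a := by linarith
  have hτ1 : (1 : ℝ) ≤ ((t + n : ℕ) : ℝ) := by exact_mod_cast (by omega : 1 ≤ t + n)
  have hαε : α * a ≤ ε := by
    rw [hε]; exact le_mul_of_one_le_right (by positivity) hτ1
  have hε0 : 0 ≤ ε := (by positivity : 0 ≤ α * a).trans hαε
  have hα2 : 2 * α ≤ ε := by nlinarith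
  have hu0 : 0 ≤ u := by linarith
  have hp0 : p ≠ 0 := by omega
  have hL3 : 3 ≤ L := by
    have hpR : (2 : ℝ) ≤ p := by exact_mod_cast h2
    have hu1 : 1 ≤ u ^ 2 := one_le_pow₀ hu
    have hpu : 1 ≤ ((p : ℝ) - 1) * u ^ 2 := by nlinarith
    have h3 : 1 * 2 ≤ ((p : ℝ) - 1) * u ^ 2 * (1 + u) :=
      mul_le_mul hpu (by linarith) zero_le_two (by linarith)
    rw [hL]; linarith
  set b := ‖Vs‖ + 1 with hb
  have hb0 : 0 ≤ b := by positivity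
  have hincr : ∀ V s, |M.meanIncr πb π n cbar rhobar V s| ≤ a * ‖V - Vs‖ := by
    intro V s
    have h1 := M.abs_meanIncr_sub_le (n := n) hcov hc hr V Vs s
    have h2 : M.meanIncr πb π n cbar rhobar Vs s = 0 := by simp [MDP.meanIncr, hzero]
    rwa [h2, sub_zero, ← ha] at h1
  have hκ1 : ∀ s, κ s ≤ 1 := fun s => by
    rw [← hκ.2.1]
    exact Finset.single_le_sum (fun s _ => hκ.1 s) (Finset.mem_univ s)
  set Vf : ℕ → (ℕ → S) → (ℕ → A) → S → ℝ :=
    fun k x z => M.vtrace πb π n cbar rhobar (fun _ => α) V₀ x z k with hVf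
  have hdep : ∀ k, HistDep (k + n) (Vf k) := fun k => M.histDep_vtrace n cbar rhobar _ V₀ k
  have hdepT : ∀ k (T : (S → ℝ) → ℝ), HistDep (k + n) fun x z => T (Vf k x z) :=
    fun k T x x' z z' hx hz => congrArg T (hdep k x x' z z' hx hz)
  have hstep : ∀ k x z, Vf (k + 1) x z = Vf k x z + Pi.single (x k)
      (α * M.vtraceIncr πb π n cbar rhobar (Vf k x z) x z k) := fun k x z => M.vtrace_succ ..
  have hlip : ∀ k x z, ‖(Vf (k + 1) x z - Vs) - (Vf k x z - Vs)‖ ≤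
      α * a * (‖Vf k x z - Vs‖ + b) := by
    intro k x z
    rw [sub_sub_sub_cancel_right, ha]
    refine (M.norm_vtrace_succ_sub_le πb π (zero_le_one.trans hc) (zero_le_one.trans hr) hα.le
      V₀ x z k).trans (mul_le_mul_of_nonneg_left ?_ (by rw [← ha]; positivity))
    have := norm_add_le (Vf k x z - Vs) Vs
    rw [sub_add_cancel] at this
    simp only [hb, hVf] at *
    linarith
  obtain ⟨j, rfl⟩ : ∃ j, k = j + (t + n) := ⟨k - (t + n), by omega⟩
  set k := j + (t + n) with hkdef
  have hpow : (1 + α * a) ^ (t + n) ≤ 1 + 2 * ε := by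
    have := one_add_pow_le (a := α * a) (by positivity) (t + n) (by rw [mul_comm, ← hε]; linarith)
    rwa [mul_comm (((t + n : ℕ) : ℝ)), ← hε] at this
  -- Growth over `t + n` steps is at most `2 ε ≤ 1/3` relative to time `j`; re-expressing it
  -- relative to time `k` costs the factor `3/2`.
  have hclose : ∀ x z, ‖Vf k x z - Vf j x z‖ ≤ 3 * ε * (‖Vf k x z - Vs‖ + b) ∧
      ‖Vf j x z - Vs‖ ≤ 2 * (‖Vf k x z - Vs‖ + b) := by
    intro x z
    have h1 := norm_sub_le_of_linear_growth (x := fun k => Vf k x z - Vs) (a := α * a) (b := b)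
      (by positivity) (fun i => hlip i x z) j (t + n)
    simp only [sub_sub_sub_cancel_right] at h1
    have h2 : ‖Vf k x z - Vf j x z‖ ≤ 2 * ε * (‖Vf j x z - Vs‖ + b) :=
      h1.trans (mul_le_mul_of_nonneg_right (by linarith) (by positivity))
    have h3 : ‖Vf j x z - Vs‖ ≤ ‖Vf k x z - Vs‖ + ‖Vf k x z - Vf j x z‖ := by
      have := norm_sub_le (Vf k x z - Vs) (Vf k x z - Vf j x z)
      rwa [sub_sub_sub_cancel_left] at this
    have hw0 : 0 ≤ ‖Vf j x z - Vs‖ + b := by positivity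
    have h4 : 2 * ε * (‖Vf j x z - Vs‖ + b) ≤ 1 / 3 * (‖Vf j x z - Vs‖ + b) :=
      mul_le_mul_of_nonneg_right (by linarith) hw0
    have h5 : ‖Vf j x z - Vs‖ + b ≤ 3 / 2 * (‖Vf k x z - Vs‖ + b) := by linarith
    refine ⟨h2.trans ?_, by linarith [norm_nonneg (Vf k x z - Vs)]⟩
    calc _ ≤ 2 * ε * (3 / 2 * (‖Vf k x z - Vs‖ + b)) :=
          mul_le_mul_of_nonneg_left h5 (by positivity)
      _ = _ := by ring
  set bias : (ℕ → S) → (ℕ → A) → ℝ := fun x z =>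
    powDual p (Vf j x z - Vs) (x k) *
      M.vtraceIncr πb π n cbar rhobar (Vf j x z) x z k -
      ∑ s, powDual p (Vf j x z - Vs) s *
        (κ s * M.meanIncr πb π n cbar rhobar (Vf j x z) s) with hbias
  have hpt : ∀ x z, powNorm p (Vf (k + 1) x z - Vs) ^ 2 ≤
      (1 - δ * α) * powNorm p (Vf k x z - Vs) ^ 2 +
      α * (ε * a) * (14 * L + 48) * (‖Vf k x z - Vs‖ + b) ^ 2 + 2 * α * bias x z := by
    intro x z
    have hmul : ∀ s (r : ℝ), |κ s * r| ≤ |r| := fun s r => by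
      rw [abs_mul, abs_of_nonneg (hκ.1 s)]
      exact mul_le_of_le_one_left (abs_nonneg _) (hκ1 s)
    have key := powNorm_sq_drift hp h2 (u := u) (β := 1 - δ) (δ := δ) (L := L) (A := a) (b := b)
      (α := α) (ε := ε) hu hu2 hd (by linarith [hβ.2]) huβ hL ha0 hb0 hα.le hαε
      (x := Vf k x z - Vs) (y := Vf j x z - Vs)
      (m := fun s => κ s * M.meanIncr πb π n cbar rhobar (Vf k x z) s)
      (m' := fun s => κ s * M.meanIncr πb π n cbar rhobar (Vf j x z) s) (s₀ := x k)
      (g := M.vtraceIncr πb π n cbar rhobar (Vf k x z) x z k)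
      (g' := M.vtraceIncr πb π n cbar rhobar (Vf j x z) x z k)
      (hcontr _) ?_ ?_ ?_ ?_ ?_ (hclose x z).2
    · have e : Vf (k + 1) x z - Vs = Vf k x z - Vs + Pi.single (x k)
          (α * M.vtraceIncr πb π n cbar rhobar (Vf k x z) x z k) := by
        rw [hstep]; abel
      rw [e]
      exact key
    · have h1 := M.abs_vtraceIncr_le (πb := πb) (π := π) (n := n) (zero_le_one.trans hc)
        (zero_le_one.trans hr) (Vf k x z) x z k
      rw [← ha] at h1
      refine h1.trans (mul_le_mul_of_nonneg_left ?_ ha0)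
      have := norm_add_le (Vf k x z - Vs) Vs
      rw [sub_add_cancel] at this
      linarith
    · intro s
      refine (hmul s _).trans ((hincr _ s).trans (mul_le_mul_of_nonneg_left (by linarith) ha0))
    · rw [sub_sub_sub_cancel_right, ha]
      exact M.abs_vtraceIncr_sub_le (zero_le_one.trans hc) (zero_le_one.trans hr) _ _ _ _ _
    · intro s
      rw [sub_sub_sub_cancel_right, ← mul_sub, ha]
      exact (hmul s _).trans (M.abs_meanIncr_sub_le hcov hc hr _ _ s)
    · rw [sub_sub_sub_cancel_right]
      exact (hclose x z).1
  have hbias_dep : HistDep (k + n) bias := by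
    intro x x' z z' hx hz
    have hWe : Vf j x z = Vf j x' z' :=
      hdep j x x' z z' (fun i hi => hx i (by omega)) (fun i hi => hz i (by omega))
    simp only [hbias]
    rw [hWe, hx k (by omega), M.vtraceIncr_congr rfl hx hz]
  have hbias_le : ∫ ω, bias (fun i => X i ω) (fun i => Z i ω) ∂μ ≤
      ∫ ω, 6 * (ε * a) * (‖Vf k (fun i => X i ω) (fun i => Z i ω) - Vs‖ + b) ^ 2 ∂μ := by
    -- The frozen iterate is known at time `j + n`, leaving exactly `t` steps to mix.
    have hkt : j + n + t = k := by omega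
    have h1 := h.integral_bias_le (π := π) n cbar rhobar (k := j + n) (t := t) (κ := κ) (α := α)
      hmix (hdep j) (fun V => powDual p (V - Vs)) (fun V => u * a * ‖V - Vs‖ ^ 2) (by
        intro V s
        rw [abs_mul]
        calc _ ≤ (u * ‖V - Vs‖) * (a * ‖V - Vs‖) :=
              mul_le_mul ((abs_powDual_le h2 _ s).trans (powNorm_le_mul_norm hp0 hu0 hd _))
                (hincr V s) (abs_nonneg _) (by positivity)
          _ = _ := by ring)
    rw [hkt] at h1
    refine h1.trans (integral_mono
      (h.integrable (hdepT j fun V => 2 * α * (u * a * ‖V - Vs‖ ^ 2)))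
      (h.integrable (hdepT k fun V => 6 * (ε * a) * (‖V - Vs‖ + b) ^ 2)) fun ω => ?_)
    simp only
    have hw : ‖Vf j (fun i => X i ω) (fun i => Z i ω) - Vs‖ ^ 2 ≤
        (2 * (‖Vf k (fun i => X i ω) (fun i => Z i ω) - Vs‖ + b)) ^ 2 :=
      pow_le_pow_left₀ (norm_nonneg _) (hclose (fun i => X i ω) (fun i => Z i ω)).2 2
    have hu32 : u ≤ 3 / 2 := by nlinarith
    -- The mixing error `2 α` is itself at most `ε`, because `a ≥ 2` and `t + n ≥ 1`.
    calc _ ≤ 2 * α * (3 / 2 * a *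
          (2 * (‖Vf k (fun i => X i ω) (fun i => Z i ω) - Vs‖ + b)) ^ 2) := by gcongr
      _ = 6 * (2 * α * a) * (‖Vf k (fun i => X i ω) (fun i => Z i ω) - Vs‖ + b) ^ 2 := by ring
      _ ≤ _ := by gcongr
  have hint : ∀ k (T : (S → ℝ) → ℝ),
      Integrable (fun ω => T (Vf k (fun i => X i ω) (fun i => Z i ω))) μ :=
    fun k T => h.integrable (hdepT k T)
  have hI1 := hint k fun V => (1 - δ * α) * powNorm p (V - Vs) ^ 2
  have hI2 := hint k fun V => α * (ε * a) * (14 * L + 48) * (‖V - Vs‖ + b) ^ 2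
  have hI3 := (h.integrable hbias_dep).const_mul (2 * α)
  have hmono := integral_mono (hint (k + 1) fun V => powNorm p (V - Vs) ^ 2)
    ((hI1.add hI2).add hI3) fun ω => hpt (fun i => X i ω) (fun i => Z i ω)
  have hsum1 := integral_add (hI1.add hI2) hI3
  have hsum2 := integral_add hI1 hI2
  simp only [Pi.add_apply] at hmono hsum1
  rw [hsum1, hsum2, integral_const_mul, integral_const_mul,
    integral_const_mul] at hmono
  rw [integral_const_mul] at hbias_le
  have hY : ∫ ω, (‖Vf k (fun i => X i ω) (fun i => Z i ω) - Vs‖ + b) ^ 2 ∂μ ≤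
      2 * ∫ ω, powNorm p (Vf k (fun i => X i ω) (fun i => Z i ω) - Vs) ^ 2 ∂μ + 2 * b ^ 2 := by
    have h1 := integral_mono (hint k fun V => (‖V - Vs‖ + b) ^ 2)
      (hint k fun V => 2 * powNorm p (V - Vs) ^ 2 + 2 * b ^ 2) fun ω => by
        have h2 := norm_le_powNorm hp0 (Vf k (fun i => X i ω) (fun i => Z i ω) - Vs)
        have h3 := pow_le_pow_left₀ (norm_nonneg _) h2 2
        simp only
        nlinarith [sq_nonneg (‖Vf k (fun i => X i ω) (fun i => Z i ω) - Vs‖ - b)]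
    refine h1.trans_eq ?_
    rw [integral_add ((hint k fun V => powNorm p (V - Vs) ^ 2).const_mul 2) (integrable_const _),
      integral_const_mul]
    simp
  have hE0 : 0 ≤ ∫ ω, powNorm p (Vf k (fun i => X i ω) (fun i => Z i ω) - Vs) ^ 2 ∂μ :=
    integral_nonneg fun ω => sq_nonneg _
  have hY0 : 0 ≤ ∫ ω, (‖Vf k (fun i => X i ω) (fun i => Z i ω) - Vs‖ + b) ^ 2 ∂μ :=
    integral_nonneg fun ω => sq_nonneg _
  simp only [hVf] at hmono hbias_le hY hE0 hY0 ⊢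
  set E := ∫ ω, powNorm p (M.vtrace πb π n cbar rhobar (fun _ => α) V₀ (fun i => X i ω)
    (fun i => Z i ω) k - Vs) ^ 2 ∂μ
  set Y := ∫ ω, (‖M.vtrace πb π n cbar rhobar (fun _ => α) V₀ (fun i => X i ω)
    (fun i => Z i ω) k - Vs‖ + b) ^ 2 ∂μ
  set B := ∫ ω, bias (fun i => X i ω) (fun i => Z i ω) ∂μ
  have hεa : 0 ≤ ε * a := mul_nonneg hε0 ha0
  have e1 : 2 * α * B ≤ 2 * α * (6 * (ε * a) * Y) :=
    mul_le_mul_of_nonneg_left hbias_le (by positivity)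
  -- `60 = 48 + 2 · 6` collects the drift and bias constants, and `L ≥ 3` absorbs it into `20 L`;
  -- the factor 2 in `hY` then gives 68.
  have e2 : α * (ε * a) * (14 * L + 60) * Y ≤ α * (ε * a) * (34 * L) * Y :=
    mul_le_mul_of_nonneg_right (mul_le_mul_of_nonneg_left (by linarith) (by positivity)) hY0
  have e3 : α * (ε * a) * (34 * L) * Y ≤ α * (ε * a) * (34 * L) * (2 * E + 2 * b ^ 2) :=
    mul_le_mul_of_nonneg_left hY (by positivity)
  have e4 : α * (68 * L * (ε * a)) * E ≤ α * (δ / 2) * E :=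
    mul_le_mul_of_nonneg_right (mul_le_mul_of_nonneg_left hsmall hα.le) hE0
  linarith

end VTraceDrift

/-! ### Stepsize constants and the final recursion. -/

section FiniteSampleBound

theorem stepsize_condition_consequences {rhobar η ℓ δ α τ L a ε : ℝ} (hr : 1 ≤ rhobar)
    (hη : 1 ≤ η) (hℓ : 0.69 ≤ ℓ) (hδ : δ ∈ Set.Ioc (0 : ℝ) (1 / 2)) (hα : 0 < α) (hτ : 1 ≤ τ)
    (hL : L ≤ 13 * (ℓ / δ)) (ha : a = 2 * rhobar * η) (hε : ε = α * a * τ)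
    (hcond : α * τ ≤ 1 / 10000 * (δ ^ 2 / ((rhobar + 1) ^ 2 * η ^ 2 * ℓ))) (b : ℝ) :
    ε ≤ 1 / 6 ∧ 68 * L * (ε * a) ≤ δ / 2 ∧ δ / 2 * α ≤ 1 ∧
      68 * L * (ε * a) * b ^ 2 * α / (δ / 2 * α) ≤
        3648 * Real.exp 1 * b ^ 2 * (ℓ * (rhobar + 1) ^ 2 * η ^ 2 / δ ^ 2) * (α * τ) := by
  obtain ⟨hδ0, hδ2⟩ := hδ
  have ha2 : 2 ≤ a := by rw [ha]; nlinarith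
  have ha0 : 0 ≤ a := by linarith
  have hε0 : 0 ≤ ε := by rw [hε]; positivity
  have hεa0 : 0 ≤ ε * a := mul_nonneg hε0 ha0
  have hasq : a ^ 2 ≤ 4 * ((rhobar + 1) ^ 2 * η ^ 2) := by
    have : rhobar ^ 2 ≤ (rhobar + 1) ^ 2 := pow_le_pow_left₀ (by linarith) (by linarith) 2
    calc a ^ 2 = 4 * (rhobar ^ 2 * η ^ 2) := by rw [ha]; ring
      _ ≤ _ := by gcongr
  -- All smallness requirements follow from this; the tightest is `68 · 13 · 4 / 10000 ≤ 1/2`, which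
  -- lets the noise consume only half of the drift.
  have hcond' : ε * a * ℓ ≤ 4 / 10000 * δ ^ 2 := by
    have hpos : 0 < (rhobar + 1) ^ 2 * η ^ 2 * ℓ := by positivity
    rw [mul_div_assoc', le_div_iff₀ hpos] at hcond
    calc ε * a * ℓ = α * τ * (a ^ 2 * ℓ) := by rw [hε]; ring
      _ ≤ α * τ * (4 * ((rhobar + 1) ^ 2 * η ^ 2) * ℓ) := by gcongr
      _ = 4 * (α * τ * ((rhobar + 1) ^ 2 * η ^ 2 * ℓ)) := by ring
      _ ≤ _ := by linarith
  have hδsq : δ ^ 2 ≤ 1 / 4 := by nlinarith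
  have hεa : ε * a ≤ 1 / 3 := by
    have := mul_le_mul_of_nonneg_left hℓ hεa0
    linarith
  have hε6 : ε ≤ 1 / 6 := by
    have := mul_le_mul_of_nonneg_left ha2 hε0
    linarith
  have hLδ : L * δ ≤ 13 * ℓ := by
    rw [mul_div_assoc', le_div_iff₀ hδ0] at hL
    exact hL
  refine ⟨hε6, ?_, ?_, ?_⟩
  · have h1 : L * δ * (ε * a) ≤ 13 * ℓ * (ε * a) := mul_le_mul_of_nonneg_right hLδ hεa0
    have h3 : δ * (68 * L * (ε * a)) ≤ δ * (δ / 2) := by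
      have := sq_nonneg δ
      linarith
    exact le_of_mul_le_mul_left h3 hδ0
  · have h0 : 1 ≤ a * τ := one_le_mul_of_one_le_of_one_le (by linarith) hτ
    have h1 : α * 1 ≤ α * (a * τ) := mul_le_mul_of_nonneg_left h0 hα.le
    have h3 : α ≤ 1 / 6 := by rw [hε, mul_assoc] at hε6; linarith
    have h4 : δ / 2 * α ≤ 1 * (1 / 6) := mul_le_mul (by linarith) h3 hα.le zero_le_one
    linarith
  · have hexp : 2.7 ≤ Real.exp 1 := by linarith [Real.exp_one_gt_d9]
    have h1 : 68 * L * (ε * a) * b ^ 2 * α / (δ / 2 * α) =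
        136 * (L * δ) * a ^ 2 * b ^ 2 * (α * τ) / δ ^ 2 := by
      rw [hε]; field_simp; ring
    have h3 : 136 * (L * δ) * a ^ 2 * b ^ 2 * (α * τ) ≤
        136 * (13 * ℓ) * (4 * ((rhobar + 1) ^ 2 * η ^ 2)) * b ^ 2 * (α * τ) := by gcongr
    have h4 : 0 ≤ ℓ * ((rhobar + 1) ^ 2 * η ^ 2) * b ^ 2 * (α * τ) := by positivity
    -- `7072 = 136 · 13 · 4`, from `136 = 2 · 68`, `L δ ≤ 13 ℓ` and `a² ≤ 4 (ρ̄ + 1)² η²`.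
    have h5 : (7072 : ℝ) ≤ 3648 * Real.exp 1 := by linarith
    have h6 := mul_le_mul_of_nonneg_right h5 h4
    have h7 : 136 * (L * δ) * a ^ 2 * b ^ 2 * (α * τ) ≤
        (3648 * Real.exp 1) * (ℓ * ((rhobar + 1) ^ 2 * η ^ 2) * b ^ 2 * (α * τ)) := by linarith
    rw [h1]
    calc _ ≤ (3648 * Real.exp 1) * (ℓ * ((rhobar + 1) ^ 2 * η ^ 2) * b ^ 2 * (α * τ)) / δ ^ 2 :=
          div_le_div_of_nonneg_right h7 (sq_nonneg δ)
      _ = _ := by ring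

variable {S A : Type*} [Fintype S] [DecidableEq S] [Fintype A]

/-- The iterates stay within a bounded distance of the initialization for a short time. -/
theorem MDP.norm_vtrace_sub_le (M : MDP S A) (πb π : Policy S A) {n : ℕ} {cbar rhobar : ℝ}
    (hc : 0 ≤ cbar) (hr : 0 ≤ rhobar) (hη : 0 ≤ eta n M.γ cbar) {α : ℝ} (hα : 0 ≤ α)
    (V₀ : S → ℝ) (x : ℕ → S) (z : ℕ → A) {l : ℕ}
    (hl : α * (2 * rhobar * eta n M.γ cbar) * l ≤ 1 / 2) :
    ‖M.vtrace πb π n cbar rhobar (fun _ => α) V₀ x z l - V₀‖ ≤ ‖V₀‖ + 1 := by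
  have hgrow := norm_sub_le_of_linear_growth
    (x := fun k => M.vtrace πb π n cbar rhobar (fun _ => α) V₀ x z k)
    (a := α * (2 * rhobar * eta n M.γ cbar)) (b := 1) (by positivity)
    (fun i => M.norm_vtrace_succ_sub_le πb π hc hr hα V₀ x z i) 0 l
  rw [zero_add] at hgrow
  have hpow := one_add_pow_le (a := α * (2 * rhobar * eta n M.γ cbar)) (by positivity) l
    (by rw [mul_comm]; linarith)
  exact hgrow.trans (mul_le_of_le_one_left (add_nonneg (norm_nonneg _) zero_le_one) (by linarith))

variable [MeasurableSpace S] [DiscreteMeasurableSpace S] [MeasurableSpace A]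
  [DiscreteMeasurableSpace A] {Ω : Type*} [MeasurableSpace Ω] {μ : Measure Ω}
  [IsProbabilityMeasure μ]

theorem MDP.IsTrajectory.integrable_vtrace {M : MDP S A} {πb : Policy S A} {X : ℕ → Ω → S}
    {Z : ℕ → Ω → A} (h : M.IsTrajectory πb μ X Z) (π : Policy S A) (n : ℕ) (cbar rhobar : ℝ)
    (α : ℕ → ℝ) (V₀ : S → ℝ) (k : ℕ) (T : (S → ℝ) → ℝ) :
    Integrable (fun ω => T (M.vtrace πb π n cbar rhobar α V₀ (fun i => X i ω)
      (fun i => Z i ω) k)) μ :=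
  h.integrable (j := k + n) (φ := fun x z => T (M.vtrace πb π n cbar rhobar α V₀ x z k))
    fun x x' z z' hx hz => congrArg T (M.histDep_vtrace n cbar rhobar α V₀ k x x' z z' hx hz)

/-- The finite-sample bound for asynchronous V-trace with an explicit stepsize condition. -/
theorem MDP.IsTrajectory.integral_norm_sq_vtrace_le {M : MDP S A} {πb π : Policy S A}
    {X : ℕ → Ω → S} {Z : ℕ → Ω → A} (h : M.IsTrajectory πb μ X Z) {n : ℕ} {cbar rhobar : ℝ}
    (hS : 2 ≤ Fintype.card S) (hn : 1 ≤ n) (hc : 1 ≤ cbar) (hcr : cbar ≤ rhobar)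
    (hcov : Covers πb π) (hirr : (M.stateMatrix πb).IsIrreducible)
    (hap : IsAperiodicChain (M.stateMatrix πb)) (V₀ : S → ℝ) {α : ℝ} (hα : 0 < α)
    {δ η : ℝ} {t : ℕ} (hδ : δ = 1 - M.beta πb π n cbar rhobar) (hη : η = eta n M.γ cbar)
    (ht : t = mixingTime (M.stateMatrix πb) α) {Vs : S → ℝ}
    (hVs : Vs = M.value (truncPolicy πb π rhobar (hc.trans hcr) hcov))
    (hcond : α * ((t + n : ℕ) : ℝ) ≤
      1 / 10000 * (δ ^ 2 / ((rhobar + 1) ^ 2 * η ^ 2 * Real.log (Fintype.card S))))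
    {k : ℕ} (hk : t + n ≤ k) :
    ∫ ω, ‖M.vtrace πb π n cbar rhobar (fun _ => α) V₀ (fun i => X i ω)
        (fun i => Z i ω) k - Vs‖ ^ 2 ∂μ ≤
      3 * (‖V₀ - Vs‖ + ‖V₀‖ + 1) ^ 2 * (1 - δ / 2 * α) ^ (k - (t + n)) +
      3648 * Real.exp 1 * (‖Vs‖ + 1) ^ 2 *
        (Real.log (Fintype.card S) * (rhobar + 1) ^ 2 * η ^ 2 / δ ^ 2) *
        (α * ((t + n : ℕ) : ℝ)) := by
  have : Nonempty S := Fintype.card_pos_iff.1 (by omega)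
  obtain ⟨N, hN⟩ := exists_pow_pos_of_irreducible_of_aperiodic hirr hap
  have hr : 1 ≤ rhobar := hc.trans hcr
  have hδmem : δ ∈ Set.Ioc (0 : ℝ) (1 / 2) := hδ ▸ M.one_sub_beta_mem hS hn hc hr hcov hN
  have hd2 : (2 : ℝ) ≤ Fintype.card S := by exact_mod_cast hS
  obtain ⟨p, u, hp, h2, hu, hu2, hd, huβ, hL⟩ := exists_exponent hd2 hδmem.1 hδmem.2
  have hη1 : 1 ≤ η := hη ▸ one_le_eta hn M.γ_pos.le (zero_le_one.trans hc)
  have hlog : 0.69 ≤ Real.log (Fintype.card S) := by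
    have h1 := Real.log_two_gt_d9
    have h2 := Real.log_le_log (by norm_num) hd2
    linarith
  have hτ1 : (1 : ℝ) ≤ ((t + n : ℕ) : ℝ) := by exact_mod_cast (by omega : 1 ≤ t + n)
  have hp0 : p ≠ 0 := by omega
  have hu0 : 0 ≤ u := by linarith
  have hL0 : 0 ≤ u ^ 2 + ((p : ℝ) - 1) * u ^ 2 * (1 + u) := by
    have hpR : (2 : ℝ) ≤ p := by exact_mod_cast h2
    exact add_nonneg (sq_nonneg u)
      (mul_nonneg (mul_nonneg (by linarith) (sq_nonneg u)) (by linarith))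
  obtain ⟨hε6, hsmall, hαδ, hnoise⟩ := stepsize_condition_consequences hr hη1 hlog hδmem hα hτ1
    hL rfl rfl hcond (‖Vs‖ + 1)
  have hint := h.integrable_vtrace π n cbar rhobar (fun _ => α) V₀
  have hrec : ∀ k, t + n ≤ k →
      ∫ ω, powNorm p (M.vtrace πb π n cbar rhobar (fun _ => α) V₀ (fun i => X i ω)
        (fun i => Z i ω) (k + 1) - Vs) ^ 2 ∂μ ≤ (1 - δ / 2 * α) *
      ∫ ω, powNorm p (M.vtrace πb π n cbar rhobar (fun _ => α) V₀ (fun i => X i ω)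
        (fun i => Z i ω) k - Vs) ^ 2 ∂μ +
        68 * (u ^ 2 + ((p : ℝ) - 1) * u ^ 2 * (1 + u)) *
          (α * (2 * rhobar * η) * ((t + n : ℕ) : ℝ) * (2 * rhobar * η)) *
          (‖Vs‖ + 1) ^ 2 * α := by
    subst ht hVs
    exact fun k hk => h.integral_powNorm_sq_succ_le hS hn hc hcr hcov hN V₀ hα hp h2 hu hu2 hd hδ
      huβ rfl (by rw [hη]) rfl hε6 hsmall hk
  have hgeom := le_geom_of_step_le (e := fun k => ∫ ω, powNorm p (M.vtrace πb π n cbar rhobar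
    (fun _ => α) V₀ (fun i => X i ω) (fun i => Z i ω) k - Vs) ^ 2 ∂μ)
    (mul_pos (half_pos hδmem.1) hα) hαδ
    (mul_nonneg (mul_nonneg (mul_nonneg (mul_nonneg (by norm_num) hL0)
      (by positivity)) (sq_nonneg _)) hα.le) hrec hk
  -- The recursion starts at `t + n`, where the iterate is still within `‖V₀‖ + 1` of `V₀`; passing
  -- to the `ℓ^p` norm costs `u² ≤ 2`, below the allowed 3.
  have hfirst : ∀ ω, powNorm p (M.vtrace πb π n cbar rhobar (fun _ => α) V₀ (fun i => X i ω)
      (fun i => Z i ω) (t + n) - Vs) ^ 2 ≤ 3 * (‖V₀ - Vs‖ + ‖V₀‖ + 1) ^ 2 := by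
    intro ω
    have h1 := M.norm_vtrace_sub_le πb π (n := n) (zero_le_one.trans hc) (zero_le_one.trans hr)
      (hη ▸ zero_le_one.trans hη1) hα.le V₀ (fun i => X i ω) (fun i => Z i ω) (l := t + n)
      (by rw [← hη]; linarith)
    generalize M.vtrace πb π n cbar rhobar (fun _ => α) V₀ (fun i => X i ω)
      (fun i => Z i ω) (t + n) = v at h1 ⊢
    have h3 : ‖v - Vs‖ ≤ ‖V₀ - Vs‖ + ‖V₀‖ + 1 := by
      have := norm_sub_le_norm_sub_add_norm_sub v V₀ Vs
      linarith
    calc _ ≤ (u * ‖v - Vs‖) ^ 2 :=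
          pow_le_pow_left₀ (powNorm_nonneg _ _) (powNorm_le_mul_norm hp0 hu0 hd _) 2
      _ = u ^ 2 * ‖v - Vs‖ ^ 2 := by ring
      _ ≤ 3 * (‖V₀ - Vs‖ + ‖V₀‖ + 1) ^ 2 := by
          gcongr
          linarith
  have hem := integral_mono (hint (t + n) fun v => powNorm p (v - Vs) ^ 2)
    (integrable_const _) hfirst
  rw [integral_const, probReal_univ, one_smul] at hem
  refine (integral_mono (hint k fun v => ‖v - Vs‖ ^ 2)
    (hint k fun v => powNorm p (v - Vs) ^ 2) fun ω =>
      pow_le_pow_left₀ (norm_nonneg _) (norm_le_powNorm hp0 _) 2).trans (hgeom.trans ?_)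
  exact add_le_add (mul_le_mul_of_nonneg_right hem (pow_nonneg (by linarith) _)) hnoise

end FiniteSampleBound

end

theorem theorem3p2 :
    ∃ c₀ : ℝ, 0 < c₀ ∧
      ∀ (S A : Type*) [Fintype S] [DecidableEq S] [MeasurableSpace S] [DiscreteMeasurableSpace S]
        [Fintype A] [MeasurableSpace A] [DiscreteMeasurableSpace A]
        (M : MDP S A) (πb π : Policy S A) (n : ℕ) (cbar rhobar : ℝ)
        (_hS : 2 ≤ Fintype.card S) (_hn : 1 ≤ n) (hc : 1 ≤ cbar) (hcr : cbar ≤ rhobar)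
        (hcov : Covers πb π) (_hirr : (M.stateMatrix πb).IsIrreducible)
        (_hap : IsAperiodicChain (M.stateMatrix πb)) (V₀ : S → ℝ) (α : ℝ) (_hα : 0 < α)
        (Ω : Type*) [MeasurableSpace Ω] (μ : Measure Ω) [IsProbabilityMeasure μ]
        (X : ℕ → Ω → S) (Z : ℕ → Ω → A) (_hXZ : M.IsTrajectory πb μ X Z),
        let β := M.beta πb π n cbar rhobar
        let η := eta n M.γ cbar
        let t := mixingTime (M.stateMatrix πb) α
        let Vstar : S → ℝ := M.value (truncPolicy πb π rhobar (hc.trans hcr) hcov)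
        let V : ℕ → Ω → S → ℝ := fun k ω =>
          M.vtrace πb π n cbar rhobar (fun _ => α) V₀ (fun i => X i ω) (fun i => Z i ω) k
        α * ((t : ℝ) + n) ≤
            c₀ * ((1 - β) ^ 2 / ((rhobar + 1) ^ 2 * η ^ 2 * Real.log (Fintype.card S))) →
        ∀ k : ℕ, t + n ≤ k →
          Integrable (fun ω => ‖V k ω - Vstar‖ ^ 2) μ ∧
          ∫ ω, ‖V k ω - Vstar‖ ^ 2 ∂μ ≤
            3 * (‖V₀ - Vstar‖ + ‖V₀‖ + 1) ^ 2 * (1 - (1 - β) / 2 * α) ^ (k - (t + n)) +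
            3648 * Real.exp 1 * (‖Vstar‖ + 1) ^ 2 *
              (Real.log (Fintype.card S) * (rhobar + 1) ^ 2 * η ^ 2 / (1 - β) ^ 2) *
              (α * ((t : ℝ) + n)) := by
  refine ⟨1 / 10000, by norm_num, ?_⟩
  intro S A _ _ _ _ _ _ _ M πb π n cbar rhobar hS hn hc hcr hcov hirr hap V₀ α hα Ω _ μ _ X Z hXZ
    β η t Vstar V hcond k hk
  refine ⟨hXZ.integrable_vtrace π n cbar rhobar _ V₀ k fun v => ‖v - Vstar‖ ^ 2, ?_⟩
  have h := hXZ.integral_norm_sq_vtrace_le (π := π) hS hn hc hcr hcov hirr hap V₀ hα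
    (δ := 1 - β) (η := η) (t := t) rfl rfl rfl (Vs := Vstar) rfl
    (by rw [Nat.cast_add]; exact hcond) hk
  rwa [Nat.cast_add] at h
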